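/- **The exploration process.** Let $G$ be a graph on the ordered vertex set $v_1<\dots<v_m$. At step $0$ the vertex $v_1$ is active and all other vertices are neutral. In step $t\in\{1,\dots,m\}$ let $w_t$ be the first active vertex if there is one, and the first neutral vertex otherwise; all neutral neighbours of $w_t$ become active, and then $w_t$ itself becomes explored. For a real number $x\in(0,m]$ let $\mathcal C_x$ be the connected component of $G$ being discovered at time $x$, that is, the component of $w_{\lceil x\rceil}$. (Equivalently, if $0=t_0<t_1<\dots$ are $0$ and the times at which no vertex is active, it is the component explored during the excursion $(t_{j-1},t_j]$ containing $x$, and $|\mathcal C_x|=t_j-t_{j-1}$.) **Theorem.** There exist $\delta\in(0,1/10)$ and constants $c,C>0$ such that the following holds for every integer $m$ and every real $\varepsilon\in(0,1]$ with $\varepsilon^3m\ge 1$ and $p=\frac{1+\varepsilon}{m}\in[0,1]$. For the random graph $G(m,p)$, with connected components $\mathcal C_1,\mathcal C_2,\dots$, (i) $\displaystyle \mathbb E\,|\mathcal C_{\delta\varepsilon m}|\le 2\varepsilon m-c\,\varepsilon^{-2}$; (ii) $\displaystyle \mathbb E\sum_{\mathcal C_j\ne\mathcal C_{\delta\varepsilon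 m}}|\mathcal C_j|^k\le C\,m\,\varepsilon^{-2k+3}$ for $k=2$ and $k=4$. -/

import Mathlib

open MeasureTheory

/-- The status of the vertices `v₁ < ⋯ < v_m` (here the elements of `Fin m`, in their usual order)
at some moment of the exploration process. Vertices that are neither active nor explored are
neutral. -/
structure ExplorationState (m : ℕ) where
  active : Finset (Fin m)
  explored : Finset (Fin m)

namespace ExplorationState

variable {m : ℕ}

/-- The neutral vertices. -/
def neutral (s : ExplorationState m) : Finset (Fin m) :=
  (s.active ∪ s.explored)ᶜ

/-- Step `0`: the first vertex is active and all the others are neutral. -/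
def start (m : ℕ) : ExplorationState m where
  active := Finset.univ.filter fun v => (v : ℕ) = 0
  explored := ∅

/-- The vertex treated in the next step: the first active vertex if there is one, and otherwise the
first neutral vertex (`none` only when every vertex has been explored). -/
def next (s : ExplorationState m) : Option (Fin m) :=
  if h : s.active.Nonempty then some (s.active.min' h)
  else if h : s.neutral.Nonempty then some (s.neutral.min' h)
  else none

open Classical in
/-- One step of the exploration of `G`: with `w` the next vertex, the neutral neighbours of `w`
become active, and `w` itself becomes explored. -/
noncomputable def step (G : SimpleGraph (Fin m)) (s : ExplorationState m) : ExplorationState m :=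
  match s.next with
  | none => s
  | some w =>
    { active := (s.active ∪ s.neutral.filter fun v => G.Adj w v).erase w
      explored := insert w s.explored }

end ExplorationState

/-- The state of the exploration process of `G` after the completion of step `t`. -/
noncomputable def explorationState {m : ℕ} (G : SimpleGraph (Fin m)) :
    ℕ → ExplorationState m
  | 0 => ExplorationState.start m
  | t + 1 => (explorationState G t).step G

/-- The vertex `w_t` treated in step `t` of the exploration process, for `1 ≤ t ≤ m`. -/
noncomputable def vertexAtStep {m : ℕ} (G : SimpleGraph (Fin m)) (t : ℕ) : Option (Fin m) :=
  (explorationState G (t - 1)).next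

/-- The connected component that the exploration process is discovering at the real time `x`, for
`0 < x ≤ m`. Step `t` occupies the time interval `(t - 1, t]`, so this is the component of `w_t`
with `t = ⌈x⌉`; equivalently, if `0 = t₀ < t₁ < ⋯` are `0` and the times at which there is no active
vertex, it is the component explored during the excursion `(t_{j-1}, t_j]` which contains `x`. -/
noncomputable def componentAtTime {m : ℕ} (G : SimpleGraph (Fin m)) (x : ℝ) :
    Option G.ConnectedComponent :=
  (vertexAtStep G ⌈x⌉₊).map G.connectedComponentMk

/-- The number of vertices `|C|` of the component at time `x`. -/
noncomputable def componentSizeAtTime {m : ℕ} (G : SimpleGraph (Fin m)) (x : ℝ) : ℕ :=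
  match componentAtTime G x with
  | none => 0
  | some C => C.supp.ncard

open Classical in
/-- The sum of `|C_j| ^ k` over all connected components `C_j` of `G` other than the one being
discovered at time `x`. -/
noncomputable def sumOtherComponents {m : ℕ} (G : SimpleGraph (Fin m)) (x : ℝ) (k : ℕ) : ℕ :=
  ∑ C : G.ConnectedComponent with componentAtTime G x ≠ some C, C.supp.ncard ^ k

theorem ExplorationState.card_explored_step {m : ℕ} (G : SimpleGraph (Fin m))
    (s : ExplorationState m) (hd : Disjoint s.active s.explored) (hc : s.explored.card < m) :
    Disjoint (s.step G).active (s.step G).explored ∧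
      (s.step G).explored.card = s.explored.card + 1 ∧ s.next.isSome := by
  classical
  obtain ⟨w, hw, hwe⟩ : ∃ w, s.next = some w ∧ w ∉ s.explored := by
    unfold ExplorationState.next
    split_ifs with h h'
    · exact ⟨_, rfl, Finset.disjoint_left.1 hd (Finset.min'_mem _ h)⟩
    · refine ⟨_, rfl, fun hmem => ?_⟩
      have := Finset.min'_mem _ h'
      simp only [ExplorationState.neutral, Finset.mem_compl, Finset.mem_union, not_or] at this
      exact this.2 hmem
    · exfalso
      rw [Finset.not_nonempty_iff_eq_empty] at h h'
      rw [ExplorationState.neutral, h, Finset.empty_union, Finset.compl_eq_empty_iff] at h'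
      rw [h', Finset.card_univ, Fintype.card_fin] at hc
      exact lt_irrefl _ hc
  have hs : s.step G =
      { active := (s.active ∪ s.neutral.filter fun v => G.Adj w v).erase w
        explored := insert w s.explored } := by
    unfold ExplorationState.step
    rw [hw]
  rw [hs, hw]
  refine ⟨?_, Finset.card_insert_of_notMem hwe, rfl⟩
  rw [Finset.disjoint_left]
  intro v hv hv'
  simp only [Finset.mem_erase, Finset.mem_union, Finset.mem_filter, ExplorationState.neutral,
    Finset.mem_compl, not_or] at hv
  rcases Finset.mem_insert.1 hv' with h | h
  · exact hv.1 h
  · rcases hv.2 with h2 | h2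
    · exact Finset.disjoint_left.1 hd h2 h
    · exact h2.1.2 h

/-- After step `t` there are exactly `t` explored vertices. -/
theorem card_explored_explorationState {m : ℕ} (G : SimpleGraph (Fin m)) (t : ℕ) (ht : t ≤ m) :
    Disjoint (explorationState G t).active (explorationState G t).explored ∧
      (explorationState G t).explored.card = t := by
  induction t with
  | zero => simp [explorationState, ExplorationState.start]
  | succ t ih =>
    obtain ⟨h1, h2⟩ := ih (by omega)
    obtain ⟨h3, h4, -⟩ := ExplorationState.card_explored_step G _ h1 (by omega)
    exact ⟨h3, by rw [explorationState, h4, h2]⟩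

/-- The component at time `x` exists for every `0 < x ≤ m`. -/
theorem componentAtTime_isSome {m : ℕ} (G : SimpleGraph (Fin m)) (x : ℝ) (h0 : 0 < x)
    (hm : x ≤ m) : (componentAtTime G x).isSome := by
  have h1 : 0 < ⌈x⌉₊ := Nat.ceil_pos.2 h0
  have h2 : ⌈x⌉₊ ≤ m := Nat.ceil_le.2 hm
  obtain ⟨h3, h4⟩ := card_explored_explorationState G (⌈x⌉₊ - 1) (by omega)
  have := (ExplorationState.card_explored_step G _ h3 (by omega)).2.2
  simpa [componentAtTime, vertexAtStep] using this

/-- There are finitely many graphs on `m` vertices, so every expectation over `G(m, p)` is that of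
an integrable function. -/
theorem integrable_binomialRandom {m : ℕ} (p : unitInterval) (f : SimpleGraph (Fin m) → ℝ) :
    Integrable f (SimpleGraph.binomialRandom (Fin m) p) := by
  have : MeasurableSingletonClass (SimpleGraph (Fin m)) := ⟨fun G => by
    rw [← (SimpleGraph.measurableEmbedding_edgeSet).measurableSet_image, Set.image_singleton]
    exact measurableSet_singleton _⟩
  exact Integrable.of_finite

/-! An edge between two unexplored vertices is never inspected before it is needed, so the numbers n
of neutral and a of active vertices form a Markov chain with binomial steps. Expectations over the
graph become expectations `chainRun` for this chain, and these are bounded by supermartingales V t n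
a (`chainRun_le`). Let T = ⌈δεm⌉ and let ζ be the first time t ≥ T without active vertices. The
component at time T is explored by time ζ, hence has at most ζ vertices.

Part (i). While a > 0 the mean increment of a is at most ε - p(t+1), and each newly begun component
contributes an extra 1. So a - `drift` grows in mean only through the number of components begun by
time T, which Z bounds (`ReachBound`); Z is about 1/(2ε). The parabola `drift` vanishes at 0 and at
z = 2ε/p - 1, so stopping at ζ gives E ζ(ζ - z) ≤ 2Z/p. If ε ≥ 1/1000, Jensen's inequality suffices,
because 2εm - z exceeds 2ε²m/(1+ε). For small ε it would only give about z + ε⁻²/2, and fluctuations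
must be used. With Ψ = pz²/8 the height of the parabola and D = a - drift + Ψ + S, the quantity U =
(z/2)(1 + √(D/Ψ)) is at least ζ at time ζ. By concavity of the root, U loses in each step an amount
proportional to the variance. Over about z steps this is about ε⁻², against a cost of about ε⁻²/2
caused by Z (`chainRun_gain`, `lt_of_gain`).

Part (ii). The sum of |C|^k is a sum of |C(v)|^j over vertices, with j = k - 1. Components explored
before that of time T have fewer than T vertices, and excursions that short have j-th moment
O(ε^(1-2j)) (`chainRun_pow_small`). The other vertices are still neutral at ζ. If pζ ≥ 11ε/10, what
remains is subcritical and the moment is again O(ε^(1-2j)) (`chainRun_pow_subcritical`). Otherwise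
the crude moment bound O(ε(εm)^j) of `chainRun_pow_le` is used; such an early stop has probability
exponentially small in ε³m, by the supermartingale (1 + b e^(pt))^n (`chainRun_le_of_late`). -/

/-! ### Binomial expectations -/

/-- The expectation of `f X` for a binomial random variable `X` with parameters `n` and `p`. -/
noncomputable def binomialMean (p : ℝ) : ℕ → (ℕ → ℝ) → ℝ
  | 0, f => f 0
  | n + 1, f => (1 - p) * binomialMean p n f + p * binomialMean p n fun k => f (k + 1)

namespace binomialMean

variable {p : ℝ}

theorem mono (h0 : 0 ≤ p) (h1 : p ≤ 1) {n : ℕ} {f g : ℕ → ℝ} (h : ∀ k ≤ n, f k ≤ g k) :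
    binomialMean p n f ≤ binomialMean p n g := by
  induction n generalizing f g with
  | zero => exact h 0 le_rfl
  | succ n ih =>
    have h2 : 0 ≤ 1 - p := by linarith
    exact add_le_add (mul_le_mul_of_nonneg_left (ih fun k hk => h k (by omega)) h2)
      (mul_le_mul_of_nonneg_left (ih fun k hk => h (k + 1) (by omega)) h0)

theorem congr {n : ℕ} {f g : ℕ → ℝ} (h : ∀ k ≤ n, f k = g k) :
    binomialMean p n f = binomialMean p n g := by
  induction n generalizing f g with
  | zero => exact h 0 le_rfl
  | succ n ih =>
    simp only [binomialMean]
    rw [ih fun k hk => h k (by omega), ih fun k hk => h (k + 1) (by omega)]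

theorem add (n : ℕ) (f g : ℕ → ℝ) :
    binomialMean p n (fun k => f k + g k) = binomialMean p n f + binomialMean p n g := by
  induction n generalizing f g with
  | zero => rfl
  | succ n ih => simp only [binomialMean, ih]; ring

theorem const_mul (n : ℕ) (c : ℝ) (f : ℕ → ℝ) :
    binomialMean p n (fun k => c * f k) = c * binomialMean p n f := by
  induction n generalizing f with
  | zero => rfl
  | succ n ih => simp only [binomialMean, ih]; ring

theorem const (n : ℕ) (c : ℝ) : binomialMean p n (fun _ => c) = c := by
  induction n with
  | zero => rfl
  | succ n ih => simp only [binomialMean, ih]; ring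

theorem sub (n : ℕ) (f g : ℕ → ℝ) :
    binomialMean p n (fun k => f k - g k) = binomialMean p n f - binomialMean p n g := by
  induction n generalizing f g with
  | zero => rfl
  | succ n ih => simp only [binomialMean, ih]; ring

theorem pow (n : ℕ) (x : ℝ) : binomialMean p n (fun k => x ^ k) = (1 - p + p * x) ^ n := by
  induction n with
  | zero => simp [binomialMean]
  | succ n ih =>
    simp only [binomialMean, pow_succ, ih]
    have := const_mul (p := p) n x (fun k => x ^ k)
    simp only [mul_comm _ x, this, ih]; ring

theorem pow_sub (n : ℕ) (x : ℝ) :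
    binomialMean p n (fun k => x ^ (n - k)) = (p + (1 - p) * x) ^ n := by
  induction n with
  | zero => simp [binomialMean]
  | succ n ih =>
    have h1 : binomialMean p n (fun k => x ^ (n + 1 - k)) =
        x * binomialMean p n (fun k => x ^ (n - k)) := by
      rw [← const_mul]
      exact congr fun k hk => by rw [Nat.sub_add_comm hk, pow_succ, mul_comm]
    simp only [binomialMean, h1, Nat.add_sub_add_right, ih]; ring

theorem cast (n : ℕ) : binomialMean p n (fun k => (k : ℝ)) = n * p := by
  induction n with
  | zero => simp [binomialMean]
  | succ n ih => simp only [binomialMean, Nat.cast_add, Nat.cast_one, add, const, ih]; ring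

theorem cast_sq (n : ℕ) :
    binomialMean p n (fun k => (k : ℝ) ^ 2) = n * p * (1 - p) + (n * p) ^ 2 := by
  induction n with
  | zero => simp [binomialMean]
  | succ n ih =>
    have h : (fun k : ℕ => ((k + 1 : ℕ) : ℝ) ^ 2) = fun k : ℕ => ((k : ℝ) ^ 2 + 2 * k) + 1 := by
      funext k; push_cast; ring
    simp only [binomialMean, h, add, const, ih, const_mul, cast]; push_cast; ring

theorem cast_cube (n : ℕ) :
    binomialMean p n (fun k => (k : ℝ) ^ 3) =
      n * p * (1 - p) * (1 - 2 * p) + 3 * (n * p) * (n * p * (1 - p)) + (n * p) ^ 3 := by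
  induction n with
  | zero => simp [binomialMean]
  | succ n ih =>
    have h : (fun k : ℕ => ((k + 1 : ℕ) : ℝ) ^ 3) =
        fun k : ℕ => ((k : ℝ) ^ 3 + 3 * (k : ℝ) ^ 2) + 3 * k + 1 := by
      funext k; push_cast; ring
    simp only [binomialMean, h, add, const, ih, const_mul, cast, cast_sq]; push_cast; ring

end binomialMean

/-! ### Random subsets of a finite set -/

/-- The expectation of `R S`, where `S` is the random subset of `D` which contains every element
independently with probability `p`. -/
noncomputable def subsetMean {α : Type*} (p : ℝ) (D : Finset α) (R : Finset α → ℝ) : ℝ :=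
  ∑ S ∈ D.powerset, p ^ S.card * (1 - p) ^ (D.card - S.card) * R S

namespace subsetMean

variable {α β : Type*} {p : ℝ}

theorem empty (R : Finset α → ℝ) : subsetMean p ∅ R = R ∅ := by simp [subsetMean]

theorem congr {D : Finset α} {R R' : Finset α → ℝ} (h : ∀ S ⊆ D, R S = R' S) :
    subsetMean p D R = subsetMean p D R' :=
  Finset.sum_congr rfl fun S hS => by rw [h S (Finset.mem_powerset.1 hS)]

variable [DecidableEq α] [DecidableEq β]

theorem insert {D : Finset α} {e : α} (he : e ∉ D) (R : Finset α → ℝ) :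
    subsetMean p (insert e D) R =
      (1 - p) * subsetMean p D R + p * subsetMean p D fun S => R (Insert.insert e S) := by
  unfold subsetMean
  rw [Finset.sum_powerset_insert he, Finset.mul_sum, Finset.mul_sum]
  congr 1
  · refine Finset.sum_congr rfl fun S hS => ?_
    have := Finset.card_le_card (Finset.mem_powerset.1 hS)
    rw [Finset.card_insert_of_notMem he, Nat.sub_add_comm this, pow_succ]; ring
  · refine Finset.sum_congr rfl fun S hS => ?_
    have h : e ∉ S := fun h => he (Finset.mem_powerset.1 hS h)
    rw [Finset.card_insert_of_notMem he, Finset.card_insert_of_notMem h, Nat.add_sub_add_right,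
      pow_succ]; ring

theorem const (D : Finset α) (c : ℝ) : subsetMean p D (fun _ => c) = c := by
  induction D using Finset.induction_on with
  | empty => simp [empty]
  | insert e D he ih => rw [insert he, ih]; ring

/-- Independence over disjoint sets of pairs; it separates the edges at the vertex being treated
from all others. -/
theorem union {D₁ D₂ : Finset α} (h : Disjoint D₁ D₂) (R : Finset α → ℝ) :
    subsetMean p (D₁ ∪ D₂) R = subsetMean p D₁ fun S₁ => subsetMean p D₂ fun S₂ => R (S₁ ∪ S₂) := by
  induction D₁ using Finset.induction_on generalizing R with
  | empty => simp [empty]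
  | insert e D he ih =>
    rw [Finset.disjoint_insert_left] at h
    rw [insert he, Finset.insert_union, insert (by simp [he, h.1]), ih h.2, ih h.2]
    simp only [Finset.insert_union]

theorem image {f : α → β} (hf : Function.Injective f) (D : Finset α) (R : Finset β → ℝ) :
    subsetMean p (D.image f) R = subsetMean p D fun S => R (S.image f) := by
  induction D using Finset.induction_on generalizing R with
  | empty => simp [empty]
  | insert e D he ih =>
    rw [insert he, Finset.image_insert, insert (by simpa [hf.eq_iff] using he), ih, ih]
    simp only [Finset.image_insert]

theorem card (D : Finset α) (g : ℕ → ℝ) :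
    subsetMean p D (fun S => g S.card) = binomialMean p D.card g := by
  induction D using Finset.induction_on generalizing g with
  | empty => simp [empty, binomialMean]
  | insert e D he ih =>
    rw [insert he, Finset.card_insert_of_notMem he, binomialMean, ih,
      ← ih fun k => g (k + 1)]
    congr 2
    exact congr fun S hS => by rw [Finset.card_insert_of_notMem fun h => he (hS h)]

end subsetMean

/-- The pairs of distinct elements. -/
def edgePairs (V : Type*) [Fintype V] [DecidableEq V] : Finset (Sym2 V) :=
  Finset.univ.filter fun e => ¬ e.IsDiag

/-- The expectation over the binomial random graph, as an expectation over a random set of pairs. -/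
theorem integral_binomialRandom {V : Type*} [Fintype V] [DecidableEq V] (p : unitInterval)
    (R : SimpleGraph V → ℝ) :
    ∫ G, R G ∂(SimpleGraph.binomialRandom V p) =
      subsetMean (p : ℝ) (edgePairs V) fun S => R (SimpleGraph.fromEdgeSet (S : Set (Sym2 V))) := by
  classical
  have hD : ((edgePairs V : Finset (Sym2 V)) : Set (Sym2 V)) = Sym2.diagSetᶜ := by
    ext e; simp [edgePairs, Sym2.diagSet]
  have hms : MeasurableSingletonClass (Set (Sym2 V)) := inferInstance
  have hmg : MeasurableSingletonClass (SimpleGraph V) := ⟨fun G => by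
    rw [← (SimpleGraph.measurableEmbedding_edgeSet).measurableSet_image, Set.image_singleton]
    exact measurableSet_singleton _⟩
  rw [SimpleGraph.binomialRandom_eq_map, integral_map SimpleGraph.measurable_fromEdgeSet.aemeasurable
    (by exact (measurable_of_finite R).aestronglyMeasurable), integral_fintype Integrable.of_finite]
  rw [← (Fintype.finsetEquivSet (α := Sym2 V)).sum_comp]
  unfold subsetMean
  rw [← Finset.sum_subset (Finset.subset_univ (edgePairs V).powerset)]
  · refine Finset.sum_congr rfl fun S hS => ?_
    rw [Finset.mem_powerset] at hS
    have hsub : (S : Set (Sym2 V)) ⊆ Sym2.diagSetᶜ := by rw [← hD]; exact_mod_cast hS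
    simp only [Fintype.finsetEquivSet_apply]
    rw [ProbabilityTheory.setBernoulli_real_singleton p hsub (Set.toFinite _), smul_eq_mul, ← hD,
      ← Finset.coe_sdiff, Set.ncard_coe_finset, Set.ncard_coe_finset, Finset.card_sdiff_of_subset hS]
  · intro S _ hS
    rw [Finset.mem_powerset] at hS
    have hsub : ¬ (S : Set (Sym2 V)) ⊆ Sym2.diagSetᶜ := by rw [← hD]; exact_mod_cast hS
    simp only [Fintype.finsetEquivSet_apply]
    rw [measureReal_def, ProbabilityTheory.setBernoulli_singleton_of_not_subset p hsub]; simp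


/-! ### The exploration process as a Markov chain -/

/-- One step of the chain of the numbers `(n, a)` of neutral and active vertices. -/
noncomputable def stepMean (p : ℝ) (f : ℕ → ℕ → ℝ) : ℕ → ℕ → ℝ
  | n, a + 1 => binomialMean p n fun k => f (n - k) (a + k)
  -- The treated vertex is itself taken from the neutral ones, so `n` candidates remain and no
  -- active vertex is used up.
  | n + 1, 0 => binomialMean p n fun k => f (n - k) k
  | 0, 0 => f 0 0

/-- The expectation of `ρ t n a` at the first time `t ≥ T` without active vertices, when the chain
of the numbers of neutral and active vertices is run for at most the given number of steps. -/
noncomputable def chainRun (p : ℝ) (T : ℕ) (ρ : ℕ → ℕ → ℕ → ℝ) : ℕ → ℕ → ℕ → ℕ → ℝ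
  -- In the uses below the number of allowed steps is at least the number of unexplored vertices, so
  -- this case only occurs when all are explored.
  | 0, t, n, a => ρ t n a
  | f + 1, t, n, a =>
    if T ≤ t ∧ a = 0 then ρ t n a else stepMean p (chainRun p T ρ f (t + 1)) n a

/-- The value of `R` at the first time `t ≥ T` without active vertices, when the exploration is run
for at most the given number of steps. -/
noncomputable def explorationRun {m : ℕ} {β : Type*} (T : ℕ)
    (R : ℕ → ExplorationState m → SimpleGraph (Fin m) → β) :
    ℕ → ℕ → ExplorationState m → SimpleGraph (Fin m) → β
  | 0, t, s, G => R t s G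
  | f + 1, t, s, G =>
    if T ≤ t ∧ s.active.card = 0 then R t s G else explorationRun T R f (t + 1) (s.step G) G

/-- The two graphs have the same edges outside `E`. -/
def AgreeOff {V : Type*} (E : Finset V) (G G' : SimpleGraph V) : Prop :=
  ∀ u ∉ E, ∀ v ∉ E, G.Adj u v ↔ G'.Adj u v

namespace ExplorationState

variable {m : ℕ}

/-- The state reached when `w` is explored and the neutral vertices in `B` become active. -/
def advance (s : ExplorationState m) (w : Fin m) (B : Finset (Fin m)) : ExplorationState m where
  active := (s.active ∪ B).erase w
  explored := insert w s.explored

/-- No vertex is both active and explored. -/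
def Valid (s : ExplorationState m) : Prop := Disjoint s.active s.explored

theorem mem_neutral {s : ExplorationState m} {v : Fin m} :
    v ∈ s.neutral ↔ v ∉ s.active ∧ v ∉ s.explored := by
  simp [neutral]

theorem next_eq_none {s : ExplorationState m} (h : s.next = none) :
    s.active = ∅ ∧ s.neutral = ∅ := by
  unfold next at h
  split_ifs at h with h1 h2
  exact ⟨Finset.not_nonempty_iff_eq_empty.1 h1, Finset.not_nonempty_iff_eq_empty.1 h2⟩

theorem next_eq_some {s : ExplorationState m} {w : Fin m} (h : s.next = some w) :
    w ∈ s.active ∨ (s.active = ∅ ∧ w ∈ s.neutral) := by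
  unfold next at h
  split_ifs at h with h1 h2
  · left; rw [← Option.some.inj h]; exact Finset.min'_mem _ h1
  · right
    exact ⟨Finset.not_nonempty_iff_eq_empty.1 h1, by
      rw [← Option.some.inj h]; exact Finset.min'_mem _ h2⟩

theorem notMem_explored_of_next {s : ExplorationState m} (hs : s.Valid) {w : Fin m}
    (h : s.next = some w) : w ∉ s.explored := by
  rcases next_eq_some h with h | ⟨-, h⟩
  · exact Finset.disjoint_left.1 hs h
  · exact (mem_neutral.1 h).2

theorem step_of_none {s : ExplorationState m} (G : SimpleGraph (Fin m)) (h : s.next = none) :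
    s.step G = s := by
  unfold step; rw [h]

open Classical in
theorem step_of_some {s : ExplorationState m} (G : SimpleGraph (Fin m)) {w : Fin m}
    (h : s.next = some w) : s.step G = s.advance w (s.neutral.filter fun v => G.Adj w v) := by
  unfold step; rw [h]; rfl

theorem Valid.advance {s : ExplorationState m} (hs : s.Valid) (w : Fin m) {B : Finset (Fin m)}
    (hB : B ⊆ s.neutral) : (s.advance w B).Valid := by
  unfold Valid ExplorationState.advance
  rw [Finset.disjoint_left]
  intro v hv hv'
  simp only [Finset.mem_erase, Finset.mem_union, Finset.mem_insert] at hv hv'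
  rcases hv' with h | h
  · exact hv.1 h
  · rcases hv.2 with h2 | h2
    · exact Finset.disjoint_left.1 hs h2 h
    · exact (mem_neutral.1 (hB h2)).2 h

theorem Valid.step {s : ExplorationState m} (hs : s.Valid) (G : SimpleGraph (Fin m)) :
    (s.step G).Valid := by
  classical
  rcases h : s.next with _ | w
  · rwa [step_of_none G h]
  · rw [step_of_some G h]
    exact hs.advance w (Finset.filter_subset _ _)

theorem neutral_advance {s : ExplorationState m} {w : Fin m} {B : Finset (Fin m)} :
    (s.advance w B).neutral = (s.neutral.erase w) \ B := by
  ext v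
  simp only [mem_neutral, ExplorationState.advance, Finset.mem_sdiff, Finset.mem_erase,
    Finset.mem_union, Finset.mem_insert]
  tauto

theorem card_neutral_advance {s : ExplorationState m} {w : Fin m} {B : Finset (Fin m)}
    (hB : B ⊆ s.neutral.erase w) :
    (s.advance w B).neutral.card = (s.neutral.erase w).card - B.card := by
  rw [neutral_advance, Finset.card_sdiff_of_subset hB]

theorem step_congr {s : ExplorationState m} (hs : s.Valid) {G G' : SimpleGraph (Fin m)}
    (h : AgreeOff s.explored G G') : s.step G = s.step G' := by
  classical
  rcases hn : s.next with _ | w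
  · rw [step_of_none G hn, step_of_none G' hn]
  · rw [step_of_some G hn, step_of_some G' hn]
    congr 1
    exact Finset.filter_congr fun v hv =>
      h w (notMem_explored_of_next hs hn) v (mem_neutral.1 hv).2

theorem explored_subset_step (s : ExplorationState m) (G : SimpleGraph (Fin m)) :
    s.explored ⊆ (s.step G).explored := by
  classical
  rcases hn : s.next with _ | w
  · rw [step_of_none G hn]
  · rw [step_of_some G hn]; exact Finset.subset_insert _ _

end ExplorationState

/-! ### Transfer of expectations from the random graph to the chain. -/

open ExplorationState

/-- The value of `R` at a state depends only on the edges between vertices that are not yet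
explored. -/
def IsLocal {m : ℕ} {β : Type*} (R : ExplorationState m → SimpleGraph (Fin m) → β) : Prop :=
  ∀ s, s.Valid → ∀ G G', AgreeOff s.explored G G' → R s G = R s G'

/-- The expectation of `R` at a state is a function `ρ` of the numbers of neutral and of active
vertices. -/
def HasMean {m : ℕ} (p : unitInterval) (R : ExplorationState m → SimpleGraph (Fin m) → ℝ)
    (ρ : ℕ → ℕ → ℝ) : Prop :=
  ∀ s, s.Valid → ∫ G, R s G ∂(SimpleGraph.binomialRandom (Fin m) p) =
    ρ s.neutral.card s.active.card

section transfer

variable {m : ℕ} {p : unitInterval}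

theorem IsLocal.step {β : Type*} {R : ExplorationState m → SimpleGraph (Fin m) → β}
    (hR : IsLocal R) : IsLocal fun s G => R (s.step G) G := by
  intro s hs G G' h
  simp only
  rw [step_congr hs h]
  exact hR _ (hs.step G') G G' fun u hu v hv =>
    h u (fun h' => hu (explored_subset_step s G' h')) v
      (fun h' => hv (explored_subset_step s G' h'))

/-- Deferred decisions. The pairs `D₁` joining `w` to the other neutral vertices decide the step;
afterwards `w` is explored and `R` is blind to edges at `w`, so it sees only the independent pairs
`D₂`. Resampling `D₁` changes nothing, hence `hm` can be applied with the full random graph and no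
conditioning is needed. -/
theorem integral_advance {R : ExplorationState m → SimpleGraph (Fin m) → ℝ} {ρ : ℕ → ℕ → ℝ}
    (hR : IsLocal R) (hm : HasMean p R ρ) {s : ExplorationState m} (hs : s.Valid) {w : Fin m}
    (hw : s.next = some w) :
    ∫ G, R (s.step G) G ∂(SimpleGraph.binomialRandom (Fin m) p) =
      subsetMean (p : ℝ) (s.neutral.erase w) fun B =>
        ρ (s.advance w B).neutral.card (s.advance w B).active.card := by
  classical
  set U := s.neutral.erase w with hU
  have hinj : Function.Injective fun v : Fin m => s(w, v) := fun a b h => Sym2.congr_right.1 h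
  set D₁ := U.image fun v => s(w, v) with hD₁
  have hsub : D₁ ⊆ edgePairs (Fin m) := by
    intro e he
    obtain ⟨v, hv, rfl⟩ := Finset.mem_image.1 he
    simp only [edgePairs, Finset.mem_filter, Finset.mem_univ, true_and, Sym2.mk_isDiag_iff]
    exact fun h => (Finset.mem_erase.1 hv).1 h.symm
  set D₂ := edgePairs (Fin m) \ D₁ with hD₂
  have hunion : edgePairs (Fin m) = D₁ ∪ D₂ := (Finset.union_sdiff_of_subset hsub).symm
  have hdisj : Disjoint D₁ D₂ := Finset.disjoint_sdiff
  have hwD : ∀ v, s(w, v) ∈ D₁ ↔ v ∈ U := fun v => by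
    rw [hD₁, Finset.mem_image]
    exact ⟨fun ⟨x, hx, h⟩ => hinj h ▸ hx, fun h => ⟨v, h, rfl⟩⟩
  have hloc : ∀ B ⊆ U, ∀ S₁ ⊆ D₁, ∀ S₂ : Finset (Sym2 (Fin m)),
      R (s.advance w B) (SimpleGraph.fromEdgeSet ((S₁ ∪ S₂ : Finset _) : Set (Sym2 (Fin m)))) =
        R (s.advance w B) (SimpleGraph.fromEdgeSet (S₂ : Set (Sym2 (Fin m)))) := by
    intro B hB S₁ hS₁ S₂
    refine hR _ (hs.advance w (hB.trans (Finset.erase_subset _ _))) _ _ fun u hu v hv => ?_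
    have hu' : u ≠ w := fun h => hu (h ▸ Finset.mem_insert_self _ _)
    have hv' : v ≠ w := fun h => hv (h ▸ Finset.mem_insert_self _ _)
    have : s(u, v) ∉ S₁ := fun h => by
      obtain ⟨x, -, hx⟩ := Finset.mem_image.1 (hS₁ h)
      rcases Sym2.eq_iff.1 hx with h | h
      · exact hu' h.1.symm
      · exact hv' h.1.symm
    simp [this]
  have hval : ∀ B ⊆ U, subsetMean (p : ℝ) D₂ (fun S₂ => R (s.advance w B)
      (SimpleGraph.fromEdgeSet (S₂ : Set (Sym2 (Fin m))))) =
        ρ (s.advance w B).neutral.card (s.advance w B).active.card := by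
    intro B hB
    rw [← hm _ (hs.advance w (hB.trans (Finset.erase_subset _ _))), integral_binomialRandom, hunion,
      subsetMean.union hdisj]
    exact (subsetMean.const (p := (p : ℝ)) D₁ _).symm.trans (subsetMean.congr fun S₁ hS₁ =>
      subsetMean.congr fun S₂ _ => (hloc B hB S₁ hS₁ S₂).symm)
  rw [integral_binomialRandom, hunion, subsetMean.union hdisj, hD₁, subsetMean.image hinj]
  refine subsetMean.congr fun B hB => ?_
  rw [← hval B hB]
  refine subsetMean.congr fun S₂ hS₂ => ?_
  have hB₁ : B.image (fun v => s(w, v)) ⊆ D₁ := Finset.image_subset_image hB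
  rw [← hloc B hB _ hB₁ S₂, step_of_some _ hw]
  congr 2
  ext v
  simp only [Finset.mem_filter, SimpleGraph.fromEdgeSet_adj, Finset.coe_union, Set.mem_union,
    Finset.mem_coe]
  constructor
  · rintro ⟨hv, h, hne⟩
    rcases h with h | h
    · obtain ⟨x, hx, h⟩ := Finset.mem_image.1 h
      exact hinj h ▸ hx
    · exact absurd ((hwD v).2 (Finset.mem_erase.2 ⟨hne.symm, hv⟩)) (Finset.mem_sdiff.1 (hS₂ h)).2
  · intro hv
    have := Finset.mem_erase.1 (hB hv)
    exact ⟨this.2, Or.inl (Finset.mem_image_of_mem _ hv), this.1.symm⟩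

theorem HasMean.step {R : ExplorationState m → SimpleGraph (Fin m) → ℝ} {ρ : ℕ → ℕ → ℝ}
    (hR : IsLocal R) (hm : HasMean p R ρ) :
    HasMean p (fun s G => R (s.step G) G) (stepMean p ρ) := by
  classical
  intro s hs
  rcases hw : s.next with _ | w
  · obtain ⟨h1, h2⟩ := next_eq_none hw
    simp only [step_of_none _ hw]
    rw [hm s hs, h1, h2]; rfl
  · rw [integral_advance hR hm hs hw]
    rcases next_eq_some hw with h | ⟨h, h'⟩
    · have hwn : w ∉ s.neutral := fun h' => (mem_neutral.1 h').1 h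
      have hpos : 0 < s.active.card := Finset.card_pos.2 ⟨w, h⟩
      obtain ⟨a, ha⟩ : ∃ a, s.active.card = a + 1 := ⟨s.active.card - 1, by omega⟩
      rw [ha, stepMean, ← subsetMean.card, Finset.erase_eq_of_notMem hwn]
      refine subsetMean.congr fun B hB => ?_
      rw [card_neutral_advance (by rwa [Finset.erase_eq_of_notMem hwn]),
        Finset.erase_eq_of_notMem hwn]
      congr 1
      have hd : Disjoint s.active B := Finset.disjoint_left.2 fun v hv hv' =>
        (mem_neutral.1 (hB hv')).1 hv
      simp only [ExplorationState.advance]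
      rw [Finset.card_erase_of_mem (Finset.mem_union_left _ h), Finset.card_union_of_disjoint hd]
      omega
    · have hpos : 0 < s.neutral.card := Finset.card_pos.2 ⟨w, h'⟩
      obtain ⟨n, hn⟩ : ∃ n, s.neutral.card = n + 1 := ⟨s.neutral.card - 1, by omega⟩
      have hcard : (s.neutral.erase w).card = n := by rw [Finset.card_erase_of_mem h', hn]; rfl
      rw [hn, h, Finset.card_empty, stepMean]
      conv_rhs => rw [← hcard]
      rw [← subsetMean.card]
      refine subsetMean.congr fun B hB => ?_
      rw [card_neutral_advance hB]
      congr 1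
      simp only [ExplorationState.advance, h, Finset.empty_union]
      rw [Finset.erase_eq_of_notMem fun hB' => (Finset.mem_erase.1 (hB hB')).1 rfl]

theorem IsLocal.explorationRun {β : Type*}
    {R : ℕ → ExplorationState m → SimpleGraph (Fin m) → β}
    (hR : ∀ t, IsLocal (R t)) (T f t : ℕ) : IsLocal (explorationRun T R f t) := by
  induction f generalizing t with
  | zero => exact hR t
  | succ f ih =>
    intro s hs G G' h
    simp only [_root_.explorationRun]
    split_ifs
    · exact hR t s hs G G' h
    · exact (ih (t + 1)).step s hs G G' h

theorem HasMean.explorationRun {R : ℕ → ExplorationState m → SimpleGraph (Fin m) → ℝ}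
    {ρ : ℕ → ℕ → ℕ → ℝ} (hR : ∀ t, IsLocal (R t)) (hm : ∀ t, HasMean p (R t) (ρ t)) (T f t : ℕ) :
    HasMean p (explorationRun T R f t) (chainRun p T ρ f t) := by
  induction f generalizing t with
  | zero => exact hm t
  | succ f ih =>
    intro s hs
    simp only [_root_.explorationRun, chainRun]
    split_ifs
    · exact hm t s hs
    · exact HasMean.step (IsLocal.explorationRun hR T f (t + 1)) (ih (t + 1)) s hs

end transfer


/-! ### Excursions of the exploration and connected components -/

section deterministic

variable {m : ℕ}

/-- The state after `k` steps from `s`. -/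
noncomputable def ExplorationState.iter (G : SimpleGraph (Fin m)) (s : ExplorationState m) :
    ℕ → ExplorationState m
  | 0 => s
  | k + 1 => (s.iter G k).step G

theorem ExplorationState.iter_step (G : SimpleGraph (Fin m)) (s : ExplorationState m) (k : ℕ) :
    (s.step G).iter G k = s.iter G (k + 1) := by
  induction k with
  | zero => rfl
  | succ k ih => rw [ExplorationState.iter, ih]; rfl

theorem ExplorationState.iter_add (G : SimpleGraph (Fin m)) (s : ExplorationState m) (k l : ℕ) :
    (s.iter G k).iter G l = s.iter G (k + l) := by
  induction l with
  | zero => rfl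
  | succ l ih => rw [ExplorationState.iter, ih]; rfl

theorem explorationState_eq_iter (G : SimpleGraph (Fin m)) (t : ℕ) :
    explorationState G t = (start m).iter G t := by
  induction t with
  | zero => rfl
  | succ t ih => rw [explorationState, ih]; rfl

/-- The stopping time depends on the states alone, so a single `k` serves all payoffs `R` at once.
-/
theorem exists_explorationRun_eq (T f t : ℕ) (s : ExplorationState m) (G : SimpleGraph (Fin m)) :
    ∃ k ≤ f, (∀ (β : Type) (R : ℕ → ExplorationState m → SimpleGraph (Fin m) → β),
      explorationRun T R f t s G = R (t + k) (s.iter G k) G) ∧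
      (∀ i < k, ¬ (T ≤ t + i ∧ (s.iter G i).active.card = 0)) ∧
      (k < f → T ≤ t + k ∧ (s.iter G k).active.card = 0) := by
  induction f generalizing t s with
  | zero => exact ⟨0, le_rfl, fun β R => rfl, by simp, by simp⟩
  | succ f ih =>
    by_cases h : T ≤ t ∧ s.active.card = 0
    · exact ⟨0, by omega, fun β R => by simp only [explorationRun, if_pos h]; rfl, by simp,
        fun _ => h⟩
    · obtain ⟨k, hk, h1, h2, h3⟩ := ih (t + 1) (s.step G)
      refine ⟨k + 1, by omega, fun β R => ?_, fun i hi => ?_, fun hkf => ?_⟩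
      · simp only [explorationRun, if_neg h]
        rw [h1, iter_step, show t + 1 + k = t + (k + 1) by omega]
      · rcases i with _ | i
        · exact h
        · have := h2 i (by omega)
          rwa [iter_step, show t + 1 + i = t + (i + 1) by omega] at this
      · have := h3 (by omega)
        rwa [iter_step, show t + 1 + k = t + (k + 1) by omega] at this

namespace ExplorationState

/-- There are no edges between explored and neutral vertices. -/
def NoCross (G : SimpleGraph (Fin m)) (s : ExplorationState m) : Prop :=
  ∀ u ∈ s.explored, ∀ v ∈ s.neutral, ¬ G.Adj u v

theorem NoCross.step {G : SimpleGraph (Fin m)} {s : ExplorationState m} (h : s.NoCross G) :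
    (s.step G).NoCross G := by
  classical
  rcases hw : s.next with _ | w
  · rwa [step_of_none G hw]
  · rw [step_of_some G hw]
    intro u hu v hv huv
    rw [neutral_advance] at hv
    simp only [Finset.mem_sdiff, Finset.mem_erase, Finset.mem_filter] at hv
    rcases Finset.mem_insert.1 hu with rfl | hu
    · exact hv.2 ⟨hv.1.2, huv⟩
    · exact h u hu v hv.1.2 huv

theorem Valid.iter {G : SimpleGraph (Fin m)} {s : ExplorationState m} (h : s.Valid) (k : ℕ) :
    (s.iter G k).Valid := by
  induction k with
  | zero => exact h
  | succ k ih => exact ih.step G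

theorem NoCross.iter {G : SimpleGraph (Fin m)} {s : ExplorationState m} (h : s.NoCross G) (k : ℕ) :
    (s.iter G k).NoCross G := by
  induction k with
  | zero => exact h
  | succ k ih => exact ih.step

theorem card_explored_iter {G : SimpleGraph (Fin m)} {s : ExplorationState m} (h : s.Valid) (k : ℕ)
    (hk : s.explored.card + k ≤ m) : (s.iter G k).explored.card = s.explored.card + k := by
  induction k with
  | zero => rfl
  | succ k ih =>
    have := ih (by omega)
    rw [ExplorationState.iter, (card_explored_step G _ (h.iter k) (by omega)).2.1, this]; rfl

/-- The set `K` of explored vertices is a union of components, and the other explored vertices and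
the active ones are in the component of `r`. -/
structure Conn (G : SimpleGraph (Fin m)) (K : Finset (Fin m)) (r : Fin m)
    (s : ExplorationState m) : Prop where
  subset : K ⊆ s.explored
  closed : ∀ u ∈ K, ∀ v ∉ K, ¬ G.Adj u v
  explored : ∀ v ∈ s.explored, v ∉ K → G.Reachable r v
  active : ∀ v ∈ s.active, G.Reachable r v

theorem Conn.step {G : SimpleGraph (Fin m)} {K : Finset (Fin m)} {r : Fin m}
    {s : ExplorationState m} (h : s.Conn G K r) (ha : s.active.Nonempty) :
    (s.step G).Conn G K r := by
  classical
  rcases hw : s.next with _ | w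
  · rwa [step_of_none G hw]
  · have hwa : w ∈ s.active := by
      rcases next_eq_some hw with h' | h'
      · exact h'
      · exact absurd h'.1 ha.ne_empty
    rw [step_of_some G hw]
    refine ⟨h.subset.trans (Finset.subset_insert _ _), h.closed, fun v hv hvK => ?_, fun v hv => ?_⟩
    · rcases Finset.mem_insert.1 hv with rfl | hv
      · exact h.active _ hwa
      · exact h.explored v hv hvK
    · rcases Finset.mem_union.1 (Finset.mem_erase.1 hv).2 with hv | hv
      · exact h.active v hv
      · exact (h.active w hwa).trans (Finset.mem_filter.1 hv).2.reachable

theorem Conn.iter {G : SimpleGraph (Fin m)} {K : Finset (Fin m)} {r : Fin m}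
    {s : ExplorationState m} (h : s.Conn G K r) (k : ℕ)
    (ha : ∀ i < k, (s.iter G i).active.Nonempty) : (s.iter G k).Conn G K r := by
  induction k with
  | zero => exact h
  | succ k ih => exact (ih fun i hi => ha i (by omega)).step (ha k (by omega))

/-- Re-rooting at the vertex being treated. If nothing is active, a new component begins and `K`
becomes the whole explored set; otherwise `K` is kept and `r` is replaced by `w`, which lies in the
same component. -/
theorem exists_conn_step {G : SimpleGraph (Fin m)} {s : ExplorationState m}
    (hc : s.NoCross G) (h : s.active = ∅ ∨ ∃ K r, s.Conn G K r) {w : Fin m}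
    (hw : s.next = some w) : ∃ K ⊆ s.explored, (s.step G).Conn G K w := by
  classical
  rcases s.active.eq_empty_or_nonempty with ha | ha
  · refine ⟨s.explored, subset_rfl, explored_subset_step s G, fun u hu v hv => hc u hu v ?_, ?_, ?_⟩
    · exact mem_neutral.2 ⟨by simp [ha], hv⟩
    · rw [step_of_some G hw]
      intro v hv hvK
      rcases Finset.mem_insert.1 hv with rfl | hv
      · exact SimpleGraph.Reachable.refl _
      · exact absurd hv hvK
    · rw [step_of_some G hw]
      intro v hv
      have hv := (Finset.mem_erase.1 hv).2
      rw [ha, Finset.empty_union, Finset.mem_filter] at hv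
      exact hv.2.reachable
  · rcases h with h | ⟨K, r, h⟩
    · exact absurd h ha.ne_empty
    · have hwa : w ∈ s.active := by
        rcases next_eq_some hw with h' | h'
        · exact h'
        · exact absurd h'.1 ha.ne_empty
      have hrw := (h.active w hwa).symm
      have h' := h.step ha
      exact ⟨K, h.subset, h'.subset, h'.closed, fun v hv hvK => hrw.trans (h'.explored v hv hvK),
        fun v hv => hrw.trans (h'.active v hv)⟩

/-- A set without edges to its complement contains the components of its elements. -/
theorem supp_subset_of_closed {G : SimpleGraph (Fin m)} {K : Finset (Fin m)}
    (hK : ∀ u ∈ K, ∀ v ∉ K, ¬ G.Adj u v) {u v : Fin m} (hu : u ∈ K) (h : G.Reachable u v) :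
    v ∈ K := by
  obtain ⟨p⟩ := h
  induction p with
  | nil => exact hu
  | cons h p ih => exact ih (by by_contra h'; exact hK _ hu _ h' h)

theorem valid_start : (start m).Valid := Finset.disjoint_empty_right _

theorem noCross_start (G : SimpleGraph (Fin m)) : (start m).NoCross G :=
  fun u hu => absurd hu (Finset.notMem_empty u)

theorem exists_conn_start (G : SimpleGraph (Fin m)) (t : ℕ) :
    ((start m).iter G t).active = ∅ ∨ ∃ K r, ((start m).iter G t).Conn G K r := by
  induction t with
  | zero =>
    rcases (start m).active.eq_empty_or_nonempty with h | ⟨r, hr⟩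
    · exact Or.inl h
    · refine Or.inr ⟨∅, r, Finset.empty_subset _, by simp, fun v hv => absurd hv
        (Finset.notMem_empty v), fun v hv => ?_⟩
      have h1 : (r : ℕ) = 0 := (Finset.mem_filter.1 hr).2
      have h2 : (v : ℕ) = 0 := (Finset.mem_filter.1 hv).2
      rw [Fin.ext (h1.trans h2.symm)]
  | succ t ih =>
    rcases hw : ((start m).iter G t).next with _ | w
    · rw [ExplorationState.iter, step_of_none G hw]; exact ih
    · obtain ⟨K, -, h⟩ := exists_conn_step ((noCross_start G).iter t) ih hw
      exact Or.inr ⟨K, w, h⟩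

end ExplorationState

/-- The size of the component of `v`. -/
noncomputable def componentSize (G : SimpleGraph (Fin m)) (v : Fin m) : ℕ :=
  (G.connectedComponentMk v).supp.ncard

theorem componentSize_le {G : SimpleGraph (Fin m)} {K : Finset (Fin m)}
    (hK : ∀ u ∈ K, ∀ v ∉ K, ¬ G.Adj u v) {v : Fin m} (hv : v ∈ K) :
    componentSize G v ≤ K.card := by
  rw [← Set.ncard_coe_finset]
  refine Set.ncard_le_ncard (fun u hu => ?_) (Finset.finite_toSet K)
  exact supp_subset_of_closed hK hv (SimpleGraph.ConnectedComponent.exact hu).symm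

/-- The exploration from a vertex `v` outside a union `E` of components lasts as many steps as the
component of `v` has vertices. -/
theorem explorationRun_singleton {β : Type} {G : SimpleGraph (Fin m)} {E : Finset (Fin m)}
    (hE : ∀ u ∈ E, ∀ v ∉ E, ¬ G.Adj u v) {v : Fin m} (hv : v ∉ E) (φ : ℕ → β) :
    explorationRun 0 (fun t _ _ => φ t) m 0 ⟨{v}, E⟩ G = φ (componentSize G v) := by
  obtain ⟨k, hk, h1, h2, h3⟩ := exists_explorationRun_eq 0 m 0 (⟨{v}, E⟩ : ExplorationState m) G
  set s : ExplorationState m := ⟨{v}, E⟩ with hs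
  rw [h1, zero_add]
  congr 1
  have hval : s.Valid := by simpa [Valid, hs] using hv
  have hnc : s.NoCross G := fun u hu x hx => hE u hu x (mem_neutral.1 hx).2
  have hconn : s.Conn G E v := ⟨subset_rfl, hE, fun x hx hx' => absurd hx hx', fun x hx => by
    rw [Finset.mem_singleton.1 hx]⟩
  have hact : ∀ i < k, (s.iter G i).active.Nonempty := fun i hi => by
    rw [← Finset.card_pos]
    have := h2 i hi
    simp only [zero_le, true_and] at this
    omega
  -- An active vertex before each step leaves a vertex to explore, so the number of explored
  -- vertices really grows by one per step.
  have hEm : ∀ i ≤ k, E.card + i ≤ m := by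
    intro i hi
    induction i with
    | zero => simpa using E.card_le_univ
    | succ i ih =>
      have h4 := card_explored_iter (G := G) hval i (ih (by omega))
      have h5 : (s.iter G i).active.card + (s.iter G i).explored.card ≤ m := by
        rw [← Finset.card_union_of_disjoint (hval.iter i)]
        simpa using Finset.card_le_univ ((s.iter G i).active ∪ (s.iter G i).explored)
      have h6 := Finset.card_pos.2 (hact i (by omega))
      simp only [hs] at h4 h5 h6 ⊢
      omega
  have hcard := card_explored_iter (G := G) hval k (hEm k le_rfl)
  have hempty : (s.iter G k).active = ∅ := by
    rcases hk.lt_or_eq with h | h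
    · exact Finset.card_eq_zero.1 (h3 h).2
    · have h5 : (s.iter G k).active.card + (s.iter G k).explored.card ≤ m := by
        rw [← Finset.card_union_of_disjoint (hval.iter k)]
        simpa using Finset.card_le_univ ((s.iter G k).active ∪ (s.iter G k).explored)
      rw [← Finset.card_eq_zero]
      omega
  have hfin := hconn.iter k hact
  have hcl : ∀ u ∈ (s.iter G k).explored, ∀ x ∉ (s.iter G k).explored, ¬ G.Adj u x :=
    fun u hu x hx => hnc.iter k u hu x (mem_neutral.2 ⟨by simp [hempty], hx⟩)
  have hvk : v ∈ (s.iter G k).explored := by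
    have : ∀ i, v ∈ (s.iter G i).active ∪ (s.iter G i).explored := by
      intro i
      induction i with
      | zero => simp [ExplorationState.iter, hs]
      | succ i ih =>
        classical
        rw [ExplorationState.iter]
        rcases hw : (s.iter G i).next with _ | w
        · rwa [step_of_none G hw]
        · rw [step_of_some G hw]
          simp only [ExplorationState.advance, Finset.mem_union, Finset.mem_erase,
            Finset.mem_insert] at ih ⊢
          tauto
    simpa [hempty] using this k
  have hset : (G.connectedComponentMk v).supp = (((s.iter G k).explored \ E : Finset _) :
      Set (Fin m)) := by
    ext x
    simp only [SimpleGraph.ConnectedComponent.mem_supp_iff, SimpleGraph.ConnectedComponent.eq,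
      Finset.coe_sdiff, Set.mem_sdiff, Finset.mem_coe]
    constructor
    · intro hx
      exact ⟨supp_subset_of_closed hcl hvk hx.symm, fun hxE => hv (supp_subset_of_closed hE hxE hx)⟩
    · exact fun hx => (hfin.explored x hx.1 hx.2).symm
  rw [componentSize, hset, Set.ncard_coe_finset, Finset.card_sdiff_of_subset hfin.subset, hcard]
  simp [hs]

/-- The state at the first time `t ≥ T` without active vertices: the component at time `T` is
explored, the other explored components have less than `T` vertices. -/
theorem exists_run_eq_of_pos {G : SimpleGraph (Fin m)} {T : ℕ} (h0 : 0 < T) (hT : T ≤ m) :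
    ∃ (ζ : ℕ) (s : ExplorationState m) (w : Fin m),
      (∀ (β : Type) (R : ℕ → ExplorationState m → SimpleGraph (Fin m) → β),
        explorationRun T R m 0 (start m) G = R ζ s G) ∧
      vertexAtStep G T = some w ∧ componentSize G w ≤ ζ ∧
      (∀ v ∈ s.explored, G.connectedComponentMk v ≠ G.connectedComponentMk w →
        componentSize G v < T) ∧
      (∀ u ∈ s.explored, ∀ v ∉ s.explored, ¬ G.Adj u v) ∧ s.active = ∅ := by
  obtain ⟨k, hk, h1, h2, h3⟩ := exists_explorationRun_eq T m 0 (start m) G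
  have hval : ∀ i, ((start m).iter G i).Valid := fun i => valid_start.iter i
  have hcard : ∀ i ≤ m, ((start m).iter G i).explored.card = i := fun i hi => by
    simpa [start] using card_explored_iter (G := G) valid_start i (by simpa [start] using hi)
  have hempty : ((start m).iter G k).active = ∅ := by
    rcases hk.lt_or_eq with h | h
    · exact Finset.card_eq_zero.1 (h3 h).2
    · have h5 : ((start m).iter G k).active.card + ((start m).iter G k).explored.card ≤ m := by
        rw [← Finset.card_union_of_disjoint (hval k)]
        simpa using Finset.card_le_univ
          (((start m).iter G k).active ∪ ((start m).iter G k).explored)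
      rw [hcard k hk] at h5
      rw [← Finset.card_eq_zero]
      omega
  have hTk : T ≤ k := by
    rcases hk.lt_or_eq with h | h
    · simpa using (h3 h).1
    · omega
  obtain ⟨w, hw⟩ : ∃ w, ((start m).iter G (T - 1)).next = some w := Option.isSome_iff_exists.1
    (card_explored_step G _ (hval _) (by rw [hcard _ (by omega)]; omega)).2.2
  obtain ⟨K, hK, hconn⟩ := exists_conn_step ((noCross_start G).iter (T - 1))
    (exists_conn_start G (T - 1)) hw
  have hstep : ((start m).iter G (T - 1)).step G = (start m).iter G T := by
    conv_rhs => rw [show T = T - 1 + 1 by omega]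
    rfl
  rw [hstep] at hconn
  have hfin : ((start m).iter G k).Conn G K w := by
    have := hconn.iter (k - T) fun i hi => by
      rw [iter_add, ← Finset.card_pos]
      have := h2 (T + i) (by omega)
      omega
    rwa [iter_add, show T + (k - T) = k by omega] at this
  have hwT : w ∈ ((start m).iter G T).explored := by
    rw [← hstep, step_of_some G hw]; exact Finset.mem_insert_self _ _
  have hwk : ∀ i, w ∈ ((start m).iter G (T + i)).explored := fun i => by
    induction i with
    | zero => exact hwT
    | succ i ih => exact explored_subset_step _ _ ih
  have hwk' := hwk (k - T)
  rw [show T + (k - T) = k by omega] at hwk'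
  have hcl : ∀ u ∈ ((start m).iter G k).explored, ∀ x ∉ ((start m).iter G k).explored,
      ¬ G.Adj u x :=
    fun u hu x hx => (noCross_start G).iter k u hu x (mem_neutral.2 ⟨by simp [hempty], hx⟩)
  refine ⟨k, (start m).iter G k, w, fun β R => by rw [h1, zero_add], ?_, ?_, fun v hv hvw => ?_,
    hcl, hempty⟩
  · rw [vertexAtStep, explorationState_eq_iter, hw]
  · exact (componentSize_le hcl hwk').trans_eq (hcard k hk)
  · have hvK : v ∈ K := by
      by_contra hvK
      exact hvw (SimpleGraph.ConnectedComponent.sound (hfin.explored v hv hvK).symm)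
    -- `K` lies among the T - 1 vertices explored before step T; hence the strict inequality.
    have h6 := (componentSize_le hfin.closed hvK).trans (Finset.card_le_card hK)
    rw [hcard _ (by omega)] at h6
    omega

end deterministic


/-! ### Reduction to the chain -/

section reduction

variable {m : ℕ}

/-- The first time `t ≥ T` without active vertices. -/
noncomputable def firstEmptyTime (T : ℕ) (G : SimpleGraph (Fin m)) : ℕ :=
  explorationRun T (fun t _ _ => t) m 0 (start m) G

theorem card_start (hm : 0 < m) : (start m).active.card = 1 ∧ (start m).neutral.card = m - 1 := by
  have h : (start m).active = {⟨0, hm⟩} := by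
    ext v; simp [start, Fin.ext_iff]
  refine ⟨by rw [h]; rfl, ?_⟩
  have h2 : (start m).explored = ∅ := rfl
  rw [neutral, h, h2, Finset.union_empty, Finset.card_compl]
  simp

theorem isLocal_const {β : Type*} (c : β) :
    IsLocal fun (_ : ExplorationState m) (_ : SimpleGraph (Fin m)) => c :=
  fun _ _ _ _ _ => rfl

theorem hasMean_const (p : unitInterval) (c : ℝ) :
    HasMean (m := m) p (fun _ _ => c) fun _ _ => c := fun s _ => by simp

theorem integral_firstEmptyTime (hm : 0 < m) (p : unitInterval) (T : ℕ) (φ : ℕ → ℝ) :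
    ∫ G, φ (firstEmptyTime T G) ∂(SimpleGraph.binomialRandom (Fin m) p) =
      chainRun p T (fun t _ _ => φ t) m 0 (m - 1) 1 := by
  have h := HasMean.explorationRun (m := m) (p := p) (R := fun t _ _ => φ t)
    (ρ := fun t _ _ => φ t) (fun t => isLocal_const _) (fun t => hasMean_const p _) T m 0
    (start m) valid_start
  rw [(card_start hm).1, (card_start hm).2] at h
  rw [← h]
  refine integral_congr_ae (Filter.Eventually.of_forall fun G => ?_)
  obtain ⟨k, hk, h1, -⟩ := exists_explorationRun_eq T m 0 (start m) G
  simp only [firstEmptyTime, h1]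

/-- Whatever was explored before the excursion containing `x` is given away here. -/
theorem componentSizeAtTime_le {G : SimpleGraph (Fin m)} {x : ℝ} (h0 : 0 < x) (hx : x ≤ m) :
    componentSizeAtTime G x ≤ firstEmptyTime ⌈x⌉₊ G := by
  obtain ⟨ζ, s, w, h1, h2, h3, -⟩ :=
    exists_run_eq_of_pos (G := G) (Nat.ceil_pos.2 h0) (Nat.ceil_le.2 hx)
  rw [firstEmptyTime, h1, componentSizeAtTime, componentAtTime, h2]
  exact h3

-- Each component is counted once for each of its vertices, which lowers the exponent by one.
open Classical in
theorem sumOtherComponents_eq (G : SimpleGraph (Fin m)) (x : ℝ) (j : ℕ) :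
    sumOtherComponents G x (j + 1) =
      ∑ v : Fin m with componentAtTime G x ≠ some (G.connectedComponentMk v),
        componentSize G v ^ j := by
  rw [sumOtherComponents, ← Finset.sum_fiberwise_of_maps_to (g := G.connectedComponentMk)
    (t := Finset.univ.filter fun C => componentAtTime G x ≠ some C)
    (fun v hv => by simpa using hv)]
  refine Finset.sum_congr rfl fun C hC => ?_
  have hset : (Finset.univ.filter fun v => componentAtTime G x ≠
      some (G.connectedComponentMk v)).filter (fun v => G.connectedComponentMk v = C) =
      C.supp.toFinset := by
    ext v
    simp only [Finset.mem_filter, Finset.mem_univ, true_and, Set.mem_toFinset,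
      SimpleGraph.ConnectedComponent.mem_supp_iff]
    exact ⟨fun h => h.2, fun h => ⟨h ▸ (Finset.mem_filter.1 hC).2, h⟩⟩
  rw [hset, Finset.sum_congr rfl (g := fun _ => C.supp.ncard ^ j), Finset.sum_const,
    ← Set.ncard_eq_toFinset_card', smul_eq_mul, pow_succ, mul_comm]
  intro v hv
  rw [Set.mem_toFinset, SimpleGraph.ConnectedComponent.mem_supp_iff] at hv
  rw [componentSize, hv]

/-- The sum of `φ |C(v)|` over the neutral vertices, as seen by the exploration. -/
noncomputable def neutralSum (φ : ℕ → ℝ) (s : ExplorationState m) (G : SimpleGraph (Fin m)) : ℝ :=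
  ∑ v ∈ s.neutral, explorationRun 0 (fun t _ _ => φ t) m 0 ⟨{v}, s.explored⟩ G

theorem isLocal_neutralSum (φ : ℕ → ℝ) : IsLocal (neutralSum (m := m) φ) := by
  intro s _ G G' h
  refine Finset.sum_congr rfl fun v hv => ?_
  refine IsLocal.explorationRun (R := fun t _ _ => φ t) (fun t => isLocal_const _) 0 m 0 _ ?_ G G' h
  simpa [Valid] using (mem_neutral.1 hv).2

theorem integral_singleton (p : unitInterval) (φ : ℕ → ℝ) {E : Finset (Fin m)} {v : Fin m}
    (hv : v ∉ E) :
    ∫ G, explorationRun 0 (fun t _ _ => φ t) m 0 ⟨{v}, E⟩ G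
      ∂(SimpleGraph.binomialRandom (Fin m) p) =
      chainRun p 0 (fun t _ _ => φ t) m 0 (m - E.card - 1) 1 := by
  have h := HasMean.explorationRun (m := m) (p := p) (R := fun t _ _ => φ t)
    (ρ := fun t _ _ => φ t) (fun t => isLocal_const _) (fun t => hasMean_const p _) 0 m 0
    ⟨{v}, E⟩ (by simpa [Valid] using hv)
  rw [h]
  simp only [neutral, Finset.card_singleton]
  rw [Finset.card_compl, Finset.card_union_of_disjoint (by simpa using hv)]
  simp only [Finset.card_singleton, Fintype.card_fin]
  congr 1; omega

/-- The excursion from `v` lives on the n + a unexplored vertices, one of which is `v`. The state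
`⟨{v}, s.explored⟩` treats the active vertices of `s` as neutral; at the stopping time there are
none. -/
theorem hasMean_neutralSum (p : unitInterval) (φ : ℕ → ℝ) :
    HasMean (m := m) p (neutralSum φ) fun n a =>
      n * chainRun p 0 (fun t _ _ => φ t) m 0 (n + a - 1) 1 := by
  intro s hs
  unfold neutralSum
  rw [integral_finsetSum _ fun v _ => integrable_binomialRandom p _]
  rw [Finset.sum_congr rfl fun v hv => integral_singleton p φ (mem_neutral.1 hv).2]
  rw [Finset.sum_const, nsmul_eq_mul]
  have h1 : s.neutral.card + s.active.card = m - s.explored.card := by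
    rw [neutral, Finset.card_compl, Finset.card_union_of_disjoint hs, Fintype.card_fin]
    have := Finset.card_le_univ (s.active ∪ s.explored)
    rw [Finset.card_union_of_disjoint hs, Fintype.card_fin] at this
    omega
  simp only [h1]

/-- A vertex outside the component at time T = ⌈x⌉ is either explored, and then its component has
fewer than T vertices, or still neutral, and then its component avoids the explored set. The first
sum runs over all `v`, at no loss of order, so that its mean is that of excursions in the full
graph. -/
theorem sumOtherComponents_le {G : SimpleGraph (Fin m)} {x : ℝ} (h0 : 0 < x) (hx : x ≤ m) (j : ℕ) :
    (sumOtherComponents G x (j + 1) : ℝ) ≤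
      (∑ v : Fin m, explorationRun 0 (fun t _ _ => if t < ⌈x⌉₊ then (t : ℝ) ^ j else 0) m 0
        ⟨{v}, ∅⟩ G) +
      explorationRun ⌈x⌉₊ (fun _ => neutralSum fun t => (t : ℝ) ^ j) m 0 (start m) G := by
  classical
  obtain ⟨ζ, s, w, h1, h2, h3, h4, h5, h6⟩ :=
    exists_run_eq_of_pos (G := G) (Nat.ceil_pos.2 h0) (Nat.ceil_le.2 hx)
  rw [h1, neutralSum]
  have e1 : ∀ v : Fin m, explorationRun 0 (fun t _ _ => if t < ⌈x⌉₊ then (t : ℝ) ^ j else 0) m 0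
      ⟨{v}, ∅⟩ G = if componentSize G v < ⌈x⌉₊ then (componentSize G v : ℝ) ^ j else 0 := fun v =>
    explorationRun_singleton (E := ∅) (by simp) (Finset.notMem_empty v)
      (fun t => if t < ⌈x⌉₊ then (t : ℝ) ^ j else 0)
  have e2 : ∀ v ∈ s.neutral, explorationRun 0 (fun t _ _ => (t : ℝ) ^ j) m 0 ⟨{v}, s.explored⟩ G =
      (componentSize G v : ℝ) ^ j := fun v hv =>
    explorationRun_singleton h5 (mem_neutral.1 hv).2 (fun t => (t : ℝ) ^ j)
  rw [Finset.sum_congr rfl fun v _ => e1 v, Finset.sum_congr rfl e2, sumOtherComponents_eq]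
  have hn : s.neutral = Finset.univ.filter fun v => v ∉ s.explored := by
    ext v; simp [mem_neutral, h6]
  rw [hn, Finset.sum_filter, Finset.sum_filter, ← Finset.sum_add_distrib]
  push_cast
  refine Finset.sum_le_sum fun v _ => ?_
  have hpos : (0 : ℝ) ≤ (componentSize G v : ℝ) ^ j := by positivity
  have hw : componentAtTime G x = some (G.connectedComponentMk w) := by
    rw [componentAtTime, h2]; rfl
  rw [hw]
  by_cases hv : v ∈ s.explored
  · by_cases hc : G.connectedComponentMk v = G.connectedComponentMk w
    · simp only [hc, ne_eq, not_true_eq_false, if_false]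
      split_ifs <;> positivity
    · rw [if_pos (h4 v hv hc)]
      split_ifs <;> linarith
  · rw [if_pos hv]
    split_ifs <;> linarith

theorem integral_sumOtherComponents_le (hm : 0 < m) (p : unitInterval) {x : ℝ} (h0 : 0 < x)
    (hx : x ≤ m) (j : ℕ) :
    ∫ G, (sumOtherComponents G x (j + 1) : ℝ) ∂(SimpleGraph.binomialRandom (Fin m) p) ≤
      m * chainRun p 0 (fun t _ _ => if t < ⌈x⌉₊ then (t : ℝ) ^ j else 0) m 0 (m - 1) 1 +
      chainRun p ⌈x⌉₊ (fun _ n a => n * chainRun p 0 (fun t _ _ => (t : ℝ) ^ j) m 0 (n + a - 1) 1)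
        m 0 (m - 1) 1 := by
  refine (integral_mono (integrable_binomialRandom p _) (integrable_binomialRandom p _)
    fun G => sumOtherComponents_le h0 hx j).trans_eq ?_
  rw [integral_add (integrable_binomialRandom p _) (integrable_binomialRandom p _),
    integral_finsetSum _ fun v _ => integrable_binomialRandom p _]
  congr 1
  · rw [Finset.sum_congr rfl fun v _ => integral_singleton p
      (fun t => if t < ⌈x⌉₊ then (t : ℝ) ^ j else 0) (Finset.notMem_empty v)]
    simp
  · have h := HasMean.explorationRun (m := m) (p := p)
      (R := fun _ => neutralSum fun t => (t : ℝ) ^ j) (fun t => isLocal_neutralSum _)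
      (fun t => hasMean_neutralSum p _) ⌈x⌉₊ m 0 (start m) valid_start
    rwa [(card_start hm).1, (card_start hm).2] at h

end reduction

/-! ### Supermartingales for the chain -/

theorem stepMean_mono {p : ℝ} (h0 : 0 ≤ p) (h1 : p ≤ 1) {f g : ℕ → ℕ → ℝ} {n a : ℕ}
    (hna : 0 < n + a) (h : ∀ n' a', n' + a' + 1 = n + a → f n' a' ≤ g n' a') :
    stepMean p f n a ≤ stepMean p g n a := by
  rcases a with _ | a
  · rcases n with _ | n
    · omega
    · exact binomialMean.mono h0 h1 fun k hk => h _ _ (by omega)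
  · exact binomialMean.mono h0 h1 fun k hk => h _ _ (by omega)

/-- A function `V` which dominates `ρ` at the stopping states and is a supermartingale elsewhere
dominates the expectation of `ρ`. -/
theorem chainRun_le {p : ℝ} (h0 : 0 ≤ p) (h1 : p ≤ 1) {T M : ℕ} (hT : T ≤ M)
    {ρ V : ℕ → ℕ → ℕ → ℝ}
    (hρ : ∀ t n, t + n = M → T ≤ t → ρ t n 0 ≤ V t n 0)
    (hV : ∀ t n a, t + n + a = M → 0 < n + a → 0 < t + a → (a = 0 → t < T) →
      stepMean p (V (t + 1)) n a ≤ V t n a)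
    {f t n a : ℕ} (hM : t + n + a = M) (hf : M ≤ t + f) (hta : 0 < t + a) :
    chainRun p T ρ f t n a ≤ V t n a := by
  induction f generalizing t n a with
  | zero =>
    -- No steps left means M ≤ t, so every vertex is explored and `hρ` applies.
    obtain ⟨rfl, rfl⟩ : n = 0 ∧ a = 0 := by omega
    exact hρ t 0 (by omega) (by omega)
  | succ f ih =>
    rw [chainRun]
    split_ifs with h
    · obtain ⟨h2, rfl⟩ := h
      exact hρ t n (by omega) h2
    · have hna : 0 < n + a := by
        by_contra hna
        exact h ⟨by omega, by omega⟩
      refine (stepMean_mono h0 h1 hna fun n' a' h' => ?_).trans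
        (hV t n a hM hna hta fun ha => ?_)
      · exact ih (by omega) (by omega) (by omega)
      · by_contra h2
        exact h ⟨by omega, ha⟩


theorem stepMean_mono' {p : ℝ} (h0 : 0 ≤ p) (h1 : p ≤ 1) {f g : ℕ → ℕ → ℝ} {n a : ℕ}
    (h : ∀ n' a', f n' a' ≤ g n' a') : stepMean p f n a ≤ stepMean p g n a := by
  rcases Nat.eq_zero_or_pos (n + a) with h' | h'
  · obtain ⟨rfl, rfl⟩ : n = 0 ∧ a = 0 := by omega
    exact h 0 0
  · exact stepMean_mono h0 h1 h' fun n' a' _ => h n' a'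

theorem stepMean_const_mul (p c : ℝ) (f : ℕ → ℕ → ℝ) (n a : ℕ) :
    stepMean p (fun n a => c * f n a) n a = c * stepMean p f n a := by
  rcases a with _ | a
  · rcases n with _ | n
    · rfl
    · exact binomialMean.const_mul _ _ _
  · exact binomialMean.const_mul _ _ _

theorem stepMean_add (p : ℝ) (f g : ℕ → ℕ → ℝ) (n a : ℕ) :
    stepMean p (fun n a => f n a + g n a) n a = stepMean p f n a + stepMean p g n a := by
  rcases a with _ | a
  · rcases n with _ | n
    · rfl
    · exact binomialMean.add _ _ _
  · exact binomialMean.add _ _ _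

theorem chainRun_mono {p : ℝ} (h0 : 0 ≤ p) (h1 : p ≤ 1) {T : ℕ} {ρ ρ' : ℕ → ℕ → ℕ → ℝ}
    (h : ∀ t n a, ρ t n a ≤ ρ' t n a) (f t n a : ℕ) :
    chainRun p T ρ f t n a ≤ chainRun p T ρ' f t n a := by
  induction f generalizing t n a with
  | zero => exact h t n a
  | succ f ih =>
    simp only [chainRun]
    split_ifs
    · exact h t n a
    · exact stepMean_mono' h0 h1 fun n' a' => ih _ _ _

theorem chainRun_const_mul (p c : ℝ) (T : ℕ) (ρ : ℕ → ℕ → ℕ → ℝ) (f t n a : ℕ) :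
    chainRun p T (fun t n a => c * ρ t n a) f t n a = c * chainRun p T ρ f t n a := by
  induction f generalizing t n a with
  | zero => rfl
  | succ f ih =>
    simp only [chainRun]
    split_ifs
    · rfl
    · rw [← stepMean_const_mul]
      congr 1
      funext n a
      exact ih _ _ _

theorem chainRun_add (p : ℝ) (T : ℕ) (ρ ρ' : ℕ → ℕ → ℕ → ℝ) (f t n a : ℕ) :
    chainRun p T (fun t n a => ρ t n a + ρ' t n a) f t n a =
      chainRun p T ρ f t n a + chainRun p T ρ' f t n a := by
  induction f generalizing t n a with
  | zero => rfl
  | succ f ih =>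
    simp only [chainRun]
    split_ifs
    · rfl
    · rw [← stepMean_add]
      congr 1
      funext n a
      exact ih _ _ _

/-! ### Exponential moments of binomial steps -/

theorem binomialMean_exp (p : ℝ) (n : ℕ) (μ a : ℝ) :
    binomialMean p n (fun k => Real.exp (μ * (a + k))) =
      Real.exp (μ * a) * (1 - p + p * Real.exp μ) ^ n := by
  rw [← binomialMean.pow, ← binomialMean.const_mul]
  refine binomialMean.congr fun k _ => ?_
  rw [mul_add, Real.exp_add, mul_comm μ (k : ℝ), Real.exp_nat_mul]

/-- The bound 1 + x ≤ e^x replaces the binomial generating function by the Poisson one, so only the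
mean `n * p` enters; `r` is the exponential rate per step. -/
theorem binomialMean_exp_le {p : ℝ} (h0 : 0 ≤ p) (h1 : p ≤ 1) {n : ℕ} {μ r : ℝ}
    (h : n * p * (Real.exp μ - 1) ≤ μ + r) (a : ℝ) :
    binomialMean p n (fun k => Real.exp (μ * (a + k))) ≤ Real.exp (μ * (a + 1) + r) := by
  rw [binomialMean_exp]
  have hb : 0 ≤ 1 - p + p * Real.exp μ := by
    have := mul_nonneg h0 (Real.exp_pos μ).le
    linarith
  have h2 : (1 - p + p * Real.exp μ) ^ n ≤ Real.exp (n * p * (Real.exp μ - 1)) := by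
    have : 1 - p + p * Real.exp μ ≤ Real.exp (p * (Real.exp μ - 1)) := by
      have := Real.add_one_le_exp (p * (Real.exp μ - 1))
      linarith
    calc _ ≤ Real.exp (p * (Real.exp μ - 1)) ^ n := pow_le_pow_left₀ hb this n
      _ = _ := by rw [← Real.exp_nat_mul, mul_assoc]
  calc _ ≤ Real.exp (μ * a) * Real.exp (n * p * (Real.exp μ - 1)) :=
        mul_le_mul_of_nonneg_left h2 (Real.exp_pos _).le
    _ = Real.exp (μ * a + n * p * (Real.exp μ - 1)) := (Real.exp_add _ _).symm
    _ ≤ _ := Real.exp_le_exp.2 (by linarith)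

theorem exp_sub_one_le {x : ℝ} (h0 : 0 ≤ x) (h1 : x ≤ 1) : Real.exp x - 1 ≤ x + x ^ 2 := by
  have := Real.abs_exp_sub_one_sub_id_le (x := x) (by rw [abs_of_nonneg h0]; exact h1)
  have := (abs_le.1 this).2
  linarith

theorem exp_neg_sub_one_le {x : ℝ} (h0 : 0 ≤ x) (h1 : x ≤ 1) :
    Real.exp (-x) - 1 ≤ -x + x ^ 2 := by
  have := Real.abs_exp_sub_one_sub_id_le (x := -x) (by rw [abs_neg, abs_of_nonneg h0]; exact h1)
  have := (abs_le.1 this).2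
  linarith [neg_sq x]

/-- The subtracted 1 matters: payoffs of the form e^x - 1 are dominated by supermartingales starting
at O(ε) rather than at O(1), and this is the source of the factor ε in all moment bounds. -/
theorem pow_le_factorial_mul_exp {x : ℝ} (hx : 0 ≤ x) {j : ℕ} (hj : 0 < j) :
    x ^ j ≤ j.factorial * (Real.exp x - 1) := by
  obtain ⟨i, rfl⟩ : ∃ i, j = i + 1 := ⟨j - 1, by omega⟩
  have h := Real.sum_le_exp_of_nonneg hx (i + 2)
  rw [Finset.sum_range_succ'] at h
  have h2 : x ^ (i + 1) / ((i + 1).factorial : ℝ) ≤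
      ∑ l ∈ Finset.range (i + 1), x ^ (l + 1) / ((l + 1).factorial : ℝ) :=
    Finset.single_le_sum (f := fun l => x ^ (l + 1) / ((l + 1).factorial : ℝ))
      (fun l _ => by positivity) (Finset.mem_range.2 (Nat.lt_succ_self i))
  have h3 : x ^ (i + 1) / ((i + 1).factorial : ℝ) ≤ Real.exp x - 1 := by
    simp only [pow_zero, Nat.factorial_zero, Nat.cast_one, div_one] at h
    linarith
  rwa [div_le_iff₀ (by positivity), mul_comm] at h3

/-- This follows from log(1 + u) ≥ 2u/(u + 2) at u = e^x - 1. A bound that stays good for large x is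
needed, since it is used at x = 8ε. -/
theorem one_sub_exp_neg_le {x : ℝ} (hx : 0 ≤ x) : 1 - Real.exp (-x) ≤ 2 * x / (2 + x) := by
  have h := Real.le_log_one_add_of_nonneg (x := Real.exp x - 1)
    (by linarith [Real.add_one_le_exp x])
  rw [add_sub_cancel, Real.log_exp, div_le_iff₀ (by linarith [Real.exp_pos x])] at h
  rw [le_div_iff₀ (by linarith)]
  have h2 : Real.exp (-x) * Real.exp x = 1 := by rw [← Real.exp_add]; simp
  have h3 := mul_le_mul_of_nonneg_left h (Real.exp_pos (-x)).le
  nlinarith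

/-- The walk of the active vertices has an exponential submartingale, uniformly in the number of
neutral vertices. -/
theorem exp_sq_le_pow {m n : ℕ} {ε p : ℝ} (hm : 45 ≤ m) (he0 : 0 < ε) (he1 : ε ≤ 1)
    (hmp : m * p = 1 + ε) (hn : n ≤ m) :
    Real.exp (-(8 * ε) + 3 * ε ^ 2) ≤ (1 - p + p * Real.exp (-(8 * ε))) ^ n := by
  have hm' : (45 : ℝ) ≤ m := by exact_mod_cast hm
  have hp : p = (1 + ε) / m := by field_simp; linarith
  have hp0 : 0 < p := by rw [hp]; positivity
  have hp2 : p ≤ 2 / 45 := by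
    rw [hp, div_le_div_iff₀ (by linarith) (by norm_num)]; nlinarith
  set x := 1 - Real.exp (-(8 * ε)) with hx
  have hx0 : 0 ≤ x := by
    have : Real.exp (-(8 * ε)) ≤ 1 := Real.exp_le_one_iff.2 (by linarith)
    linarith
  have hx1 : x ≤ 8 * ε := by linarith [Real.add_one_le_exp (-(8 * ε))]
  have hx2 : x * (1 + 4 * ε) ≤ 8 * ε := by
    have := one_sub_exp_neg_le (x := 8 * ε) (by linarith)
    rw [le_div_iff₀ (by linarith)] at this
    linarith
  have hy0 : 0 ≤ p * x := by positivity
  have hy1 : p * x ≤ 16 * ε / 45 := by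
    calc p * x ≤ 2 / 45 * (8 * ε) := mul_le_mul hp2 hx1 hx0 (by norm_num)
      _ = _ := by ring
  have hy2 : 0 < 1 - p * x := by linarith
  have e1 : 1 - p + p * Real.exp (-(8 * ε)) = 1 - p * x := by rw [hx]; ring
  rw [e1]
  -- Fewer neutral vertices only help, so n = m is the worst case.
  have h1 : (1 - p * x) ^ m ≤ (1 - p * x) ^ n :=
    pow_le_pow_of_le_one hy2.le (by linarith) hn
  refine le_trans ?_ h1
  rw [← Real.exp_log hy2, ← Real.exp_nat_mul]
  refine Real.exp_le_exp.2 ?_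
  have h2 := Real.one_sub_inv_le_log_of_pos hy2
  have h3 : (m : ℝ) * (1 - (1 - p * x)⁻¹) ≤ m * Real.log (1 - p * x) :=
    mul_le_mul_of_nonneg_left h2 (by linarith)
  refine le_trans ?_ h3
  have h4 : (m : ℝ) * (1 - (1 - p * x)⁻¹) = -((1 + ε) * x / (1 - p * x)) := by
    rw [← hmp]; field_simp; ring
  rw [h4]
  have h5 : (1 + ε) * x / (1 - p * x) ≤ 8 * ε - 3 * ε ^ 2 := by
    rw [div_le_iff₀ hy2]
    have h6 : (8 * ε - 3 * ε ^ 2) * (1 - 16 * ε / 45) ≤ (8 * ε - 3 * ε ^ 2) * (1 - p * x) :=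
      mul_le_mul_of_nonneg_left (by linarith) (by nlinarith)
    refine le_trans ?_ h6
    -- The constants 8, 3 and 45 are fitted to ε = 1, where the polynomial inequality reads 16 ≤ 5 ·
    -- (29/45) · 5 = 145/9.
    have h7 : (1 + ε) * (x * (1 + 4 * ε)) ≤
        (8 * ε - 3 * ε ^ 2) * (1 - 16 * ε / 45) * (1 + 4 * ε) := by
      refine (mul_le_mul_of_nonneg_left hx2 (by linarith)).trans ?_
      have h8 : 0 ≤ ε ^ 2 * (1 - ε) := by have := sub_nonneg.2 he1; positivity
      have h9 : 0 ≤ ε ^ 2 * (1 - ε) ^ 2 := by positivity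
      nlinarith
    nlinarith
  linarith

theorem le_binomialMean_exp_neg {m n : ℕ} {ε p : ℝ} (hm : 45 ≤ m) (he0 : 0 < ε) (he1 : ε ≤ 1)
    (hmp : m * p = 1 + ε) (hn : n ≤ m) (a : ℝ) :
    Real.exp (-(8 * ε) * (a + 1) + 3 * ε ^ 2) ≤
      binomialMean p n (fun k => Real.exp (-(8 * ε) * (a + k))) := by
  rw [binomialMean_exp]
  calc _ = Real.exp (-(8 * ε) * a) * Real.exp (-(8 * ε) + 3 * ε ^ 2) := by
        rw [← Real.exp_add]; ring_nf
    _ ≤ _ := mul_le_mul_of_nonneg_left (exp_sq_le_pow hm he0 he1 hmp hn) (Real.exp_pos _).le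

/-! ### Excursions from a single vertex -/

/-- The walk has drift at most -η, so exp(ηa/2) shrinks by the factor exp(-η²/4) per step, which
leaves room for exp(η²t/4). The initial value e^(η/2) - 1 is at most η. -/
theorem chainRun_exp_subcritical {p η : ℝ} (h0 : 0 ≤ p) (h1 : p ≤ 1) {N f : ℕ} (hN : 0 < N)
    (hf : N ≤ f) (he0 : 0 < η) (he1 : η ≤ 1) (hNp : N * p ≤ 1 - η) :
    chainRun p 0 (fun t _ _ => Real.exp (η ^ 2 / 4 * t) - 1) f 0 (N - 1) 1 ≤ η := by
  have h := chainRun_le (ρ := fun t _ _ => Real.exp (η ^ 2 / 4 * t) - 1)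
    (V := fun t _ a => Real.exp (η ^ 2 / 4 * t) * Real.exp (η / 2 * a) - 1) h0 h1
    (T := 0) (M := N) (Nat.zero_le _) (fun t n _ _ => by simp) (fun t n a hM hna hta ha => ?_)
    (f := f) (t := 0) (n := N - 1) (a := 1) (by omega) (by omega) (by omega)
  · refine h.trans ?_
    have := exp_sub_one_le (x := η / 2) (by linarith) (by linarith)
    simp only [Nat.cast_zero, mul_zero, Real.exp_zero, one_mul, Nat.cast_one, mul_one]
    nlinarith
  · obtain ⟨a, rfl⟩ : ∃ b, a = b + 1 := ⟨a - 1, by omega⟩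
    simp only [stepMean]
    rw [binomialMean.sub, binomialMean.const, binomialMean.const_mul]
    refine sub_le_sub_right ?_ 1
    have hn : (n : ℝ) * p ≤ 1 - η :=
      (mul_le_mul_of_nonneg_right (by exact_mod_cast (by omega : n ≤ N)) h0).trans hNp
    have h2 := exp_sub_one_le (x := η / 2) (by linarith) (by linarith)
    have h3 := binomialMean_exp_le h0 h1 (n := n) (μ := η / 2) (r := -(η ^ 2 / 4)) (by
      have h4 : (n : ℝ) * p * (Real.exp (η / 2) - 1) ≤ (1 - η) * (η / 2 + (η / 2) ^ 2) :=
        mul_le_mul hn h2 (by linarith [Real.add_one_le_exp (η / 2)]) (by linarith)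
      nlinarith [pow_pos he0 3]) a
    have h5 := mul_le_mul_of_nonneg_left h3 (Real.exp_pos (η ^ 2 / 4 * ((t + 1 : ℕ) : ℝ))).le
    simp only [Nat.cast_add, Nat.cast_one] at h5 ⊢
    refine h5.trans_eq ?_
    rw [← Real.exp_add, ← Real.exp_add]
    ring_nf

/-- In a subcritical graph, the `j`-th moment of the size of a component is `O(η ^ (1 - 2 j))`. -/
theorem chainRun_pow_subcritical {p η : ℝ} (h0 : 0 ≤ p) (h1 : p ≤ 1) {N f j : ℕ} (hj : 0 < j)
    (hN : 0 < N) (hf : N ≤ f) (he0 : 0 < η) (he1 : η ≤ 1) (hNp : N * p ≤ 1 - η) :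
    chainRun p 0 (fun t _ _ => (t : ℝ) ^ j) f 0 (N - 1) 1 ≤
      j.factorial * 4 ^ j * (η / η ^ (2 * j)) := by
  have h := chainRun_mono h0 h1 (T := 0) (ρ := fun t _ _ => (t : ℝ) ^ j)
    (ρ' := fun t _ _ => j.factorial * 4 ^ j / η ^ (2 * j) * (Real.exp (η ^ 2 / 4 * t) - 1))
    (fun t n a => by
      have := pow_le_factorial_mul_exp (x := η ^ 2 / 4 * t) (by positivity) hj
      rw [mul_pow, div_pow, ← pow_mul] at this
      rw [div_mul_eq_mul_div, le_div_iff₀ (by positivity)]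
      rw [div_mul_eq_mul_div, div_le_iff₀ (by positivity)] at this
      linarith) f 0 (N - 1) 1
  rw [chainRun_const_mul] at h
  refine h.trans ((mul_le_mul_of_nonneg_left
    (chainRun_exp_subcritical h0 h1 hN hf he0 he1 hNp) (by positivity)).trans_eq ?_)
  ring


/-! ### Excursions from a vertex at density 1 + ε: long, late and short ones. -/

section supercritical

variable {m N f L : ℕ} {ε p : ℝ}

/-- The excursion from a single vertex has length of order `ε ^ (-2)` or more with probability
`O(ε)`. -/
theorem chainRun_one_sub_exp (hm : 45 ≤ m) (h0 : 0 ≤ p) (h1 : p ≤ 1) (he0 : 0 < ε) (he1 : ε ≤ 1)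
    (hmp : m * p = 1 + ε) (hN : 0 < N) (hNm : N ≤ m) (hf : N ≤ f) :
    chainRun p 0 (fun t _ _ => 1 - Real.exp (-(3 * ε ^ 2) * t)) f 0 (N - 1) 1 ≤ 8 * ε := by
  have h := chainRun_le (ρ := fun t _ _ => 1 - Real.exp (-(3 * ε ^ 2) * t))
    (V := fun t _ a => 1 - Real.exp (-(3 * ε ^ 2) * t) * Real.exp (-(8 * ε) * a)) h0 h1
    (T := 0) (M := N) (Nat.zero_le _) (fun t n _ _ => by simp) (fun t n a hM hna hta ha => ?_)
    (f := f) (t := 0) (n := N - 1) (a := 1) (by omega) (by omega) (by omega)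
  · refine h.trans ?_
    have := Real.add_one_le_exp (-(8 * ε))
    simp only [Nat.cast_zero, mul_zero, Real.exp_zero, one_mul, Nat.cast_one, mul_one]
    linarith
  · obtain ⟨a, rfl⟩ : ∃ b, a = b + 1 := ⟨a - 1, by omega⟩
    simp only [stepMean]
    rw [binomialMean.sub, binomialMean.const, binomialMean.const_mul]
    refine sub_le_sub_left ?_ 1
    have h3 := le_binomialMean_exp_neg (n := n) hm he0 he1 hmp (by omega) a
    have h5 := mul_le_mul_of_nonneg_left h3 (Real.exp_pos (-(3 * ε ^ 2) * ((t + 1 : ℕ) : ℝ))).le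
    simp only [Nat.cast_add, Nat.cast_one] at h5 ⊢
    refine le_trans (le_of_eq ?_) h5
    rw [← Real.exp_add, ← Real.exp_add]
    ring_nf

/-- The excursion from a single vertex: the part after time `L`, where `L` is a large multiple of
the size of the giant component. -/
theorem chainRun_exp_late (hm : 45 ≤ m) (h0 : 0 ≤ p) (h1 : p ≤ 1) (he0 : 0 < ε) (he1 : ε ≤ 1)
    (hmp : m * p = 1 + ε) (hL : 6 * ε + p ≤ p * L) (hN : 0 < N) (hNm : N ≤ m) (hf : N ≤ f) :
    chainRun p 0 (fun t _ _ => if t < L then 0 else Real.exp (ε ^ 2 * ((t : ℝ) - L)) - 1)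
      f 0 (N - 1) 1 ≤ 10 * ε := by
  -- `S t` is the sum of the rates 3ε² - pεs over s < t. The choice of L makes S L ≤ 0: the early
  -- growth has been repaid by time L.
  set S : ℕ → ℝ := fun t => 3 * ε ^ 2 * t - p * ε * t * (t - 1) / 2 with hS
  have hSL : S L ≤ 0 := by
    have : S L = -(ε * L / 2) * (p * L - (6 * ε + p)) := by simp only [hS]; ring
    rw [this]
    have h2 : 0 ≤ ε * L / 2 := by positivity
    nlinarith
  have hSs : ∀ t : ℕ, S (t + 1) = S t + (3 * ε ^ 2 - p * t * ε) := fun t => by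
    simp only [hS]; push_cast; ring
  have hL0 : 0 < L := by
    rcases Nat.eq_zero_or_pos L with rfl | h
    · norm_num at hL; nlinarith
    · exact h
  have hφ : ∀ a : ℕ, 0 ≤ Real.exp (ε * a) - Real.exp (-(8 * ε) * a) := fun a => by
    refine sub_nonneg.2 (Real.exp_le_exp.2 ?_)
    have : (0 : ℝ) ≤ ε * a := by positivity
    linarith
  -- Subtracting e^(-8εa) makes V vanish at a = 0 before time L and costs nothing, since that term
  -- grows at rate at least 3ε². The change of formula at time L is a decrease because e^(-S L) ≥ 1
  -- ≥ e^(-8εa).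
  set V : ℕ → ℕ → ℕ → ℝ := fun t _ a =>
    if t < L then Real.exp (-S t) * (Real.exp (ε * a) - Real.exp (-(8 * ε) * a))
    else Real.exp (ε ^ 2 * ((t : ℝ) - L)) * Real.exp (ε * a) - 1 with hV
  have hexp := exp_sub_one_le he0.le he1
  have h := chainRun_le (ρ := fun t _ _ => if t < L then 0 else Real.exp (ε ^ 2 * ((t : ℝ) - L)) - 1)
    (V := V) h0 h1 (T := 0) (M := N) (Nat.zero_le _) (fun t n _ _ => ?_)
    (fun t n a hM hna hta ha => ?_)
    (f := f) (t := 0) (n := N - 1) (a := 1) (by omega) (by omega) (by omega)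
  · refine h.trans ?_
    have h2 := Real.add_one_le_exp (-(8 * ε))
    have h3 : S 0 = 0 := by simp [hS]
    simp only [hV, if_pos hL0, h3, neg_zero, Real.exp_zero, one_mul, Nat.cast_one, mul_one]
    nlinarith
  · simp only [hV]
    split_ifs <;> simp
  · obtain ⟨a, rfl⟩ : ∃ b, a = b + 1 := ⟨a - 1, by omega⟩
    simp only [stepMean]
    have hnp : (n : ℝ) * p ≤ 1 + ε - p * t := by
      have h2 : (n : ℝ) + t ≤ m := by exact_mod_cast (by omega : n + t ≤ m)
      have := mul_le_mul_of_nonneg_right h2 h0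
      linarith
    have hnp0 : 0 ≤ (n : ℝ) * p := by positivity
    rcases Nat.lt_or_ge t L with htL | htL
    · have hV1 : ∀ k : ℕ, V (t + 1) (n - k) (a + k) ≤
          Real.exp (-S (t + 1)) * (Real.exp (ε * (a + k)) - Real.exp (-(8 * ε) * (a + k))) := by
        intro k
        simp only [hV]
        split_ifs with h2
        · push_cast; rfl
        · have h3 : t + 1 = L := by omega
          have h4 := hφ (a + k)
          push_cast at h4
          have h5 : 1 ≤ Real.exp (-S L) := Real.one_le_exp (by linarith)
          have h6 : Real.exp (-(8 * ε) * ((a : ℝ) + k)) ≤ 1 := by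
            refine Real.exp_le_one_iff.2 ?_
            have : (0 : ℝ) ≤ ε * (a + k) := by positivity
            linarith
          rw [h3]
          push_cast
          simp only [sub_self, mul_zero, Real.exp_zero, one_mul]
          nlinarith
      refine (binomialMean.mono h0 h1 fun k _ => hV1 k).trans ?_
      rw [binomialMean.const_mul, binomialMean.sub]
      have h3 := binomialMean_exp_le h0 h1 (n := n) (μ := ε) (r := 3 * ε ^ 2 - p * t * ε) (by
        have hpt : 0 ≤ p * t := by positivity
        have h4 : (n : ℝ) * p * (Real.exp ε - 1) ≤ (1 + ε - p * t) * (ε + ε ^ 2) :=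
          mul_le_mul hnp hexp (by linarith [Real.add_one_le_exp ε]) (by linarith)
        nlinarith [mul_nonneg hpt (sq_nonneg ε), mul_nonneg (sq_nonneg ε) (sub_nonneg.2 he1)]) a
      have h4 := le_binomialMean_exp_neg (n := n) hm he0 he1 hmp (by omega) a
      have h5 : Real.exp (-(8 * ε) * (a + 1) + (3 * ε ^ 2 - p * t * ε)) ≤
          Real.exp (-(8 * ε) * (a + 1) + 3 * ε ^ 2) := Real.exp_le_exp.2 (by
        have : 0 ≤ p * t * ε := by positivity
        linarith)
      have h6 : binomialMean p n (fun k => Real.exp (ε * (a + k))) -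
          binomialMean p n (fun k => Real.exp (-(8 * ε) * (a + k))) ≤
          Real.exp (ε * (a + 1) + (3 * ε ^ 2 - p * t * ε)) -
          Real.exp (-(8 * ε) * (a + 1) + (3 * ε ^ 2 - p * t * ε)) := by linarith
      refine (mul_le_mul_of_nonneg_left h6 (Real.exp_pos _).le).trans_eq ?_
      simp only [hV, if_pos htL]
      push_cast
      rw [mul_sub, mul_sub, ← Real.exp_add, ← Real.exp_add, ← Real.exp_add, ← Real.exp_add, hSs]
      ring_nf
    · have h2 : ∀ k : ℕ, V (t + 1) (n - k) (a + k) =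
          Real.exp (ε ^ 2 * ((t + 1 : ℝ) - L)) * Real.exp (ε * (a + k)) - 1 := fun k => by
        simp only [hV, if_neg (by omega : ¬ t + 1 < L)]
        push_cast; rfl
      simp only [h2]
      rw [binomialMean.sub, binomialMean.const, binomialMean.const_mul]
      have h3 := binomialMean_exp_le h0 h1 (n := n) (μ := ε) (r := -ε ^ 2) (by
        have h4 : p * L ≤ p * t := mul_le_mul_of_nonneg_left (by exact_mod_cast htL) h0
        have h5 : (n : ℝ) * p ≤ 1 - 5 * ε := by linarith
        have h4 : (n : ℝ) * p * (Real.exp ε - 1) ≤ (1 - 5 * ε) * (ε + ε ^ 2) :=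
          mul_le_mul h5 hexp (by linarith [Real.add_one_le_exp ε]) (by linarith)
        nlinarith [pow_pos he0 3]) a
      have h5 := mul_le_mul_of_nonneg_left h3 (Real.exp_pos (ε ^ 2 * ((t + 1 : ℝ) - L))).le
      simp only [hV, if_neg (by omega : ¬ t < L)]
      refine sub_le_sub_right (h5.trans_eq ?_) 1
      push_cast
      rw [← Real.exp_add, ← Real.exp_add]
      ring_nf

/-- The `j`-th moment of the size of the component of a vertex is `O(ε (ε m) ^ j)`. -/
theorem chainRun_pow_le (hm : 45 ≤ m) (h0 : 0 ≤ p) (h1 : p ≤ 1) (he0 : 0 < ε) (he1 : ε ≤ 1)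
    (hmp : m * p = 1 + ε) (hem : 1 ≤ ε ^ 3 * m) {j : ℕ} (hj : 0 < j) (hN : 0 < N) (hNm : N ≤ m)
    (hf : N ≤ f) :
    chainRun p 0 (fun t _ _ => (t : ℝ) ^ j) f 0 (N - 1) 1 ≤
      (16 ^ (j + 1) + 10 * 2 ^ j * j.factorial) * (ε * (ε * m) ^ j) := by
  have hm' : (45 : ℝ) ≤ m := by exact_mod_cast hm
  have hp0 : 0 < p := by
    rcases h0.lt_or_eq with h | h
    · exact h
    · rw [← h] at hmp; linarith
  -- The additional 1 supplies the summand p in 6ε + p ≤ pL.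
  set L := ⌈6 * ε / p⌉₊ + 1 with hL
  have hεm : 1 ≤ ε ^ 2 * (ε * m) := by linarith
  have hεm0 : 0 < ε * m := by positivity
  have hεm1 : 1 ≤ ε * m := hεm.trans (mul_le_of_le_one_left hεm0.le (pow_le_one₀ he0.le he1))
  have hdiv : 6 * ε / p * (1 + ε) = 6 * (ε * m) := by rw [← hmp]; field_simp
  have hd1 : 3 * (ε * m) ≤ 6 * ε / p := by
    have : 0 ≤ 6 * ε / p := by positivity
    nlinarith
  have hd2 : 6 * ε / p ≤ 6 * (ε * m) := by
    have : 0 ≤ 6 * ε / p := by positivity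
    nlinarith
  have hL1 : 6 * ε / p + 1 ≤ L := by
    rw [hL]; push_cast; linarith [Nat.le_ceil (6 * ε / p)]
  have hL2 : (L : ℝ) ≤ 8 * (ε * m) := by
    rw [hL]; push_cast; linarith [Nat.ceil_lt_add_one (a := 6 * ε / p) (by positivity)]
  have hLp : 6 * ε + p ≤ p * L := by
    have := mul_le_mul_of_nonneg_left hL1 h0
    have e : p * (6 * ε / p + 1) = 6 * ε + p := by field_simp
    linarith
  have hL0 : (0 : ℝ) < L := by linarith
  have hA := chainRun_one_sub_exp (f := f) hm h0 h1 he0 he1 hmp hN hNm hf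
  have hB := chainRun_exp_late (f := f) hm h0 h1 he0 he1 hmp hLp hN hNm hf
  -- Split t at L. The part up to L satisfies min(t, L) ≤ 2L(1 - e^(-3ε²t)) because ε²L ≥ 1; the
  -- part beyond L is dominated by an exponential.
  have hpt : ∀ t : ℕ, (t : ℝ) ^ j ≤
      2 * L ^ j * 2 ^ j * (1 - Real.exp (-(3 * ε ^ 2) * t)) + 2 ^ j * (j.factorial / (ε ^ 2) ^ j) *
        (if t < L then 0 else Real.exp (ε ^ 2 * ((t : ℝ) - L)) - 1) := by
    intro t
    have hx : 0 ≤ 3 * ε ^ 2 * (t : ℝ) := by positivity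
    have hmin : min (t : ℝ) L ≤ L * (2 * (1 - Real.exp (-(3 * ε ^ 2) * t))) := by
      have h2 : 1 - Real.exp (-(3 * ε ^ 2) * t) ≥ 1 - 1 / (1 + 3 * ε ^ 2 * t) := by
        have := Real.add_one_le_exp (3 * ε ^ 2 * (t : ℝ))
        rw [neg_mul, Real.exp_neg, ← one_div]
        exact sub_le_sub_left (one_div_le_one_div_of_le (by linarith) (by linarith)) 1
      have h3 : 1 - 1 / (1 + 3 * ε ^ 2 * (t : ℝ)) = 3 * ε ^ 2 * t / (1 + 3 * ε ^ 2 * t) := by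
        field_simp; ring
      rw [h3] at h2
      refine le_trans ?_ (mul_le_mul_of_nonneg_left (mul_le_mul_of_nonneg_left h2 zero_le_two)
        hL0.le)
      rw [← mul_assoc, ← mul_div_assoc, le_div_iff₀ (by linarith)]
      have hLe : 1 ≤ ε ^ 2 * L := by nlinarith [sq_nonneg ε]
      rcases le_total (t : ℝ) L with h4 | h4
      · rw [min_eq_left h4]
        have h5 : (0 : ℝ) ≤ t := by positivity
        have h6 : 0 ≤ ε ^ 2 * t * (L - t) := by
          have := sub_nonneg.2 h4; positivity
        nlinarith
      · rw [min_eq_right h4]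
        have h5 : ε ^ 2 * L ≤ ε ^ 2 * t := mul_le_mul_of_nonneg_left h4 (sq_nonneg ε)
        nlinarith
    have hmin0 : 0 ≤ min (t : ℝ) L := by positivity
    have hminj : (min (t : ℝ) L) ^ j ≤ 2 * L ^ j * (1 - Real.exp (-(3 * ε ^ 2) * t)) := by
      obtain ⟨i, rfl⟩ : ∃ i, j = i + 1 := ⟨j - 1, by omega⟩
      calc (min (t : ℝ) L) ^ (i + 1) = (min (t : ℝ) L) ^ i * min (t : ℝ) L := pow_succ _ _
        _ ≤ L ^ i * (L * (2 * (1 - Real.exp (-(3 * ε ^ 2) * t)))) :=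
          mul_le_mul (pow_le_pow_left₀ hmin0 (min_le_right _ _) i) hmin hmin0 (by positivity)
        _ = _ := by ring
    split_ifs with htL
    · have h4 : min (t : ℝ) L = t := min_eq_left (by exact_mod_cast htL.le)
      rw [h4] at hminj
      have h5 : (1 : ℝ) ≤ 2 ^ j := one_le_pow₀ (by norm_num)
      have h6 : (0 : ℝ) ≤ (t : ℝ) ^ j := by positivity
      nlinarith
    · have h4 : (L : ℝ) ≤ t := by exact_mod_cast (not_lt.1 htL)
      rw [min_eq_right h4] at hminj
      have h5 := pow_le_factorial_mul_exp (x := ε ^ 2 * ((t : ℝ) - L))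
        (mul_nonneg (sq_nonneg ε) (sub_nonneg.2 h4)) hj
      have h6 : ((t : ℝ) - L) ^ j ≤ j.factorial / (ε ^ 2) ^ j *
          (Real.exp (ε ^ 2 * ((t : ℝ) - L)) - 1) := by
        rw [div_mul_eq_mul_div, le_div_iff₀ (by positivity), mul_comm, ← mul_pow]
        exact h5
      have h7 : (t : ℝ) ^ j ≤ 2 ^ j * ((L : ℝ) ^ j + ((t : ℝ) - L) ^ j) := by
        have h8 : (t : ℝ) ≤ 2 * max (L : ℝ) (t - L) := by
          have := le_max_left (L : ℝ) (t - L); have := le_max_right (L : ℝ) (t - L); linarith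
        have h9 : 0 ≤ (t : ℝ) - L := sub_nonneg.2 h4
        refine (pow_le_pow_left₀ (by positivity) h8 j).trans ?_
        rw [mul_pow]
        refine mul_le_mul_of_nonneg_left ?_ (by positivity)
        rcases le_total (L : ℝ) (t - L) with h10 | h10
        · rw [max_eq_right h10]; linarith [pow_nonneg hL0.le j]
        · rw [max_eq_left h10]; linarith [pow_nonneg h9 j]
      have h10 : (0 : ℝ) ≤ 2 ^ j := by positivity
      nlinarith
  have h := chainRun_mono h0 h1 (T := 0) (fun t n a => hpt t) f 0 (N - 1) 1
  rw [chainRun_add p 0 (fun t _ _ => 2 * L ^ j * 2 ^ j * (1 - Real.exp (-(3 * ε ^ 2) * t)))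
    (fun t _ _ => 2 ^ j * (j.factorial / (ε ^ 2) ^ j) *
        (if t < L then 0 else Real.exp (ε ^ 2 * ((t : ℝ) - L)) - 1)),
    chainRun_const_mul, chainRun_const_mul] at h
  refine h.trans ?_
  have h2 : 2 * (L : ℝ) ^ j * 2 ^ j * (8 * ε) ≤ 16 ^ (j + 1) * (ε * (ε * m) ^ j) := by
    have := pow_le_pow_left₀ hL0.le hL2 j
    calc 2 * (L : ℝ) ^ j * 2 ^ j * (8 * ε) ≤ 2 * (8 * (ε * m)) ^ j * 2 ^ j * (8 * ε) := by gcongr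
      _ = _ := by
        rw [mul_pow 8 (ε * m), pow_succ, show (16 : ℝ) = 8 * 2 by norm_num, mul_pow 8 2]; ring
  have h3 : 2 ^ j * (j.factorial / (ε ^ 2) ^ j) * (10 * ε) ≤
      10 * 2 ^ j * j.factorial * (ε * (ε * m) ^ j) := by
    have h4 : 1 / (ε ^ 2) ^ j ≤ (ε * m) ^ j := by
      rw [div_le_iff₀ (by positivity), ← mul_pow]
      exact one_le_pow₀ (by linarith)
    calc (2 : ℝ) ^ j * (j.factorial / (ε ^ 2) ^ j) * (10 * ε) =
        10 * 2 ^ j * j.factorial * (ε * (1 / (ε ^ 2) ^ j)) := by ring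
      _ ≤ _ := by gcongr
  have h5 := mul_le_mul_of_nonneg_left hA (show (0 : ℝ) ≤ 2 * L ^ j * 2 ^ j by positivity)
  have h6 := mul_le_mul_of_nonneg_left hB
    (show (0 : ℝ) ≤ 2 ^ j * (j.factorial / (ε ^ 2) ^ j) by positivity)
  linarith

/-- The exponential moment of the length of the excursion from a single vertex, restricted to
lengths less than about half of the typical size of the giant component. -/
theorem chainRun_exp_small (hm : 45 ≤ m) (h0 : 0 ≤ p) (h1 : p ≤ 1) (he0 : 0 < ε) (he1 : ε ≤ 1)
    (hmp : m * p = 1 + ε) {T : ℕ} (hT : p * T ≤ ε / 2 + p) :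
    chainRun p 0 (fun t _ _ => if t < T then Real.exp (ε ^ 2 / 24 * t) - 1 else 0)
      m 0 (m - 1) 1 ≤ 8 * ε := by
  set W : ℝ → ℝ → ℝ := fun t a => Real.exp (ε ^ 2 / 24 * t) * Real.exp (-(ε / 6) * a) -
    Real.exp (-(8 * ε) * a) with hW
  have hW0 : ∀ t a : ℕ, 0 ≤ W t a := fun t a => by
    refine sub_nonneg.2 ?_
    rw [← Real.exp_add]
    refine Real.exp_le_exp.2 ?_
    have h2 : (0 : ℝ) ≤ ε * a := by positivity
    have h3 : 0 ≤ ε ^ 2 / 24 * (t : ℝ) := by positivity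
    linarith
  -- The cutoff uses t + a, which never decreases. Below T, enough neutral vertices remain to give
  -- np ≥ 1 + ε/2; once T is reached, the excursion cannot end before T and the payoff is 0.
  set V : ℕ → ℕ → ℕ → ℝ := fun t _ a => if t + a < T then W t a else 0 with hV
  have h := chainRun_le
    (ρ := fun t _ _ => if t < T then Real.exp (ε ^ 2 / 24 * t) - 1 else 0)
    (V := V) h0 h1 (T := 0) (M := m) (Nat.zero_le _) (fun t n _ _ => by
      simp only [hV, hW, add_zero, Nat.cast_zero, mul_zero, Real.exp_zero, mul_one]; rfl)
    (fun t n a hM hna hta ha => ?_)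
    (f := m) (t := 0) (n := m - 1) (a := 1) (by omega) (by omega) (by omega)
  · refine h.trans ?_
    have h2 := Real.add_one_le_exp (-(8 * ε))
    have h3 : Real.exp (-(ε / 6)) ≤ 1 := Real.exp_le_one_iff.2 (by linarith)
    simp only [hV, hW]
    split_ifs
    · simp only [Nat.cast_zero, mul_zero, Real.exp_zero, one_mul, Nat.cast_one, mul_one]
      linarith
    · linarith
  · obtain ⟨a, rfl⟩ : ∃ b, a = b + 1 := ⟨a - 1, by omega⟩
    simp only [stepMean]
    by_cases hta' : t + (a + 1) < T
    · have hV1 : ∀ k : ℕ, V (t + 1) (n - k) (a + k) ≤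
          Real.exp (ε ^ 2 / 24 * (t + 1)) * Real.exp (-(ε / 6) * (a + k)) -
            Real.exp (-(8 * ε) * (a + k)) := by
        intro k
        have := hW0 (t + 1) (a + k)
        simp only [hV]
        simp only [hW] at this ⊢
        push_cast at this ⊢
        split_ifs
        · exact le_rfl
        · exact this
      refine (binomialMean.mono h0 h1 fun k _ => hV1 k).trans ?_
      rw [binomialMean.sub, binomialMean.const_mul]
      have hnp : 1 + ε / 2 ≤ (n : ℝ) * p := by
        have h2 : (n : ℝ) + (t + (a + 1)) = m := by exact_mod_cast (by omega : n + (t + (a + 1)) = m)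
        have h3 : (t : ℝ) + (a + 1) + 1 ≤ T := by exact_mod_cast hta'
        have h4 := mul_le_mul_of_nonneg_left h3 h0
        have h5 : (n : ℝ) * p + p * (t + (a + 1)) = 1 + ε := by rw [← hmp, ← h2]; ring
        linarith
      have hexp := exp_neg_sub_one_le (x := ε / 6) (by linarith) (by linarith)
      -- The rate 1/24 comes from (1 + ε/2)(-ε/6 + ε²/36) ≤ -ε/6 - ε²/24, with equality at ε = 1.
      have h3 := binomialMean_exp_le h0 h1 (n := n) (μ := -(ε / 6)) (r := -(ε ^ 2 / 24)) (by
        have h4 : (n : ℝ) * p * (Real.exp (-(ε / 6)) - 1) ≤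
            (n : ℝ) * p * (-(ε / 6) + (ε / 6) ^ 2) :=
          mul_le_mul_of_nonneg_left hexp (by linarith)
        have h5 : (n : ℝ) * p * (-(ε / 6) + (ε / 6) ^ 2) ≤
            (1 + ε / 2) * (-(ε / 6) + (ε / 6) ^ 2) :=
          mul_le_mul_of_nonpos_right hnp (by nlinarith)
        nlinarith [mul_nonneg (sq_nonneg ε) (sub_nonneg.2 he1)]) a
      have h4 := le_binomialMean_exp_neg (n := n) hm he0 he1 hmp (by omega) a
      have h5 : Real.exp (-(8 * ε) * (a + 1)) ≤ Real.exp (-(8 * ε) * (a + 1) + 3 * ε ^ 2) :=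
        Real.exp_le_exp.2 (by nlinarith)
      have h6 := mul_le_mul_of_nonneg_left h3 (Real.exp_pos (ε ^ 2 / 24 * ((t : ℝ) + 1))).le
      simp only [hV, if_pos hta', hW]
      push_cast
      have e : Real.exp (ε ^ 2 / 24 * ((t : ℝ) + 1)) *
          Real.exp (-(ε / 6) * (a + 1) + -(ε ^ 2 / 24)) =
          Real.exp (ε ^ 2 / 24 * t) * Real.exp (-(ε / 6) * (a + 1)) := by
        rw [← Real.exp_add, ← Real.exp_add]; ring_nf
      linarith
    · have hk : ∀ k : ℕ, ¬ (t + 1 + (a + k) < T) := fun k => by omega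
      simp only [hV, if_neg hta', hk, if_false]
      exact (binomialMean.const n 0).le

theorem chainRun_pow_small (hm : 45 ≤ m) (h0 : 0 ≤ p) (h1 : p ≤ 1) (he0 : 0 < ε) (he1 : ε ≤ 1)
    (hmp : m * p = 1 + ε) {T j : ℕ} (hj : 0 < j) (hT : p * T ≤ ε / 2 + p) :
    chainRun p 0 (fun t _ _ => if t < T then (t : ℝ) ^ j else 0) m 0 (m - 1) 1 ≤
      8 * j.factorial * 24 ^ j * (ε / ε ^ (2 * j)) := by
  have h := chainRun_mono h0 h1 (T := 0) (ρ := fun t _ _ => if t < T then (t : ℝ) ^ j else 0)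
    (ρ' := fun t _ _ => j.factorial * 24 ^ j / ε ^ (2 * j) *
      (if t < T then Real.exp (ε ^ 2 / 24 * t) - 1 else 0))
    (fun t n a => by
      split_ifs
      · have := pow_le_factorial_mul_exp (x := ε ^ 2 / 24 * t) (by positivity) hj
        rw [mul_pow, div_pow, ← pow_mul] at this
        rw [div_mul_eq_mul_div, le_div_iff₀ (by positivity)]
        rw [div_mul_eq_mul_div, div_le_iff₀ (by positivity)] at this
        linarith
      · simp) m 0 (m - 1) 1
  rw [chainRun_const_mul] at h
  refine h.trans ((mul_le_mul_of_nonneg_left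
    (chainRun_exp_small hm h0 h1 he0 he1 hmp hT) (by positivity)).trans_eq ?_)
  ring

end supercritical


/-! ### The number of neutral vertices -/

/-- A neutral vertex survives a step with probability 1 - p, and (1 - p)e^p ≤ 1. So a generating
function of the number of neutral vertices is a supermartingale when its parameter moves with
e^(pt). -/
theorem binomialMean_pow_sub_le {p b : ℝ} (h1 : p ≤ 1) (hb : 0 ≤ b) (n t : ℕ) :
    binomialMean p n (fun k => (1 + b * Real.exp (p * (t + 1 : ℕ))) ^ (n - k)) ≤
      (1 + b * Real.exp (p * t)) ^ n := by
  rw [binomialMean.pow_sub]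
  have h2 : (1 - p) * Real.exp p ≤ 1 := by
    have h3 : 1 - p ≤ Real.exp (-p) := by linarith [Real.add_one_le_exp (-p)]
    calc (1 - p) * Real.exp p ≤ Real.exp (-p) * Real.exp p :=
          mul_le_mul_of_nonneg_right h3 (Real.exp_pos p).le
      _ = 1 := by rw [← Real.exp_add]; simp
  have h3 : p + (1 - p) * (1 + b * Real.exp (p * (t + 1 : ℕ))) =
      1 + b * Real.exp (p * t) * ((1 - p) * Real.exp p) := by
    push_cast
    rw [show p * ((t : ℝ) + 1) = p * t + p by ring, Real.exp_add]; ring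
  rw [h3]
  have h4 : 0 ≤ (1 - p) * Real.exp p := mul_nonneg (by linarith) (Real.exp_pos p).le
  have h5 : 0 ≤ b * Real.exp (p * t) := by positivity
  exact pow_le_pow_left₀ (by positivity) (by nlinarith) n

theorem stepMean_pow_le {p b : ℝ} (h1 : p ≤ 1) (hb : 0 ≤ b) (n a t : ℕ) :
    stepMean p (fun n _ => (1 + b * Real.exp (p * (t + 1 : ℕ))) ^ n) n (a + 1) ≤
      (1 + b * Real.exp (p * t)) ^ n :=
  binomialMean_pow_sub_le h1 hb n t

/-- When a component begins, one neutral vertex is lost at once and the exponent drops from n + 1 to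
n. This extra factor is what later counts components. -/
theorem stepMean_pow_zero_le {p b : ℝ} (h1 : p ≤ 1) (hb : 0 ≤ b) (n t : ℕ) :
    stepMean p (fun n _ => (1 + b * Real.exp (p * (t + 1 : ℕ))) ^ n) (n + 1) 0 ≤
      (1 + b * Real.exp (p * t)) ^ n :=
  binomialMean_pow_sub_le h1 hb n t

theorem sub_sq_half_le_log {x : ℝ} (hx : 0 ≤ x) : x - x ^ 2 / 2 ≤ Real.log (1 + x) := by
  refine le_trans ?_ (Real.le_log_one_add_of_nonneg hx)
  rw [le_div_iff₀ (by linarith)]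
  nlinarith [pow_nonneg hx 3]

/-- If there is no active vertex at a time `t` well before the end of the giant component, then the
number of neutral vertices is exceptionally large. -/
theorem neutral_large {m t n : ℕ} {ε p : ℝ} (he0 : 0 < ε) (he1 : ε ≤ 1) (hmp : m * p = 1 + ε)
    (h0 : 0 ≤ p) (htn : t + n = m) (hpt : p * t ≤ 11 / 10 * ε) :
    (1 + ε / 100) ^ m * Real.exp (ε ^ 2 * t / 1000) ≤ (1 + ε / 100 * Real.exp (p * t)) ^ n := by
  set b := ε / 100 with hb
  set y := p * t with hy
  have hb0 : 0 < b := by positivity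
  have hy0 : 0 ≤ y := by positivity
  have hE1 : 1 + y + y ^ 2 / 2 ≤ Real.exp y := Real.quadratic_le_exp_of_nonneg hy0
  have hE2 : Real.exp y ≤ 31 / 10 := by
    have h1 : Real.exp y ≤ Real.exp (1 + 1 / 10) := Real.exp_le_exp.2 (by linarith)
    have h2 := exp_sub_one_le (x := 1 / 10) (by norm_num) (by norm_num)
    rw [Real.exp_add] at h1
    have h3 := Real.exp_one_lt_d9
    nlinarith [Real.exp_pos 1]
  set u := Real.exp y - 1 with hu
  have hu0 : 0 ≤ u := by linarith [sq_nonneg y]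
  have hu1 : u ≤ 31 / 10 * y := by
    have h2 : 1 - y ≤ Real.exp (-y) := by linarith [Real.add_one_le_exp (-y)]
    have h3 : (1 - y) * Real.exp y ≤ 1 := by
      calc (1 - y) * Real.exp y ≤ Real.exp (-y) * Real.exp y :=
            mul_le_mul_of_nonneg_right h2 (Real.exp_pos y).le
        _ = 1 := by rw [← Real.exp_add]; simp
    nlinarith
  set x := b * u / (1 + b) with hx
  have hx0 : 0 ≤ x := by positivity
  -- As n = m - t, this factorisation turns the claim into e^(ε²t/1000) (1 + b e^y)^t ≤ (1 + x)^m.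
  have hfac : 1 + b * Real.exp y = (1 + b) * (1 + x) := by
    rw [hx, hu]; field_simp; ring
  have hx1 : x ≤ b * u := div_le_self (by positivity) (by linarith)
  have hx2 : b * u * (1 - b) ≤ x := by
    rw [hx, le_div_iff₀ (by linarith)]
    nlinarith [mul_nonneg (mul_nonneg hb0.le hu0) (sq_nonneg b)]
  -- First-order gain in b: the surplus of m - t over the typical m e^(-pt), positive since y ≤
  -- 11ε/10. The second-order losses are bounded by 19/100 in `hloss`; this is why b is only ε/100.
  have hmain : y * ε * (39 / 100) ≤ (u * (1 + ε) - y * Real.exp y) := by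
    have h2 : 0 ≤ 1 + ε - y := by linarith
    have h3 := mul_le_mul_of_nonneg_right hE1 h2
    have h4 : u * (1 + ε) - y * Real.exp y = Real.exp y * (1 + ε - y) - (1 + ε) := by rw [hu]; ring
    have h5 : ε * (39 / 100) ≤ ε - y / 2 + ε * y / 2 - y ^ 2 / 2 := by nlinarith
    have h6 := mul_le_mul_of_nonneg_left h5 hy0
    rw [h4]
    nlinarith
  have hloss : b * (u + u ^ 2 / 2) * (1 + ε) ≤ y * ε * (19 / 100) := by
    have h2 : u ^ 2 ≤ 31 / 10 * y * (31 / 10 * (11 / 10)) := by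
      rw [sq]; exact mul_le_mul hu1 (by nlinarith) hu0 (by positivity)
    have h3 : (u + u ^ 2 / 2) * (1 + ε) ≤ (9 * y) * 2 :=
      mul_le_mul (by nlinarith) (by linarith) (by linarith) (by positivity)
    have h4 := mul_le_mul_of_nonneg_left h3 hb0.le
    rw [hb] at h4 ⊢
    nlinarith [mul_nonneg hy0 he0.le]
  have hkey : (ε ^ 2 / 1000 + b * Real.exp y) * y ≤ (x - x ^ 2 / 2) * (1 + ε) := by
    have h2 : x ^ 2 ≤ (b * u) ^ 2 := pow_le_pow_left₀ hx0 hx1 2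
    have h3 : b * (u - b * u - b * u ^ 2 / 2) * (1 + ε) ≤ (x - x ^ 2 / 2) * (1 + ε) :=
      mul_le_mul_of_nonneg_right (by nlinarith) (by linarith)
    refine le_trans ?_ h3
    have h5 : y * ε / 10 ≤ (u - b * u - b * u ^ 2 / 2) * (1 + ε) - y * Real.exp y := by
      nlinarith [mul_nonneg hy0 he0.le]
    have h6 := mul_le_mul_of_nonneg_left h5 hb0.le
    have h7 : b * (y * ε / 10) = ε ^ 2 / 1000 * y := by rw [hb]; ring
    linarith
  have hm0 : (0 : ℝ) ≤ m := by positivity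
  have hkey2 : ε ^ 2 * t / 1000 + t * (b * Real.exp y) ≤ m * (x - x ^ 2 / 2) := by
    have h2 := mul_le_mul_of_nonneg_left hkey hm0
    have h3 : (m : ℝ) * ((ε ^ 2 / 1000 + b * Real.exp y) * y) =
        (ε ^ 2 * t / 1000 + t * (b * Real.exp y)) * (1 + ε) := by rw [hy, ← hmp]; ring
    rw [h3] at h2
    exact le_of_mul_le_mul_right (h2.trans_eq (mul_assoc _ _ _).symm) (by linarith)
  have hpos : 0 < 1 + b * Real.exp y := by positivity
  have h8 : Real.exp (ε ^ 2 * t / 1000) * (1 + b * Real.exp y) ^ t ≤ (1 + x) ^ m := by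
    have h9 : (1 + b * Real.exp y) ^ t ≤ Real.exp (t * (b * Real.exp y)) := by
      rw [Real.exp_nat_mul]
      exact pow_le_pow_left₀ hpos.le (by linarith [Real.add_one_le_exp (b * Real.exp y)]) t
    calc _ ≤ Real.exp (ε ^ 2 * t / 1000) * Real.exp (t * (b * Real.exp y)) :=
          mul_le_mul_of_nonneg_left h9 (Real.exp_pos _).le
      _ = Real.exp (ε ^ 2 * t / 1000 + t * (b * Real.exp y)) := (Real.exp_add _ _).symm
      _ ≤ Real.exp (m * Real.log (1 + x)) := Real.exp_le_exp.2
          (hkey2.trans (mul_le_mul_of_nonneg_left (sub_sq_half_le_log hx0) hm0))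
      _ = (1 + x) ^ m := by rw [Real.exp_nat_mul, Real.exp_log (by linarith)]
  have h10 : (1 + b) ^ m * Real.exp (ε ^ 2 * t / 1000) * (1 + b * Real.exp y) ^ t ≤
      (1 + b * Real.exp y) ^ n * (1 + b * Real.exp y) ^ t := by
    rw [← pow_add, add_comm n t, htn, mul_assoc]
    conv_rhs => rw [hfac, mul_pow]
    exact mul_le_mul_of_nonneg_left h8 (by positivity)
  exact le_of_mul_le_mul_right h10 (by positivity)

/-- With exponentially small error, the component at time `T` reaches the end of the giant
component. -/
theorem chainRun_le_of_late {m T : ℕ} {ε p A B : ℝ} (h0 : 0 ≤ p) (h1 : p ≤ 1) (he0 : 0 < ε)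
    (he1 : ε ≤ 1) (hmp : m * p = 1 + ε) (hm : 0 < m) (hT : T ≤ m) (hB : 0 ≤ B)
    {ρ : ℕ → ℕ → ℕ → ℝ}
    (hρ : ∀ t n, t + n = m → ρ t n 0 ≤ A + if p * t < 11 / 10 * ε then B else 0) :
    chainRun p T ρ m 0 (m - 1) 1 ≤ A + B * Real.exp (-(ε ^ 2 * T / 1000)) := by
  set b := ε / 100 with hb
  have hb0 : 0 < b := by positivity
  -- Normalised so that at an early stop, where the power has grown by at least e^(ε²T/1000), the
  -- supermartingale pays for B.
  set K := B * Real.exp (-(ε ^ 2 * T / 1000)) / (1 + b) ^ m with hK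
  have hK0 : 0 ≤ K := by positivity
  have h := chainRun_le (ρ := ρ)
    (V := fun t n _ => A + K * (1 + b * Real.exp (p * t)) ^ n) h0 h1
    (T := T) (M := m) hT (fun t n htn hTt => ?_)
    (fun t n a hM hna hta ha => ?_)
    (f := m) (t := 0) (n := m - 1) (a := 1) (by omega) (by omega) (by omega)
  · refine h.trans (add_le_add_right ?_ A)
    simp only [Nat.cast_zero, mul_zero, Real.exp_zero, mul_one]
    rw [hK, div_mul_eq_mul_div, div_le_iff₀ (by positivity)]
    refine mul_le_mul_of_nonneg_left (pow_le_pow_right₀ (by linarith) (by omega)) (by positivity)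
  · refine (hρ t n htn).trans (add_le_add_right ?_ A)
    split_ifs with h2
    · have h3 := neutral_large he0 he1 hmp h0 htn h2.le
      rw [hK, div_mul_eq_mul_div, le_div_iff₀ (by positivity), mul_assoc]
      refine mul_le_mul_of_nonneg_left ?_ hB
      calc (1 + b) ^ m = Real.exp (-(ε ^ 2 * T / 1000)) * ((1 + b) ^ m *
            Real.exp (ε ^ 2 * T / 1000)) := by
            rw [mul_comm, mul_assoc, ← Real.exp_add]; simp
        _ ≤ Real.exp (-(ε ^ 2 * T / 1000)) * ((1 + b) ^ m * Real.exp (ε ^ 2 * t / 1000)) := by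
            gcongr
        _ ≤ _ := mul_le_mul_of_nonneg_left h3 (Real.exp_pos _).le
    · positivity
  · have hc : stepMean p (fun n a => A + K * (1 + b * Real.exp (p * (t + 1 : ℕ))) ^ n) n a =
        stepMean p (fun _ _ => A) n a +
          K * stepMean p (fun n _ => (1 + b * Real.exp (p * (t + 1 : ℕ))) ^ n) n a := by
      rw [stepMean_add p (fun _ _ => A)
        (fun n _ => K * (1 + b * Real.exp (p * (t + 1 : ℕ))) ^ n), stepMean_const_mul]
    rw [hc]
    rcases a with _ | a
    · obtain ⟨n, rfl⟩ : ∃ n', n = n' + 1 := ⟨n - 1, by omega⟩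
      refine add_le_add (binomialMean.const _ _).le (mul_le_mul_of_nonneg_left ?_ hK0)
      refine (stepMean_pow_zero_le h1 hb0.le n t).trans (pow_le_pow_right₀ ?_ (Nat.le_succ n))
      linarith [mul_pos hb0 (Real.exp_pos (p * t))]
    · exact add_le_add (binomialMean.const _ _).le
        (mul_le_mul_of_nonneg_left (stepMean_pow_le h1 hb0.le n a t) hK0)

/-! ### Components other than the giant -/

theorem componentSize_le_card {m : ℕ} (G : SimpleGraph (Fin m)) (v : Fin m) :
    componentSize G v ≤ m := by
  simpa using componentSize_le (G := G) (K := Finset.univ) (by simp) (Finset.mem_univ v)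

theorem sumOtherComponents_le_pow {m : ℕ} (G : SimpleGraph (Fin m)) (x : ℝ) (j : ℕ) :
    sumOtherComponents G x (j + 1) ≤ m * m ^ j := by
  classical
  rw [sumOtherComponents_eq]
  refine (Finset.sum_le_sum_of_subset (Finset.filter_subset _ _)).trans ?_
  refine (Finset.sum_le_card_nsmul _ _ (m ^ j) fun v _ =>
    Nat.pow_le_pow_left (componentSize_le_card G v) j).trans ?_
  simp

/-- C₄ comes from components completed earlier, C₁ from the subcritical remainder after a late stop,
and C₂C₃ from the crude moment bound weighted by the chance of an early stop. The term 45^j covers m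
< 45, where `exp_sq_le_pow` does not apply. -/
theorem exists_sumOtherComponents_bound {δ : ℝ} (hδ0 : 0 < δ) (hδ1 : δ ≤ 1 / 4) {j : ℕ}
    (hj : 0 < j) :
    ∃ C : ℝ, 0 < C ∧ ∀ (m : ℕ) (ε : ℝ) (p : unitInterval), 0 < ε → ε ≤ 1 →
      (p : ℝ) = (1 + ε) / m → 1 ≤ ε ^ 3 * m →
      ∫ G, (sumOtherComponents G (δ * ε * m) (j + 1) : ℝ)
        ∂(SimpleGraph.binomialRandom (Fin m) p) ≤ C * m * (ε / ε ^ (2 * j)) := by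
  set C₁ : ℝ := j.factorial * 4 ^ j * 10 ^ (2 * j) with hC₁
  set C₂ : ℝ := 16 ^ (j + 1) + 10 * 2 ^ j * j.factorial with hC₂
  set C₃ : ℝ := j.factorial / (δ / 1000) ^ j with hC₃
  set C₄ : ℝ := 8 * j.factorial * 24 ^ j with hC₄
  refine ⟨45 ^ j + (C₄ + (C₁ + C₂ * C₃)), by positivity, fun m ε p he0 he1 hp hem => ?_⟩
  have hm0 : 0 < m := by
    rcases Nat.eq_zero_or_pos m with rfl | h
    · norm_num at hem
    · exact h
  have hm0' : (0 : ℝ) < m := by exact_mod_cast hm0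
  have hrest : 0 ≤ C₄ + (C₁ + C₂ * C₃) := by positivity
  have hQ0 : 0 < ε / ε ^ (2 * j) := by positivity
  rcases Nat.lt_or_ge m 45 with hm | hm
  · have h2 : ∫ G, (sumOtherComponents G (δ * ε * m) (j + 1) : ℝ)
        ∂(SimpleGraph.binomialRandom (Fin m) p) ≤ m * 45 ^ j := by
      refine (integral_mono (integrable_binomialRandom p _) (integrable_binomialRandom p _)
        (g := fun _ => (m : ℝ) * 45 ^ j) fun G => ?_).trans_eq (by simp)
      have h3 := sumOtherComponents_le_pow G (δ * ε * m) j
      have h4 : (sumOtherComponents G (δ * ε * m) (j + 1) : ℝ) ≤ m * m ^ j := by exact_mod_cast h3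
      refine h4.trans (mul_le_mul_of_nonneg_left (pow_le_pow_left₀ hm0'.le ?_ j) hm0'.le)
      exact_mod_cast hm.le
    refine h2.trans ?_
    have h3 : 1 ≤ ε / ε ^ (2 * j) := by
      rw [le_div_iff₀ (by positivity), one_mul]
      exact pow_le_of_le_one he0.le he1 (by omega)
    have h4 : (45 : ℝ) ^ j ≤ 45 ^ j + (C₄ + (C₁ + C₂ * C₃)) := by linarith
    calc (m : ℝ) * 45 ^ j ≤ m * (45 ^ j + (C₄ + (C₁ + C₂ * C₃))) := by gcongr
      _ = (45 ^ j + (C₄ + (C₁ + C₂ * C₃))) * m * 1 := by ring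
      _ ≤ _ := mul_le_mul_of_nonneg_left h3 (by positivity)
  have h0 : (0 : ℝ) ≤ p := p.2.1
  have h1 : (p : ℝ) ≤ 1 := p.2.2
  have hmp : (m : ℝ) * p = 1 + ε := by rw [hp]; field_simp
  set x := δ * ε * m with hx
  have hx0 : 0 < x := by positivity
  have hxm : x ≤ m := by
    have : δ * ε ≤ 1 := by nlinarith
    calc x ≤ 1 * m := mul_le_mul_of_nonneg_right this hm0'.le
      _ = m := one_mul _
  set T := ⌈x⌉₊ with hT
  have hTx : x ≤ T := Nat.le_ceil x
  have hTx' : (T : ℝ) ≤ x + 1 := (Nat.ceil_lt_add_one hx0.le).le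
  have hTm : T ≤ m := Nat.ceil_le.2 hxm
  have hpT : (p : ℝ) * T ≤ ε / 2 + p := by
    have h2 := mul_le_mul_of_nonneg_left hTx' h0
    have h3 : (p : ℝ) * x = δ * ε * (1 + ε) := by rw [hx, ← hmp]; ring
    have h4 : δ * ε * (1 + ε) ≤ 1 / 4 * ε * 2 := by gcongr; linarith
    linarith
  have hsmall := chainRun_pow_small hm h0 h1 he0 he1 hmp hj hpT
  set A : ℝ := m * (C₁ * (ε / ε ^ (2 * j))) with hA
  set B : ℝ := m * (C₂ * (ε * (ε * m) ^ j)) with hB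
  have hB0 : 0 ≤ B := by positivity
  have hA0 : 0 ≤ A := by positivity
  have hlate := chainRun_le_of_late (T := T) (A := A) (B := B) h0 h1 he0 he1 hmp hm0 hTm hB0
    (ρ := fun _ n a => n * chainRun p 0 (fun t _ _ => (t : ℝ) ^ j) m 0 (n + a - 1) 1)
    (fun t n htn => by
      rcases Nat.eq_zero_or_pos n with rfl | hn
      · simp only [Nat.cast_zero, zero_mul]; split_ifs <;> positivity
      have hnm : (n : ℝ) ≤ m := by exact_mod_cast (by omega : n ≤ m)
      split_ifs with h2
      · have h3 := chainRun_pow_le (f := m) (N := n) hm h0 h1 he0 he1 hmp hem hj hn (by omega)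
          (by omega)
        have h4 : (n : ℝ) * chainRun p 0 (fun t _ _ => (t : ℝ) ^ j) m 0 (n + 0 - 1) 1 ≤ B :=
          -- Nonnegativity of the expectation, by comparison with the payoff 0.
          mul_le_mul hnm h3 ((chainRun_mono h0 h1 (ρ := fun _ _ _ => 0)
            (fun t n a => by positivity) m 0 (n - 1) 1).trans' (by
              rw [show (fun (_ _ _ : ℕ) => (0 : ℝ)) = fun _ _ _ => 0 * 0 by simp,
                chainRun_const_mul p 0 0 (fun _ _ _ => 0)]; simp)) hm0'.le
        linarith
      · have h2 := not_lt.1 h2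
        have h5 : (n : ℝ) * p ≤ 1 - ε / 10 := by
          have : (t : ℝ) + n = m := by exact_mod_cast htn
          have : (n : ℝ) * p = 1 + ε - p * t := by rw [← hmp, ← this]; ring
          linarith
        have h3 := chainRun_pow_subcritical (f := m) (η := ε / 10) h0 h1 hj hn (by omega)
          (by positivity) (by linarith) h5
        have h6 : (j.factorial : ℝ) * 4 ^ j * (ε / 10 / (ε / 10) ^ (2 * j)) ≤
            C₁ * (ε / ε ^ (2 * j)) := by
          have e : (ε / 10) / (ε / 10) ^ (2 * j) = 10 ^ (2 * j) * (ε / ε ^ (2 * j)) / 10 := by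
            rw [div_pow]; field_simp
          rw [e, hC₁]
          have : 0 ≤ (j.factorial : ℝ) * 4 ^ j * (10 ^ (2 * j) * (ε / ε ^ (2 * j))) := by positivity
          linarith
        have h4 : (n : ℝ) * chainRun p 0 (fun t _ _ => (t : ℝ) ^ j) m 0 (n + 0 - 1) 1 ≤ A :=
          mul_le_mul hnm (h3.trans h6) ((chainRun_mono h0 h1 (ρ := fun _ _ _ => 0)
            (fun t n a => by positivity) m 0 (n - 1) 1).trans' (by
              rw [show (fun (_ _ _ : ℕ) => (0 : ℝ)) = fun _ _ _ => 0 * 0 by simp,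
                chainRun_const_mul p 0 0 (fun _ _ _ => 0)]; simp)) hm0'.le
        linarith)
  -- Since ε(εm)^j = ε^(1-2j) (ε³m)^j, the surplus power of ε³m is absorbed by the exponential.
  have htail : B * Real.exp (-(ε ^ 2 * T / 1000)) ≤ m * (C₂ * C₃ * (ε / ε ^ (2 * j))) := by
    set l := δ / 1000 * (ε ^ 3 * m) with hl
    have hl0 : 0 < l := by positivity
    have h2 : Real.exp (-(ε ^ 2 * T / 1000)) ≤ Real.exp (-l) := by
      refine Real.exp_le_exp.2 (neg_le_neg ?_)
      have := mul_le_mul_of_nonneg_left hTx (sq_nonneg ε)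
      rw [hl]
      rw [hx] at this
      linarith
    have h3 : l ^ j * Real.exp (-l) ≤ j.factorial := by
      have := pow_le_factorial_mul_exp hl0.le hj
      have h4 : l ^ j ≤ j.factorial * Real.exp l := by
        have : (0 : ℝ) ≤ j.factorial := by positivity
        linarith
      calc l ^ j * Real.exp (-l) ≤ j.factorial * Real.exp l * Real.exp (-l) := by gcongr
        _ = j.factorial := by rw [mul_assoc, ← Real.exp_add]; simp
    have h4 : ε * (ε * m) ^ j = ε / ε ^ (2 * j) * (l ^ j / (δ / 1000) ^ j) := by
      rw [hl, mul_pow (δ / 1000), mul_div_assoc, mul_comm ((δ / 1000) ^ j),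
        div_mul_cancel₀ _ (by positivity)]
      rw [div_mul_eq_mul_div, eq_div_iff (by positivity), pow_mul, mul_assoc, ← mul_pow]
      ring_nf
    calc B * Real.exp (-(ε ^ 2 * T / 1000)) ≤ B * Real.exp (-l) := by gcongr
      _ = m * (C₂ * (ε / ε ^ (2 * j) * ((l ^ j * Real.exp (-l)) / (δ / 1000) ^ j))) := by
        rw [hB, h4]; ring
      _ ≤ m * (C₂ * (ε / ε ^ (2 * j) * (j.factorial / (δ / 1000) ^ j))) := by gcongr
      _ = _ := by rw [hC₃]; ring
  refine (integral_sumOtherComponents_le hm0 p hx0 hxm j).trans ?_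
  have h2 := mul_le_mul_of_nonneg_left hsmall hm0'.le
  have h3 : (0 : ℝ) ≤ 45 ^ j * m * (ε / ε ^ (2 * j)) := by positivity
  have h4 : (45 ^ j + (C₄ + (C₁ + C₂ * C₃))) * m * (ε / ε ^ (2 * j)) =
      45 ^ j * m * (ε / ε ^ (2 * j)) + m * (C₄ * (ε / ε ^ (2 * j))) +
        (A + m * (C₂ * C₃ * (ε / ε ^ (2 * j)))) := by rw [hA]; ring
  rw [h4]
  linarith


/-! ### The number of components before the time `T` -/

/-- The cumulated drift of the number of active vertices. -/
noncomputable def drift (ε p t : ℝ) : ℝ := ε * t - p / 2 * (t * (t + 1))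

/-- The expectation at the end of the component at time `T` of a payoff which is dominated by a
function `V` that is a supermartingale from time `T` on and at most `K₀ + K₁ (a - drift T)` at time
`T`. Here `Z` bounds the expected number of components up to time `T`. -/
def ReachBound (m : ℕ) (ε p : ℝ) (T : ℕ) (Z : ℝ) : Prop :=
  ∀ (ρ V : ℕ → ℕ → ℕ → ℝ) (K₀ K₁ : ℝ), 0 ≤ K₁ →
    (∀ t n, t + n = m → T ≤ t → ρ t n 0 ≤ V t n 0) →
    (∀ t n a, t + n + (a + 1) = m → T ≤ t → stepMean p (V (t + 1)) n (a + 1) ≤ V t n (a + 1)) →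
    (∀ n a, T + n + a = m → V T n a ≤ K₀ + K₁ * (a - drift ε p T)) →
    chainRun p T ρ m 0 (m - 1) 1 ≤ K₀ + K₁ * Z

/-- The process a - drift gains in mean at most 1 when a component begins, and nothing otherwise.
Let G = (1 + b e^(pt))^n. By `h`, G is at least κ(1 + b)^m when a = 0, and beginning a component
divides it by 1 + b e^(pt), so the drop of C·G pays for the 1. The initial value of C·G is 1/(bκ).
-/
theorem reachBound_of_growth {m T : ℕ} {ε p b κ : ℝ} (h0 : 0 ≤ p) (h1 : p ≤ 1)
    (hmp : m * p = 1 + ε) (hT0 : 0 < T) (hTm : T ≤ m) (hb : 0 < b) (hκ : 0 < κ)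
    (h : ∀ t n : ℕ, t + n = m → 0 < t → t < T →
      κ * (1 + b) ^ m ≤ (1 + b * Real.exp (p * t)) ^ n) :
    ReachBound m ε p T (1 + 1 / (b * κ)) := by
  intro ρ V K₀ K₁ hK₁ hρ hV hlin
  -- Chosen so that Cκ(1 + b)^m = 1 + 1/b; then the drop is at least (1 + 1/b)·c/(1 + c) ≥ 1 for
  -- every c ≥ b.
  set C := 1 / κ * (1 + 1 / b) / (1 + b) ^ m with hC
  have hC0 : 0 < C := by positivity
  set V' : ℕ → ℕ → ℕ → ℝ := fun t n a =>
    if t < T then K₀ + K₁ * (a - drift ε p t + C * (1 + b * Real.exp (p * t)) ^ n) else V t n a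
    with hV'
  have hbt : ∀ t : ℕ, b ≤ b * Real.exp (p * t) := fun t =>
    le_mul_of_one_le_right hb.le (Real.one_le_exp (by positivity))
  have hdrift : ∀ t : ℕ, drift ε p (t + 1 : ℕ) = drift ε p t + (ε - p * (t + 1)) := fun t => by
    simp only [drift]; push_cast; ring
  have hnext : ∀ t n a : ℕ, t < T → t + 1 + n + a = m → V' (t + 1) n a ≤
      K₀ + K₁ * (a - drift ε p (t + 1 : ℕ) + C * (1 + b * Real.exp (p * (t + 1 : ℕ))) ^ n) := by
    intro t n a ht hM
    simp only [hV']
    split_ifs with h2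
    · exact le_rfl
    · obtain rfl : t + 1 = T := by omega
      refine (hlin n a hM).trans ?_
      have : 0 ≤ C * (1 + b * Real.exp (p * (t + 1 : ℕ))) ^ n := by positivity
      gcongr
      linarith
  have hmean : ∀ (t n : ℕ) (a : ℝ), binomialMean p n (fun k => K₀ + K₁ * ((a + k) -
      drift ε p (t + 1 : ℕ) + C * (1 + b * Real.exp (p * (t + 1 : ℕ))) ^ (n - k))) ≤
      K₀ + K₁ * (a + n * p - drift ε p (t + 1 : ℕ) + C * (1 + b * Real.exp (p * t)) ^ n) := by
    intro t n a
    rw [binomialMean.add, binomialMean.const, binomialMean.const_mul, binomialMean.add,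
      binomialMean.const_mul, binomialMean.sub, binomialMean.add, binomialMean.const,
      binomialMean.const, binomialMean.cast]
    gcongr
    exact binomialMean_pow_sub_le h1 hb.le n t
  have hfin := chainRun_le (ρ := ρ) (V := V') h0 h1 (T := T) (M := m) hTm
    (fun t n htn hTt => by
      simp only [hV', if_neg (not_lt.2 hTt)]; exact hρ t n htn hTt)
    (fun t n a hM hna hta ha => ?_)
    (f := m) (t := 0) (n := m - 1) (a := 1) (by omega) (by omega) (by omega)
  · refine hfin.trans ?_
    simp only [hV', if_pos hT0]
    simp only [drift, Nat.cast_zero, mul_zero, Real.exp_zero, mul_one, Nat.cast_one, zero_mul,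
      sub_zero]
    refine add_le_add_right (mul_le_mul_of_nonneg_left (add_le_add_right (le_of_eq ?_) 1) hK₁) K₀
    have e : (1 + b) ^ m = (1 + b) ^ (m - 1) * (1 + b) := by
      rw [← pow_succ]; congr 1; omega
    rw [hC, e]
    have : 0 < (1 + b) ^ (m - 1) := by positivity
    field_simp
    ring
  · rcases Nat.lt_or_ge t T with ht | ht
    · refine (stepMean_mono h0 h1 hna fun n' a' h' => hnext t n' a' ht (by omega)).trans ?_
      simp only [hV', if_pos ht]
      rcases a with _ | a
      · obtain ⟨n, rfl⟩ : ∃ n', n = n' + 1 := ⟨n - 1, by omega⟩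
        have h2 := hmean t n 0
        simp only [zero_add] at h2
        simp only [stepMean]
        refine h2.trans (add_le_add_right (mul_le_mul_of_nonneg_left ?_ hK₁) K₀)
        have h3 : (n : ℝ) * p = 1 + ε - p * (t + 1) := by
          have : (t : ℝ) + (n + 1) = m := by exact_mod_cast (by omega : t + (n + 1) = m)
          rw [← hmp, ← this]; ring
        have h4 := h t (n + 1) (by omega) (by omega) ht
        have h5 : 1 ≤ C * (1 + b * Real.exp (p * t)) ^ n * (b * Real.exp (p * t)) := by
          have h6 : C * (κ * (1 + b) ^ m) ≤ C * (1 + b * Real.exp (p * t)) ^ (n + 1) :=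
            mul_le_mul_of_nonneg_left h4 hC0.le
          have h7 : C * (κ * (1 + b) ^ m) = 1 + 1 / b := by rw [hC]; field_simp
          rw [h7, pow_succ, ← mul_assoc] at h6
          set c := b * Real.exp (p * t) with hc
          have hc0 : b ≤ c := hbt t
          set q := C * (1 + c) ^ n with hq
          have hq0 : 0 ≤ q := by positivity
          have h8 : (1 + 1 / b) * b = b + 1 := by field_simp
          by_contra h9
          push Not at h9
          have h10 : q * b ≤ q * c := mul_le_mul_of_nonneg_left hc0 hq0
          have h11 : (1 + 1 / b) * b ≤ (q * (1 + c)) * b := mul_le_mul_of_nonneg_right h6 hb.le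
          nlinarith
        rw [hdrift, h3, pow_succ]
        push_cast
        linarith
      · simp only [stepMean]
        have h2 := hmean t n a
        push_cast at h2 ⊢
        refine h2.trans (add_le_add_right (mul_le_mul_of_nonneg_left ?_ hK₁) K₀)
        have h3 : (n : ℝ) * p ≤ 1 + ε - p * (t + 1) := by
          have : (t : ℝ) + 1 + n ≤ m := by exact_mod_cast (by omega : t + 1 + n ≤ m)
          have := mul_le_mul_of_nonneg_right this h0
          linarith
        have := hdrift t
        push_cast at this
        linarith
    · obtain ⟨a, rfl⟩ : ∃ b, a = b + 1 := ⟨a - 1, by omega⟩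
      have h2 : V' (t + 1) = V (t + 1) := by
        funext n a; simp only [hV', if_neg (by omega : ¬ t + 1 < T)]
      rw [h2]
      simp only [hV', if_neg (not_lt.2 ht)]
      exact hV t n a hM ht

/-- This is u ≤ sinh u at u = log(1 + c). It is exact to second order in c, as required to get the
sharp leading constant in Z ≈ 1/(2ε). -/
theorem log_one_add_le {c : ℝ} (hc : 0 ≤ c) : Real.log (1 + c) ≤ c * (2 + c) / (2 * (1 + c)) := by
  have h := Real.self_le_sinh_iff.2 (Real.log_nonneg (by linarith : 1 ≤ 1 + c))
  rw [Real.sinh_log (by linarith)] at h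
  refine h.trans_eq ?_
  field_simp
  ring

/-- With 1 + bE = (1 + b)(1 + x) and n = m - t, one has to compare t·log(1 + bE) with m·log(1 + x);
to second order in b this is the hypothesis. For y → 0 and r = 0 it reads 1 + b/2 ≤ 1 + ε, so b may
be almost 2ε. -/
theorem growth_of_le {m t n : ℕ} {ε p b r : ℝ} (hmp : m * p = 1 + ε)
    (h0 : 0 ≤ p) (htn : t + n = m) (hb : 0 < b) (hr : 0 ≤ r) (hy : Real.exp (p * t) ≤ 2)
    (h : Real.exp (p * t) * (1 + b * Real.exp (p * t) / 2) ≤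
      (1 + ε) * (1 - b * (p * t) / 2) + r) :
    Real.exp (-(t * b * r)) * (1 + b) ^ m ≤ (1 + b * Real.exp (p * t)) ^ n := by
  set y := p * t with hy'
  set E := Real.exp y with hE
  have hy0 : 0 ≤ y := by positivity
  have hE1 : 1 + y ≤ E := by linarith [Real.add_one_le_exp y]
  set x := b * (E - 1) / (1 + b) with hx
  have hx0 : 0 ≤ x := by
    have : 0 ≤ E - 1 := by linarith
    positivity
  have hx1 : x ≤ 1 := by
    rw [hx, div_le_one (by linarith)]; nlinarith
  set x' := b * y / (1 + b) with hx'
  have hx'0 : 0 ≤ x' := by positivity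
  have hxx : x' ≤ x := by
    rw [hx, hx']; gcongr; linarith
  have hfac : 1 + b * E = (1 + b) * (1 + x) := by
    rw [hx]; field_simp; ring
  have h2 : x' * (1 - b * y / 2) ≤ x - x ^ 2 / 2 := by
    have h3 : x' ≤ b * y := div_le_self (by positivity) (by linarith)
    have h4 : x' * (1 - b * y / 2) ≤ x' * (1 - x' / 2) :=
      mul_le_mul_of_nonneg_left (by linarith) hx'0
    nlinarith
  have hc : Real.log (1 + b * E) ≤ b / (1 + b) * (E * (1 + b * E / 2)) := by
    have hE0 : 0 < E := Real.exp_pos y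
    refine (log_one_add_le (by positivity)).trans ?_
    rw [div_mul_eq_mul_div, div_le_div_iff₀ (by positivity) (by positivity)]
    have h5 : 0 ≤ b * (E * (2 + b * E)) := by positivity
    have h6 : 1 + b ≤ 1 + b * E := by nlinarith
    nlinarith [mul_le_mul_of_nonneg_left h6 h5]
  have hm0 : (0 : ℝ) ≤ m := by positivity
  have hkey : t * Real.log (1 + b * E) ≤ m * Real.log (1 + x) + t * b * r := by
    have h5 : (t : ℝ) * (1 + ε) = m * y := by rw [← hmp, hy']; ring
    have h6 : (t : ℝ) * Real.log (1 + b * E) ≤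
        t * (b / (1 + b) * ((1 + ε) * (1 - b * y / 2) + r)) := by
      refine mul_le_mul_of_nonneg_left (hc.trans ?_) (by positivity)
      exact mul_le_mul_of_nonneg_left h (by positivity)
    have h7 : t * (b / (1 + b) * ((1 + ε) * (1 - b * y / 2) + r)) =
        m * (x' * (1 - b * y / 2)) + t * (b / (1 + b)) * r := by
      rw [hx']
      calc _ = t * (1 + ε) * (b / (1 + b)) * (1 - b * y / 2) + t * (b / (1 + b)) * r := by ring
        _ = _ := by rw [h5]; ring
    have h8 : t * (b / (1 + b)) * r ≤ t * b * r := by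
      have : b / (1 + b) ≤ b := div_le_self hb.le (by linarith)
      gcongr
    have h9 := mul_le_mul_of_nonneg_left (h2.trans (sub_sq_half_le_log hx0)) hm0
    linarith
  have hpos : 0 < 1 + b * E := by positivity
  have h10 : Real.exp (-(t * b * r)) * (1 + b * E) ^ t ≤ (1 + x) ^ m := by
    have e1 : (1 + b * E) ^ t = Real.exp (t * Real.log (1 + b * E)) := by
      rw [Real.exp_nat_mul, Real.exp_log hpos]
    have e2 : (1 + x) ^ m = Real.exp (m * Real.log (1 + x)) := by
      rw [Real.exp_nat_mul, Real.exp_log (by linarith)]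
    rw [e1, e2, ← Real.exp_add]
    exact Real.exp_le_exp.2 (by linarith)
  have h11 : Real.exp (-(t * b * r)) * (1 + b) ^ m * (1 + b * E) ^ t ≤
      (1 + b * E) ^ n * (1 + b * E) ^ t := by
    rw [← pow_add, add_comm n t, htn]
    conv_rhs => rw [hfac, mul_pow]
    calc _ = (1 + b) ^ m * (Real.exp (-(t * b * r)) * (1 + b * E) ^ t) := by ring
      _ ≤ _ := mul_le_mul_of_nonneg_left h10 (by positivity)
  exact le_of_mul_le_mul_right h11 (by positivity)

section

variable {m T : ℕ} {δ ε p : ℝ}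

/-- Up to time `1` there is only one component. -/
theorem reachBound_one (h0 : 0 ≤ p) (h1 : p ≤ 1) (hmp : m * p = 1 + ε) (hm : 0 < m) {η : ℝ}
    (hη : 0 < η) : ReachBound m ε p 1 (1 + η) := by
  -- No t lies strictly between 0 and 1, so the growth condition is vacuous and κ is free.
  have := reachBound_of_growth h0 h1 hmp one_pos hm one_pos (κ := 1 / η) (by positivity)
    (fun t n _ h2 h3 => by omega)
  simpa using this

theorem exp_le_of_early (he0 : 0 < ε) (he1 : ε ≤ 1) (hδ0 : 0 < δ) (hδ1 : δ ≤ 1 / 1000) {y : ℝ}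
    (hy0 : 0 ≤ y) (hy : y ≤ 2 * δ * ε) : Real.exp y ≤ 1 + 4 * δ * ε := by
  have h3 : δ * ε ≤ 1 / 1000 := by nlinarith
  have h2 := exp_sub_one_le hy0 (by nlinarith)
  nlinarith

/-- The expected number of components up to a time at most `δ ε m` is at most about
`1 / (2 ε)`. -/
theorem reachBound_supercritical (h0 : 0 ≤ p) (h1 : p ≤ 1) (he0 : 0 < ε) (he1 : ε ≤ 1)
    (hmp : m * p = 1 + ε) (hT0 : 0 < T) (hTm : T ≤ m) (hδ0 : 0 < δ) (hδ1 : δ ≤ 1 / 1000)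
    (hT : (T : ℝ) ≤ δ * ε * m + 1) :
    ReachBound m ε p T (1 + 1 / (2 * ε * (1 - 20 * δ))) := by
  have hb : 0 < 2 * ε * (1 - 20 * δ) := by
    have : 0 < 1 - 20 * δ := by linarith
    positivity
  have := reachBound_of_growth (T := T) h0 h1 hmp hT0 hTm hb one_pos (fun t n htn ht htT => ?_)
  · simpa using this
  · have ht' : (t : ℝ) ≤ δ * ε * m := by
      have : (t : ℝ) + 1 ≤ T := by exact_mod_cast htT
      linarith
    have hy : p * t ≤ 2 * δ * ε := by
      have h2 := mul_le_mul_of_nonneg_left ht' h0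
      have h3 : p * (δ * ε * m) = δ * ε * (1 + ε) := by rw [← hmp]; ring
      have h4 : 0 ≤ δ * ε * (1 - ε) := by have := sub_nonneg.2 he1; positivity
      linarith
    have hy0 : 0 ≤ p * t := by positivity
    have hE := exp_le_of_early he0 he1 hδ0 hδ1 hy0 hy
    have hδε : 0 < δ * ε := by positivity
    have hδε1 : δ * ε ≤ 1 / 1000 := by nlinarith
    have := growth_of_le (r := 0) hmp h0 htn hb le_rfl (by linarith) ?_
    · simpa using this
    · set E := Real.exp (p * t) with hE'
      have hE0 : 0 < E := Real.exp_pos _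
      have hE2 : E * E ≤ 1 + 9 * δ * ε := by
        have := mul_le_mul hE hE hE0.le (by linarith)
        nlinarith
      -- The loss 20δε in b pays for 4δε from E, 9δε from E² and 4δε from the right-hand side.
      have h5 : E * (1 + 2 * ε * (1 - 20 * δ) * E / 2) = E + ε * (1 - 20 * δ) * (E * E) := by ring
      have h6 : ε * (1 - 20 * δ) * (E * E) ≤ ε * (1 - 20 * δ) * (1 + 9 * δ * ε) :=
        mul_le_mul_of_nonneg_left hE2 (by nlinarith)
      have h7 : ε * (1 - 20 * δ) * (1 + 9 * δ * ε) ≤ ε - 20 * (δ * ε) + 9 * (δ * ε) := by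
        have h8 : 0 ≤ (δ * ε) * (1 - ε) := mul_nonneg hδε.le (by linarith)
        have h9 : 0 ≤ (δ * ε) * (δ * ε) := by positivity
        nlinarith
      have h8 : (1 + ε) * (2 * ε * (1 - 20 * δ) * (p * t) / 2) ≤ 4 * (δ * ε) := by
        have h9 : 2 * ε * (1 - 20 * δ) * (p * t) / 2 ≤ 1 * (2 * δ * ε) := by
          have : 2 * ε * (1 - 20 * δ) / 2 ≤ 1 := by nlinarith
          calc _ = 2 * ε * (1 - 20 * δ) / 2 * (p * t) := by ring
            _ ≤ 1 * (2 * δ * ε) := mul_le_mul this hy hy0 zero_le_one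
        nlinarith
      rw [h5]
      nlinarith

/-- The expected number of components up to a time at most `x = δ ε m` is `O(√x)`. -/
theorem reachBound_sqrt (h0 : 0 ≤ p) (h1 : p ≤ 1) (he0 : 0 < ε) (he1 : ε ≤ 1)
    (hmp : m * p = 1 + ε) (hT0 : 0 < T) (hTm : T ≤ m) (hδ0 : 0 < δ) (hδ1 : δ ≤ 1 / 1000)
    (hT : (T : ℝ) ≤ δ * ε * m + 1) (hx : 1 ≤ δ * ε * m) :
    ReachBound m ε p T (1 + Real.exp 1 * √(δ * ε * m)) := by
  set s := √(δ * ε * m) with hs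
  have hs1 : 1 ≤ s := Real.one_le_sqrt.2 hx
  have hss : s * s = δ * ε * m := Real.mul_self_sqrt (by linarith)
  have hb : 0 < 1 / s := by positivity
  have hb1 : 1 / s ≤ 1 := by rw [div_le_one (by linarith)]; exact hs1
  have := reachBound_of_growth (T := T) h0 h1 hmp hT0 hTm hb (Real.exp_pos (-1))
    (fun t n htn ht htT => ?_)
  · have e : 1 / (1 / s * Real.exp (-1)) = Real.exp 1 * s := by
      rw [Real.exp_neg]; field_simp
    rwa [e] at this
  · have ht' : (t : ℝ) ≤ δ * ε * m := by
      have : (t : ℝ) + 1 ≤ T := by exact_mod_cast htT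
      linarith
    have hy : p * t ≤ 2 * δ * ε := by
      have h2 := mul_le_mul_of_nonneg_left ht' h0
      have h3 : p * (δ * ε * m) = δ * ε * (1 + ε) := by rw [← hmp]; ring
      have h4 : 0 ≤ δ * ε * (1 - ε) := by have := sub_nonneg.2 he1; positivity
      linarith
    have hy0 : 0 ≤ p * t := by positivity
    have hE := exp_le_of_early he0 he1 hδ0 hδ1 hy0 hy
    have hδε : 0 < δ * ε := by positivity
    have hδε1 : δ * ε ≤ ε / 1000 := by nlinarith
    -- At the critical scale t ≤ s² the choice b = r = 1/s gives t·b·r ≤ 1, so only a factor e⁻¹ is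
    -- lost.
    have h2 := growth_of_le (r := 1 / s) hmp h0 htn hb hb.le (by linarith) ?_
    · refine le_trans (mul_le_mul_of_nonneg_right (Real.exp_le_exp.2 ?_) (by positivity)) h2
      refine neg_le_neg ?_
      calc (t : ℝ) * (1 / s) * (1 / s) = t / (s * s) := by field_simp
        _ ≤ 1 := by rw [div_le_one (by positivity), hss]; exact ht'
    · set E := Real.exp (p * t) with hE'
      have hE0 : 0 < E := Real.exp_pos _
      have hE2 : E * E ≤ 3 / 2 := by
        have := mul_le_mul hE hE hE0.le (by linarith)
        nlinarith
      have h5 : E * (1 + 1 / s * E / 2) = E + 1 / s * (E * E / 2) := by ring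
      have h6 : (1 + ε) * (1 / s * (p * t) / 2) ≤ 1 / s * (1 / 10) := by
        have h9 : (1 + ε) * ((p * t) / 2) ≤ 1 / 10 := by nlinarith
        calc _ = 1 / s * ((1 + ε) * ((p * t) / 2)) := by ring
          _ ≤ _ := mul_le_mul_of_nonneg_left h9 hb.le
      rw [h5]
      nlinarith
end


/-! ### The end of the component at time `T` -/

theorem binomialMean_sub_mean (p : ℝ) (n : ℕ) :
    binomialMean p n (fun k => (k : ℝ) - n * p) = 0 := by
  rw [binomialMean.sub, binomialMean.const, binomialMean.cast, sub_self]

theorem binomialMean_sub_mean_sq (p : ℝ) (n : ℕ) :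
    binomialMean p n (fun k => ((k : ℝ) - n * p) ^ 2) = n * p * (1 - p) := by
  have h : (fun k : ℕ => ((k : ℝ) - n * p) ^ 2) =
      fun k : ℕ => (k : ℝ) ^ 2 - 2 * (n * p) * k + (n * p) ^ 2 := by funext k; ring
  rw [h, binomialMean.add, binomialMean.sub, binomialMean.const, binomialMean.const_mul,
    binomialMean.cast, binomialMean.cast_sq]
  ring

theorem binomialMean_sub_mean_cube (p : ℝ) (n : ℕ) :
    binomialMean p n (fun k => ((k : ℝ) - n * p) ^ 3) = n * p * (1 - p) * (1 - 2 * p) := by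
  have h : (fun k : ℕ => ((k : ℝ) - n * p) ^ 3) = fun k : ℕ =>
      ((k : ℝ) ^ 3 - 3 * (n * p) * (k : ℝ) ^ 2) + (3 * (n * p) ^ 2 * k - (n * p) ^ 3) := by
    funext k; ring
  rw [h, binomialMean.add, binomialMean.sub, binomialMean.sub, binomialMean.const,
    binomialMean.const_mul, binomialMean.const_mul, binomialMean.cast, binomialMean.cast_sq,
    binomialMean.cast_cube]
  ring

/-- The square of the cubic Taylor polynomial exceeds 1 + u by a nonnegative multiple of u⁴, so it
is an upper bound on all of u ≥ -1. -/
theorem sqrt_one_add_le {u : ℝ} (hu : -1 ≤ u) :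
    √(1 + u) ≤ 1 + u / 2 - u ^ 2 / 8 + u ^ 3 / 16 := by
  refine Real.sqrt_le_iff.2 ⟨?_, ?_⟩
  · nlinarith [sq_nonneg (u - 1), mul_nonneg (by linarith : 0 ≤ 1 + u) (sq_nonneg (u - 3 / 2))]
  · have h : (1 + u / 2 - u ^ 2 / 8 + u ^ 3 / 16) ^ 2 - (1 + u) =
        u ^ 4 * ((u - 2) ^ 2 + 16) / 256 := by ring
    have h2 : 0 ≤ u ^ 4 * ((u - 2) ^ 2 + 16) / 256 := by positivity
    linarith

/-- Concavity costs the variance over 8x^(3/2). The third central moment is at most the variance, so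
the cubic term takes back at most the fraction 1/(2x) ≤ 1/(2S) of it. -/
theorem binomialMean_sqrt_le {p x S : ℝ} (h0 : 0 ≤ p) (h1 : p ≤ 1) {n : ℕ} (hS : 1 ≤ S)
    (hx : S ≤ x) (hk : ∀ k ≤ n, 0 ≤ x + ((k : ℝ) - n * p)) :
    binomialMean p n (fun k => √(x + ((k : ℝ) - n * p))) ≤
      √x - n * p * ((1 - p) * (1 - 1 / (2 * S))) / (8 * (x * √x)) := by
  have hx0 : 0 < x := by linarith
  have hs0 : 0 < √x := Real.sqrt_pos.2 hx0
  have hpt : ∀ k ≤ n, √(x + ((k : ℝ) - n * p)) ≤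
      √x + (√x / (2 * x) * ((k : ℝ) - n * p) - √x / (8 * x ^ 2) * ((k : ℝ) - n * p) ^ 2) +
        √x / (16 * x ^ 3) * ((k : ℝ) - n * p) ^ 3 := by
    intro k hkn
    have e : x + ((k : ℝ) - n * p) = x * (1 + ((k : ℝ) - n * p) / x) := by field_simp
    have h2 : -1 ≤ ((k : ℝ) - n * p) / x := by
      rw [le_div_iff₀ hx0]; linarith [hk k hkn]
    rw [e, Real.sqrt_mul hx0.le]
    refine (mul_le_mul_of_nonneg_left (sqrt_one_add_le h2) hs0.le).trans_eq ?_
    field_simp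
    ring
  refine (binomialMean.mono h0 h1 hpt).trans ?_
  rw [binomialMean.add, binomialMean.add, binomialMean.const, binomialMean.sub,
    binomialMean.const_mul, binomialMean.const_mul, binomialMean.const_mul,
    binomialMean_sub_mean, binomialMean_sub_mean_sq, binomialMean_sub_mean_cube]
  have hv : 0 ≤ n * p * (1 - p) := mul_nonneg (by positivity) (by linarith)
  have h3 : √x / (16 * x ^ 3) * (n * p * (1 - p) * (1 - 2 * p)) ≤
      √x / (16 * x ^ 3) * (n * p * (1 - p)) :=
    mul_le_mul_of_nonneg_left (mul_le_of_le_one_right hv (by linarith)) (by positivity)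
  have h4 : n * p * ((1 - p) * (1 - 1 / (2 * S))) / (8 * (x * √x)) ≤
      n * p * ((1 - p) * (1 - 1 / (2 * x))) / (8 * (x * √x)) := by
    have h5 : 1 / (2 * x) ≤ 1 / (2 * S) := one_div_le_one_div_of_le (by linarith) (by linarith)
    have h6 : n * p * (1 - p) * (1 - 1 / (2 * S)) ≤ n * p * (1 - p) * (1 - 1 / (2 * x)) :=
      mul_le_mul_of_nonneg_left (by linarith) hv
    have h7 : 0 < 8 * (x * √x) := by positivity
    rw [div_le_div_iff_of_pos_right h7]
    linarith
  have h5 : n * p * ((1 - p) * (1 - 1 / (2 * x))) / (8 * (x * √x)) =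
      √x / (8 * x ^ 2) * (n * p * (1 - p)) - √x / (16 * x ^ 3) * (n * p * (1 - p)) := by
    have hss : √x * √x = x := Real.mul_self_sqrt hx0.le
    have e : 1 / (x * √x) = √x / x ^ 2 := by
      rw [div_eq_div_iff (by positivity) (by positivity)]
      calc 1 * x ^ 2 = x * x := by ring
        _ = x * (√x * √x) := by rw [hss]
        _ = _ := by ring
    calc _ = n * p * (1 - p) * (1 - 1 / (2 * x)) / 8 * (1 / (x * √x)) := by field_simp
      _ = _ := by rw [e]; field_simp; ring
  linarith

/-- The tangent of the convex function x^(-3/2) at x = y. It makes the gain linear in D, whose mean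
is controlled. -/
theorem tangent_le_rpow {x y : ℝ} (hx : 0 < x) (hy : 0 < y) :
    1 / y ^ 2 * (5 / 2 - 3 / 2 * (x / y)) ≤ 1 / (x * √x * √y) := by
  set s := √x with hs
  set w := √y with hw
  have hs0 : 0 < s := Real.sqrt_pos.2 hx
  have hw0 : 0 < w := Real.sqrt_pos.2 hy
  have hx' : x = s ^ 2 := (Real.sq_sqrt hx.le).symm
  have hy' : y = w ^ 2 := (Real.sq_sqrt hy.le).symm
  rw [hx', hy']
  have e : 1 / (w ^ 2) ^ 2 * (5 / 2 - 3 / 2 * (s ^ 2 / w ^ 2)) =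
      (5 * w ^ 2 - 3 * s ^ 2) / (2 * w ^ 6) := by field_simp
  rw [e, div_le_div_iff₀ (by positivity) (by positivity)]
  have h : 0 ≤ (s - w) ^ 2 * (3 * s ^ 3 + 6 * s ^ 2 * w + 4 * s * w ^ 2 + 2 * w ^ 3) * w := by
    positivity
  nlinarith

/-- Optional stopping of a - drift. As drift = (p/2)·t(z - t), it says E ζ(ζ - z) ≤ 2Z/p. -/
theorem chainRun_neg_drift {m T : ℕ} {ε p Z : ℝ} (h0 : 0 ≤ p) (hmp : m * p = 1 + ε)
    (hZ : ReachBound m ε p T Z) :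
    chainRun p T (fun t _ _ => -drift ε p t) m 0 (m - 1) 1 ≤ Z := by
  have h := hZ (fun t _ _ => -drift ε p t) (fun t _ a => a - drift ε p t) 0 1 zero_le_one
    (fun t n _ _ => by simp) (fun t n a hM _ => ?_) (fun n a _ => by simp)
  · simpa using h
  · simp only [stepMean]
    rw [binomialMean.sub, binomialMean.const]
    push_cast
    rw [binomialMean.add, binomialMean.const, binomialMean.cast]
    have h3 : (n : ℝ) * p ≤ 1 + ε - p * (t + 1) := by
      have : (t : ℝ) + 1 + n ≤ m := by exact_mod_cast (by omega : t + 1 + n ≤ m)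
      have := mul_le_mul_of_nonneg_right this h0
      linarith
    simp only [drift]
    linarith

/-- The expected end of the component at time `T`, with the gain coming from the fluctuations of
the exploration. -/
theorem chainRun_gain {m T L : ℕ} {ε p Z S z Ψ g : ℝ} (h0 : 0 < p) (h1 : p ≤ 1) (he0 : 0 ≤ ε)
    (hmp : m * p = 1 + ε) (hZ : ReachBound m ε p T Z) (hS : 1 ≤ S) (hz : p * z = 2 * ε - p)
    (hz0 : 0 < z) (hΨ : Ψ = p / 8 * z ^ 2)
    (hg : g = z * ((1 - p) * (1 - 1 / (2 * S))) / (16 * Ψ ^ 2)) (hTL : T < L) :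
    chainRun p T (fun t _ _ => t + 5 * g / 2 * min (t : ℝ) L) m 0 (m - 1) 1 ≤
      z + z / 4 * ((S + Z) / Ψ) + 5 * g / 2 * (T + ε * T + Z) +
        3 * g / 2 * (1 + ε) * L * (1 + (S + Z) / Ψ) := by
  have hΨ0 : 0 < Ψ := by rw [hΨ]; positivity
  have hκ0 : 0 ≤ (1 - p) * (1 - 1 / (2 * S)) := by
    have : 1 / (2 * S) ≤ 1 := by rw [div_le_one (by linarith)]; linarith
    exact mul_nonneg (by linarith) (by linarith)
  have hg0 : 0 ≤ g := by rw [hg]; positivity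
  -- Completing the square, D = a - drift + Ψ + S. The shift S keeps the argument of the root away
  -- from 0.
  set D : ℕ → ℕ → ℝ := fun t a => a + p / 2 * (t - z / 2) ^ 2 + S with hD
  have hDS : ∀ t a, S ≤ D t a := fun t a => by
    have : 0 ≤ (a : ℝ) + p / 2 * (t - z / 2) ^ 2 := by positivity
    simp only [hD]; linarith
  have hD0 : ∀ t a, 0 < D t a := fun t a => by linarith [hDS t a]
  -- Without S, this equals max(t, z - t) when a = 0; hence it dominates the payoff t.
  set U : ℕ → ℕ → ℝ := fun t a => z / 2 * (1 + √(D t a) / √Ψ) with hU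
  have hw0 : 0 < √Ψ := Real.sqrt_pos.2 hΨ0
  have hDdrift : ∀ t a, D t a = a - drift ε p t + Ψ + S := fun t a => by
    have : ε = (p * z + p) / 2 := by linarith
    simp only [hD, drift, hΨ, this]; ring
  have hUt : ∀ t : ℕ, (t : ℝ) ≤ U t 0 := by
    intro t
    have h2 : |(t : ℝ) - z / 2| ≤ z / 2 * (√(D t 0) / √Ψ) := by
      rw [← Real.sqrt_div (hD0 t 0).le]
      have e : z / 2 = √((z / 2) ^ 2) := (Real.sqrt_sq (by linarith)).symm
      rw [e, ← Real.sqrt_mul (by positivity), ← Real.sqrt_sq_eq_abs, ← e]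
      refine Real.sqrt_le_sqrt ?_
      have e2 : (z / 2) ^ 2 * (D t 0 / Ψ) = (t - z / 2) ^ 2 + 2 * S / p := by
        simp only [hD, hΨ]; field_simp; push_cast; ring
      rw [e2]
      have : 0 ≤ 2 * S / p := by positivity
      linarith
    have := (abs_le.1 h2).2
    simp only [hU]; linarith
  have hmean : ∀ t n a : ℕ, t + n + (a + 1) = m →
      binomialMean p n (fun k => D (t + 1) (a + k)) ≤ D t (a + 1) ∧
      binomialMean p n (fun k => U (t + 1) (a + k)) ≤
        U t (a + 1) - g * (n * p) * (5 / 2 - 3 / 2 * (D t (a + 1) / Ψ)) ∧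
      binomialMean p n (fun k => U (t + 1) (a + k)) ≤ U t (a + 1) := by
    intro t n a hM
    -- The mean of D after the step; p·a accounts for active vertices, which cannot be discovered
    -- again.
    set x := D t (a + 1) - p * a with hx
    have hxD : x ≤ D t (a + 1) := by
      have : 0 ≤ p * a := by positivity
      linarith
    have hxS : S ≤ x := by
      have h2 : 0 ≤ (1 - p) * a := mul_nonneg (by linarith) (by positivity)
      have h3 : 0 ≤ p / 2 * ((t : ℝ) - z / 2) ^ 2 := by positivity
      simp only [hx, hD]; push_cast; linarith
    have hx0 : 0 < x := by linarith
    have hk : ∀ k : ℕ, D (t + 1) (a + k) = x + ((k : ℝ) - n * p) := fun k => by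
      have h2 : (t : ℝ) + n + (a + 1) = m := by exact_mod_cast hM
      have h3 : (n : ℝ) * p = 1 + ε - p * (t + a + 1) := by rw [← hmp, ← h2]; ring
      rw [h3]
      simp only [hx, hDdrift, drift]; push_cast; ring
    constructor
    · simp only [hk]
      rw [binomialMean.add, binomialMean.const, binomialMean_sub_mean, add_zero]
      exact hxD
    · have h2 := binomialMean_sqrt_le h0.le h1 hS hxS (n := n) (fun k _ => by
        rw [← hk]; exact (hD0 _ _).le)
      set κ := (1 - p) * (1 - 1 / (2 * S)) with hκ
      set y := D t (a + 1) with hy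
      have hy0 : 0 < y := hD0 _ _
      have h3 : √x ≤ √y := Real.sqrt_le_sqrt hxD
      have hsx : 0 < √x := Real.sqrt_pos.2 hx0
      have h4 : n * p * κ / (8 * (y * √y)) ≤ n * p * κ / (8 * (x * √x)) := by
        have : 0 ≤ n * p * κ := by positivity
        gcongr
      have h5 : binomialMean p n (fun k => √(D (t + 1) (a + k))) ≤
          √y - n * p * κ / (8 * (y * √y)) := by
        simp only [hk]; linarith
      have e : (fun k => U (t + 1) (a + k)) =
          fun k => z / 2 + z / 2 / √Ψ * √(D (t + 1) (a + k)) := by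
        funext k; simp only [hU]; field_simp
      have e0 : binomialMean p n (fun k => U (t + 1) (a + k)) =
          z / 2 + z / 2 / √Ψ * binomialMean p n (fun k => √(D (t + 1) (a + k))) := by
        rw [e, binomialMean.add, binomialMean.const, binomialMean.const_mul]
      rw [e0]
      have h6 := mul_le_mul_of_nonneg_left h5 (show 0 ≤ z / 2 / √Ψ by positivity)
      have h7 := mul_le_mul_of_nonneg_left (tangent_le_rpow hy0 hΨ0)
        (show 0 ≤ n * p * (z * κ / 16) by positivity)
      have e2 : z / 2 / √Ψ * (√y - n * p * κ / (8 * (y * √y))) =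
          z / 2 * (√y / √Ψ) - n * p * (z * κ / 16) * (1 / (y * √y * √Ψ)) := by
        have : √y ≠ 0 := (Real.sqrt_pos.2 hy0).ne'
        field_simp; ring
      have e3 : g * (n * p) * (5 / 2 - 3 / 2 * (y / Ψ)) =
          n * p * (z * κ / 16) * (1 / Ψ ^ 2 * (5 / 2 - 3 / 2 * (y / Ψ))) := by
        rw [hg]; field_simp
      have h8 : 0 ≤ n * p * (z * κ / 16) * (1 / (y * √y * √Ψ)) := by positivity
      have e4 : U t (a + 1) = z / 2 + z / 2 * (√y / √Ψ) := by simp only [hU, hy]; ring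
      rw [e3, e4]
      constructor <;> linarith
  -- The increments of m - n have mean np, matching the constant part 5/2 of the tangent, and m - n
  -- = t when a = 0. The last term prepays the part with 3/2 for the L - t remaining steps, D being
  -- a supermartingale; stopping the count at L keeps this prepayment bounded.
  set V : ℕ → ℕ → ℕ → ℝ := fun t n a =>
    if t < L then U t a + 5 * g / 2 * (m - n) + 3 * g / 2 * (1 + ε) * (L - t) * (D t a / Ψ)
    else U t a + 5 * g / 2 * L with hV
  have h := hZ (fun t _ _ => t + 5 * g / 2 * min (t : ℝ) L) V
    (z + z / 4 * (S / Ψ) + 5 * g / 2 * (T + ε * T) + 3 * g / 2 * (1 + ε) * L * (1 + S / Ψ))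
    (z / 4 / Ψ + 5 * g / 2 + 3 * g / 2 * (1 + ε) * L / Ψ) (by positivity) ?_ ?_ ?_
  · refine h.trans_eq ?_
    field_simp
    ring
  · intro t n htn _
    simp only [hV]
    split_ifs with ht
    · have ht' : (t : ℝ) ≤ L := by exact_mod_cast ht.le
      have h2 : (t : ℝ) + n = m := by exact_mod_cast htn
      have h3 : 0 ≤ 3 * g / 2 * (1 + ε) * (L - t) * (D t 0 / Ψ) := by
        have := sub_nonneg.2 ht'
        have := hD0 t 0
        positivity
      rw [min_eq_left ht', ← h2]
      have := hUt t
      linarith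
    · rw [min_eq_right (by exact_mod_cast not_lt.1 ht)]
      have := hUt t
      linarith
  · intro t n a hM _
    obtain ⟨hm1, hm2, hm3⟩ := hmean t n a hM
    clear_value D U
    simp only [stepMean]
    rcases Nat.lt_or_ge t L with ht | ht
    · have hV1 : ∀ k ≤ n, V (t + 1) (n - k) (a + k) ≤ U (t + 1) (a + k) +
          5 * g / 2 * ((m - n) + k) +
            3 * g / 2 * (1 + ε) * (L - (t + 1)) / Ψ * D (t + 1) (a + k) := by
        intro k hk
        simp only [hV]
        split_ifs with h2
        · rw [Nat.cast_sub hk]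
          push_cast
          refine le_of_eq ?_
          field_simp
          ring
        · have h3 : (t : ℝ) + 1 = L := by exact_mod_cast (by omega : t + 1 = L)
          have h4 : (t : ℝ) + n + (a + 1) = m := by exact_mod_cast hM
          rw [← h3, ← h4]
          have h5 : 0 ≤ 5 * g / 2 * ((a : ℝ) + k) := by positivity
          simp only [sub_self, mul_zero, zero_div, zero_mul, add_zero]
          linarith
      refine (binomialMean.mono h0.le h1 hV1).trans ?_
      rw [binomialMean.add, binomialMean.add, binomialMean.const_mul, binomialMean.const_mul,
        binomialMean.add, binomialMean.const, binomialMean.cast]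
      simp only [hV, if_pos ht]
      have ht' : (t : ℝ) + 1 ≤ L := by exact_mod_cast ht
      have hc : 0 ≤ 3 * g / 2 * (1 + ε) * (L - (t + 1)) / Ψ := by
        have := sub_nonneg.2 ht'
        positivity
      have h2 := mul_le_mul_of_nonneg_left hm1 hc
      have h3 : (n : ℝ) * p ≤ 1 + ε := by
        rw [← hmp]
        exact mul_le_mul_of_nonneg_right (by exact_mod_cast (by omega : n ≤ m)) h0.le
      have h4 : g * (3 / 2 * (D t (a + 1) / Ψ)) * (n * p) ≤
          g * (3 / 2 * (D t (a + 1) / Ψ)) * (1 + ε) := by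
        refine mul_le_mul_of_nonneg_left h3 ?_
        have := hD0 t (a + 1)
        positivity
      have e : 3 * g / 2 * (1 + ε) * (L - t) * (D t (a + 1) / Ψ) =
          3 * g / 2 * (1 + ε) * (L - (t + 1)) / Ψ * D t (a + 1) +
            g * (3 / 2 * (D t (a + 1) / Ψ)) * (1 + ε) := by ring
      rw [e]
      linarith
    · have hV1 : ∀ k : ℕ, V (t + 1) (n - k) (a + k) = U (t + 1) (a + k) + 5 * g / 2 * L :=
        fun k => by simp only [hV, if_neg (by omega : ¬ t + 1 < L)]
      simp only [hV1]
      rw [binomialMean.add, binomialMean.const]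
      simp only [hV, if_neg (by omega : ¬ t < L)]
      refine add_le_add_left ?_ _
      exact hm3
  · intro n a hM
    simp only [hV, if_pos hTL]
    have h2 : (T : ℝ) + n + a = m := by exact_mod_cast hM
    have h3 : (D T a) / Ψ = 1 + (S + (a - drift ε p T)) / Ψ := by
      rw [hDdrift]; field_simp; ring
    have hU1 : U T a ≤ z + z / 4 * ((S + (a - drift ε p T)) / Ψ) := by
      -- At time T the root is linearised, since `ReachBound` only controls a - drift linearly.
      have h4 : √(D T a) / √Ψ ≤ 1 + (S + (a - drift ε p T)) / Ψ / 2 := by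
        rw [← Real.sqrt_div (hD0 T a).le, h3]
        refine Real.sqrt_one_add_le ?_
        have : 0 < D T a / Ψ := div_pos (hD0 T a) hΨ0
        linarith
      have := mul_le_mul_of_nonneg_left h4 (show 0 ≤ z / 2 by linarith)
      simp only [hU]
      linarith
    have h5 : (m : ℝ) - n ≤ T + ε * T + (a - drift ε p T) := by
      have : drift ε p T ≤ ε * T := by
        have : 0 ≤ p / 2 * ((T : ℝ) * (T + 1)) := by positivity
        simp only [drift]; linarith
      linarith
    have h6 := mul_le_mul_of_nonneg_left h5 (show 0 ≤ 5 * g / 2 by positivity)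
    have h7 : 3 * g / 2 * (1 + ε) * (L - T) * (D T a / Ψ) ≤
        3 * g / 2 * (1 + ε) * L * (1 + (S + (a - drift ε p T)) / Ψ) := by
      rw [← h3]
      have h8 : 0 ≤ D T a / Ψ := (div_pos (hD0 T a) hΨ0).le
      have h9 : (L : ℝ) - T ≤ L := by linarith [(Nat.cast_nonneg T : (0 : ℝ) ≤ T)]
      gcongr
    refine (add_le_add (add_le_add hU1 h6) h7).trans_eq ?_
    field_simp
    ring


/-! ### The expected size of the component at time `δ ε m` -/

section
variable {m T : ℕ} {p : unitInterval} {ε Z z : ℝ}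

theorem sq_integral_firstEmptyTime_le :
    (∫ G, (firstEmptyTime T G : ℝ) ∂(SimpleGraph.binomialRandom (Fin m) p)) ^ 2 ≤
      ∫ G, (firstEmptyTime T G : ℝ) ^ 2 ∂(SimpleGraph.binomialRandom (Fin m) p) := by
  set e := ∫ G, (firstEmptyTime T G : ℝ) ∂(SimpleGraph.binomialRandom (Fin m) p) with he
  have h : 0 ≤ ∫ G, ((firstEmptyTime T G : ℝ) - e) ^ 2 ∂(SimpleGraph.binomialRandom (Fin m) p) :=
    integral_nonneg fun _ => sq_nonneg _
  have h2 : ∫ G, ((firstEmptyTime T G : ℝ) - e) ^ 2 ∂(SimpleGraph.binomialRandom (Fin m) p) =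
      (∫ G, (firstEmptyTime T G : ℝ) ^ 2 ∂(SimpleGraph.binomialRandom (Fin m) p)) -
        2 * e * e + e ^ 2 := by
    have h3 : (fun G : SimpleGraph (Fin m) => ((firstEmptyTime T G : ℝ) - e) ^ 2) =
        fun G => (firstEmptyTime T G : ℝ) ^ 2 - 2 * e * firstEmptyTime T G + e ^ 2 := by
      funext G; ring
    rw [h3, integral_add (integrable_binomialRandom p _) (integrable_binomialRandom p _),
      integral_sub (integrable_binomialRandom p _) (integrable_binomialRandom p _),
      integral_const_mul, ← he]
    simp
  nlinarith

theorem integral_firstEmptyTime_sq_sub_le (hm : 0 < m) (hmp : (m : ℝ) * p = 1 + ε)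
    (hZ : ReachBound m ε p T Z) (hz : p * z = 2 * ε - p) :
    p * ((∫ G, (firstEmptyTime T G : ℝ) ^ 2 ∂(SimpleGraph.binomialRandom (Fin m) p)) -
      z * ∫ G, (firstEmptyTime T G : ℝ) ∂(SimpleGraph.binomialRandom (Fin m) p)) ≤ 2 * Z := by
  have h := chainRun_neg_drift p.2.1 hmp hZ
  rw [← integral_firstEmptyTime hm p T (fun t => -drift ε p t)] at h
  have h3 : (fun G : SimpleGraph (Fin m) => -drift ε p (firstEmptyTime T G)) =
      fun G => (p : ℝ) / 2 * ((firstEmptyTime T G : ℝ) ^ 2 - z * firstEmptyTime T G) := by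
    funext G
    have : ε = (p * z + p) / 2 := by linarith
    simp only [drift]
    rw [this]
    ring
  rw [h3, integral_const_mul,
    integral_sub (integrable_binomialRandom p _) (integrable_binomialRandom p _),
    integral_const_mul] at h
  linarith

/-- Pointwise z - ζ ≤ (10/z)(ζ - z)² + z/40. With the second-moment hypothesis both terms on the
right cost z/40 in mean. -/
theorem le_integral_min_firstEmptyTime {L : ℝ} (hz0 : 0 < z) (hLz : z ≤ L)
    (hvar : (∫ G, (firstEmptyTime T G : ℝ) ^ 2 ∂(SimpleGraph.binomialRandom (Fin m) p)) -
      2 * z * (∫ G, (firstEmptyTime T G : ℝ) ∂(SimpleGraph.binomialRandom (Fin m) p)) + z ^ 2 ≤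
        25 / 10000 * z ^ 2) :
    95 / 100 * z ≤
      ∫ G, min (firstEmptyTime T G : ℝ) L ∂(SimpleGraph.binomialRandom (Fin m) p) := by
  have h3 : ∫ G, (z - 10 / z * ((firstEmptyTime T G : ℝ) ^ 2 - 2 * z * firstEmptyTime T G + z ^ 2)
        - z / 40) ∂(SimpleGraph.binomialRandom (Fin m) p) ≤
      ∫ G, min (firstEmptyTime T G : ℝ) L ∂(SimpleGraph.binomialRandom (Fin m) p) := by
    refine integral_mono (integrable_binomialRandom p _) (integrable_binomialRandom p _) ?_
    intro G
    have h4 : 0 ≤ 10 / z * ((firstEmptyTime T G : ℝ) ^ 2 - 2 * z * firstEmptyTime T G + z ^ 2) := by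
      have : (firstEmptyTime T G : ℝ) ^ 2 - 2 * z * firstEmptyTime T G + z ^ 2 =
        ((firstEmptyTime T G : ℝ) - z) ^ 2 := by ring
      rw [this]
      positivity
    refine le_min ?_ (by dsimp only; linarith)
    have h5 : 0 ≤ 10 / z * ((z - firstEmptyTime T G) - z / 20) ^ 2 := by positivity
    have h6 : 10 / z * ((z - firstEmptyTime T G) - z / 20) ^ 2 =
        10 / z * ((firstEmptyTime T G : ℝ) ^ 2 - 2 * z * firstEmptyTime T G + z ^ 2)
          - (z - firstEmptyTime T G) + z / 40 := by
      field_simp; ring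
    dsimp only
    linarith
  rw [integral_sub (integrable_binomialRandom p _) (integrable_binomialRandom p _),
    integral_sub (integrable_binomialRandom p _) (integrable_binomialRandom p _),
    integral_const_mul,
    integral_add (integrable_binomialRandom p _) (integrable_binomialRandom p _),
    integral_sub (integrable_binomialRandom p _) (integrable_binomialRandom p _),
    integral_const_mul] at h3
  have hc : ∀ c : ℝ, ∫ _, c ∂(SimpleGraph.binomialRandom (Fin m) p) = c := fun c => by simp
  rw [hc, hc, hc] at h3
  have h4 := mul_le_mul_of_nonneg_left hvar (show 0 ≤ 10 / z by positivity)
  have h5 : 10 / z * (25 / 10000 * z ^ 2) = 25 / 1000 * z := by field_simp; norm_num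
  linarith

/-- The bound on the expected end of the component from Jensen's inequality alone. -/
theorem integral_firstEmptyTime_le_of_jensen (hm : 0 < m) (hmp : (m : ℝ) * p = 1 + ε)
    (hZ : ReachBound m ε p T Z) (he : 1 / 1000 ≤ ε) (he1 : ε ≤ 1) (hl : 1 ≤ ε ^ 3 * m)
    (hZ2 : Z ≤ 17 / 10 * (ε ^ 3 * m)) :
    ∫ G, (firstEmptyTime T G : ℝ) ∂(SimpleGraph.binomialRandom (Fin m) p) ≤
      2 * ε * m - 1 / 10000 / ε ^ 2 := by
  have he0 : 0 < ε := by linarith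
  have hm0 : (0 : ℝ) < m := by exact_mod_cast hm
  have hp0 : (0 : ℝ) < p := by
    by_contra h
    have := mul_nonpos_of_nonneg_of_nonpos hm0.le (not_lt.1 h)
    linarith
  obtain ⟨z, hz⟩ : ∃ z : ℝ, p * z = 2 * ε - p := ⟨(2 * ε - p) / p, by field_simp⟩
  have h1 := sq_integral_firstEmptyTime_le (m := m) (T := T) (p := p)
  have h2 := integral_firstEmptyTime_sq_sub_le hm hmp hZ hz
  set e := ∫ G, (firstEmptyTime T G : ℝ) ∂(SimpleGraph.binomialRandom (Fin m) p)
  set B := 2 * ε * m - 1 / 10000 / ε ^ 2 with hB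
  -- Here ε ≥ 1/1000 is used: the claimed ε⁻²/10000 is a small part of the gap of order ε²m between
  -- z and 2εm.
  have hc : 1 / 10000 / ε ^ 2 ≤ 1 / 10 * (ε ^ 2 * m) := by
    rw [div_le_iff₀ (by positivity)]
    nlinarith [mul_le_mul he hl zero_le_one he0.le]
  have hc2 : ε ^ 2 * m ≤ ε * m := by nlinarith [mul_nonneg he0.le hm0.le]
  have hB0 : 19 / 10 * (ε * m) ≤ B := by linarith
  have hBz : 18 / 10 * (ε ^ 2 * m) ≤ (m : ℝ) * p * (B - z) := by
    have h3 : (m : ℝ) * p * (B - z) = (1 + ε) * B - m * (2 * ε - p) := by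
      rw [mul_sub, ← hz, ← mul_assoc, hmp]
    have h4 : (1 + ε) * B ≥ (1 + ε) * (2 * ε * m) - 2 * (1 / 10 * (ε ^ 2 * m)) := by
      have : 0 ≤ 1 / 10 * (ε ^ 2 * m) := by positivity
      nlinarith
    rw [h3]
    nlinarith
  by_contra! hlt
  have hBz0 : 0 < B - z := by
    have h5 : 0 < 18 / 10 * (ε ^ 2 * m) := by positivity
    exact pos_of_mul_pos_right (h5.trans_le hBz) (by positivity)
  have h3 : p * (B * (B - z)) < 2 * Z := by
    have h5 : B * (B - z) < e * (e - z) :=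
      mul_lt_mul'' hlt (by linarith) ((by positivity : 0 ≤ 19 / 10 * (ε * m)).trans hB0) hBz0.le
    have h6 := mul_lt_mul_of_pos_left h5 hp0
    have h7 := mul_le_mul_of_nonneg_left (sub_le_sub_right h1 (z * e)) hp0.le
    nlinarith
  have h4 := mul_lt_mul_of_pos_left h3 hm0
  have h5 : 19 / 10 * (ε * m) * (18 / 10 * (ε ^ 2 * m)) ≤ B * (m * p * (B - z)) :=
    mul_le_mul hB0 hBz (by positivity) ((by positivity : 0 ≤ 19 / 10 * (ε * m)).trans hB0)
  have h6 := mul_le_mul_of_nonneg_left hZ2 hm0.le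
  have h7 : 0 < ε ^ 3 * m * m := by positivity
  nlinarith

/-- The balance: the gain is (5/2 · 95/100 - 158/100 - 5/1000)·gz = 0.79·gz, and gz ≥ (97/100)ε⁻²,
so about 0.766·ε⁻². The cost of Z and of the shift 20 is at most 0.63·ε⁻², and the rest covers the
claimed ε⁻²/10000. -/
theorem lt_of_gain {ε p z Ψ g κ Z τ L e M : ℝ} (he0 : 0 < ε) (he1 : ε ≤ 1 / 1000) (hp0 : 0 < p)
    (hp : p ≤ ε / 500000) (hz : 199 / 100 * (1 / ε ^ 2) ≤ z) (hΨz : 8 * Ψ = (2 * ε - p) * z)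
    (hΨ : 490 ≤ Ψ) (hZ1 : Z ≤ 6 / 10 / ε) (hZΨ : Z ≤ 6 / 1000 * Ψ) (hT0 : 0 ≤ τ)
    (hT : τ ≤ 1 / 10000 * z) (hL0 : 0 ≤ L) (hL : L ≤ z + 1) (hκ1 : 97 / 100 ≤ κ)
    (hg : g = z * κ / (16 * Ψ ^ 2)) (hM : 95 / 100 * z ≤ M)
    (hgain : e + 5 * g / 2 * M ≤ z + z / 4 * ((20 + Z) / Ψ) + 5 * g / 2 * (τ + ε * τ + Z) +
      3 * g / 2 * (1 + ε) * L * (1 + (20 + Z) / Ψ)) :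
    e < z - 1 / 10000 * (1 / ε ^ 2) := by
  have hei : 1000 ≤ 1 / ε := by rw [le_div_iff₀ he0]; linarith
  have hei2 : 1000 * (1 / ε) ≤ 1 / ε ^ 2 := by
    have : 1 / ε ^ 2 = 1 / ε * (1 / ε) := by field_simp
    rw [this]
    exact mul_le_mul_of_nonneg_right hei (by positivity)
  have hz0 : 0 < z := by linarith
  have hΨ0 : 0 < Ψ := by linarith
  have hg0 : 0 ≤ g := by
    have : 0 ≤ κ := by linarith
    rw [hg]; positivity
  have hgz : 97 / 100 * (1 / ε ^ 2) ≤ g * z := by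
    have h3 : g * z = κ * (4 / (2 * ε - p) ^ 2) := by
      have h4 : 16 * Ψ ^ 2 = (2 * ε - p) ^ 2 * z ^ 2 / 4 := by
        have : 16 * Ψ ^ 2 = (8 * Ψ) ^ 2 / 4 := by ring
        rw [this, hΨz]; ring
      have h5 : 2 * ε - p ≠ 0 := by
        have : 0 < 2 * ε - p := by linarith
        exact this.ne'
      rw [hg, h4]
      field_simp
    have h4 : 1 / ε ^ 2 ≤ 4 / (2 * ε - p) ^ 2 := by
      rw [div_le_div_iff₀ (by positivity) (pow_pos (by linarith) 2)]
      nlinarith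
    rw [h3]
    exact mul_le_mul hκ1 h4 (by positivity) (by linarith)
  have hs : (20 + Z) / Ψ ≤ 47 / 1000 := by
    rw [div_le_iff₀ hΨ0]; linarith
  have hA : z / 4 * ((20 + Z) / Ψ) ≤ 63 / 100 * (1 / ε ^ 2) := by
    have h3 : z / 4 * ((20 + Z) / Ψ) = 2 * (20 + Z) / (2 * ε - p) := by
      have h5 : 2 * ε - p ≠ 0 := by
        have : 0 < 2 * ε - p := by linarith
        exact this.ne'
      have h6 : Ψ = (2 * ε - p) * z / 8 := by linarith
      rw [h6]
      field_simp
      ring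
    rw [h3, div_le_iff₀ (by linarith)]
    have h4 : 63 / 100 * (1 / ε ^ 2) * (199 / 100 * ε) ≤ 63 / 100 * (1 / ε ^ 2) * (2 * ε - p) :=
      mul_le_mul_of_nonneg_left (by linarith) (by positivity)
    have h5 : 63 / 100 * (1 / ε ^ 2) * (199 / 100 * ε) = 63 * 199 / 10000 * (1 / ε) := by
      field_simp; norm_num
    have h6 : 6 / 10 / ε = 6 / 10 * (1 / ε) := by ring
    linarith
  have hB : 5 * g / 2 * (τ + ε * τ + Z) ≤ 5 / 1000 * (g * z) := by
    have h3 : τ + ε * τ + Z ≤ 2 / 1000 * z := by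
      have h4 : ε * τ ≤ 1 / 1000 * τ := mul_le_mul_of_nonneg_right he1 hT0
      have h6 : 6 / 10 / ε = 6 / 10 * (1 / ε) := by ring
      linarith
    have := mul_le_mul_of_nonneg_left h3 (show 0 ≤ 5 * g / 2 by positivity)
    linarith
  have hC : 3 * g / 2 * (1 + ε) * L * (1 + (20 + Z) / Ψ) ≤ 158 / 100 * (g * z) := by
    have h3 : (1 + ε) * L * (1 + (20 + Z) / Ψ) ≤
        1001 / 1000 * (1001 / 1000 * z) * (1047 / 1000) := by
      refine (mul_le_mul_of_nonneg_left (by linarith) (by positivity) :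
        _ ≤ (1 + ε) * L * (1047 / 1000)).trans ?_
      have h4 : (1 + ε) * L ≤ 1001 / 1000 * (1001 / 1000 * z) :=
        mul_le_mul (by linarith) (by linarith) (by positivity) (by norm_num)
      linarith
    have h4 := mul_le_mul_of_nonneg_left h3 (show 0 ≤ 3 * g / 2 by positivity)
    have h5 : 0 ≤ g * z := by positivity
    linarith
  have hD : 5 * g / 2 * (95 / 100 * z) ≤ 5 * g / 2 * M :=
    mul_le_mul_of_nonneg_left hM (by positivity)
  have hE : 0 < 1 / ε ^ 2 := by positivity
  linarith

set_option maxHeartbeats 800000 in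
/-- The expected end of the component stays below `z` when it is concentrated there, because of
the fluctuations of the exploration. -/
theorem integral_firstEmptyTime_le_of_gain (hm : 0 < m) (hmp : (m : ℝ) * p = 1 + ε)
    (hZ : ReachBound m ε p T Z) (he0 : 0 < ε) (he1 : ε ≤ 1 / 1000) (hl : 1 ≤ ε ^ 3 * m)
    (hT : (T : ℝ) ≤ 1 / 1000000000000 * (ε * m) + 1) (hZ1 : Z ≤ 6 / 10 / ε)
    (hZ2 : Z ≤ 29 / 10000 * (ε ^ 2 * m)) :
    ∫ G, (firstEmptyTime T G : ℝ) ∂(SimpleGraph.binomialRandom (Fin m) p) ≤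
      2 * ε * m - 1 / 10000 / ε ^ 2 := by
  have hm0 : (0 : ℝ) < m := by exact_mod_cast hm
  have hp0 : (0 : ℝ) < p := by
    by_contra h
    have := mul_nonpos_of_nonneg_of_nonpos hm0.le (not_lt.1 h)
    linarith
  obtain ⟨z, hz⟩ : ∃ z : ℝ, p * z = 2 * ε - p := ⟨(2 * ε - p) / p, by field_simp⟩
  -- sizes
  have hpe : (p : ℝ) ≤ 2 * ε ^ 3 := by
    have h1 : (p : ℝ) ≤ ε ^ 3 * m * p := le_mul_of_one_le_left hp0.le hl
    have h2 : ε ^ 3 * m * p = ε ^ 3 * (1 + ε) := by rw [mul_assoc, hmp]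
    nlinarith [pow_pos he0 3]
  have hpe2 : (p : ℝ) ≤ ε / 500000 := by
    have : ε ^ 2 ≤ 1 / 1000000 := by nlinarith
    have : ε * ε ^ 2 ≤ ε * (1 / 1000000) := mul_le_mul_of_nonneg_left this he0.le
    nlinarith
  have hem : 1 / ε ^ 2 ≤ ε * m := by
    rw [div_le_iff₀ (by positivity)]; linarith
  have hei : 1000 ≤ 1 / ε := by rw [le_div_iff₀ he0]; linarith
  have hei2 : 1000 * (1 / ε) ≤ 1 / ε ^ 2 := by
    have : 1 / ε ^ 2 = 1 / ε * (1 / ε) := by field_simp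
    rw [this]
    exact mul_le_mul_of_nonneg_right hei (by positivity)
  have hmz : (1 + ε) * z = 2 * ε * m - (1 + ε) := by
    calc (1 + ε) * z = m * (p * z) := by rw [← hmp]; ring
      _ = _ := by rw [hz, mul_sub, hmp]; ring
  have hz1 : z ≤ 2 * ε * m := by
    by_contra! h
    nlinarith [mul_pos he0 hm0]
  have hz2 : 199 / 100 * (ε * m) ≤ z := by
    by_contra! h
    have h1 : (1 + ε) * z < (1 + ε) * (199 / 100 * (ε * m)) :=
      mul_lt_mul_of_pos_left h (by linarith)
    have h2 : ε * (ε * m) ≤ 1 / 1000 * (ε * m) :=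
      mul_le_mul_of_nonneg_right he1 (by positivity)
    nlinarith
  have hz3 : 1990000 ≤ z := by linarith
  have hz0 : 0 < z := by linarith
  set Ψ := (p : ℝ) / 8 * z ^ 2 with hΨ
  have hΨz : 8 * Ψ = (2 * ε - p) * z := by rw [← hz, hΨ]; ring
  have hΨ1 : 49 / 100 * (ε ^ 2 * m) ≤ Ψ := by
    have h1 : 199 / 100 * ε * (199 / 100 * (ε * m)) ≤ (2 * ε - p) * z :=
      mul_le_mul (by linarith) hz2 (by positivity) (by linarith)
    have h2 : 0 < ε ^ 2 * m := by positivity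
    nlinarith
  have hΨ2 : 490 ≤ Ψ := by
    have : 1 / ε ≤ ε ^ 2 * m := by rw [div_le_iff₀ he0]; linarith
    linarith
  have hΨ0 : 0 < Ψ := by linarith
  have hZΨ : Z ≤ 6 / 1000 * Ψ := by linarith
  have h1 := sq_integral_firstEmptyTime_le (m := m) (T := T) (p := p)
  have h2 := integral_firstEmptyTime_sq_sub_le hm hmp hZ hz
  set e := ∫ G, (firstEmptyTime T G : ℝ) ∂(SimpleGraph.binomialRandom (Fin m) p) with he
  have hfin : 1 / 10000 / ε ^ 2 = 1 / 10000 * (1 / ε ^ 2) := by ring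
  -- If e is clearly below z, the claim is immediate. Otherwise the bound on E ζ(ζ - z) forces ζ to
  -- concentrate near z, so that almost z steps contribute to the gain.
  rcases le_or_gt e (999 / 1000 * z) with hez | hez
  · rw [hfin]; linarith
  set q := ∫ G, (firstEmptyTime T G : ℝ) ^ 2 ∂(SimpleGraph.binomialRandom (Fin m) p) with hq
  have hvar : q - 2 * z * e + z ^ 2 ≤ 25 / 10000 * z ^ 2 := by
    have h3 : p * (q - z * e) ≤ p * (15 / 10000 * z ^ 2) := by
      refine h2.trans ?_
      rw [hΨ] at hZΨ
      linarith
    have h4 := le_of_mul_le_mul_left h3 hp0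
    nlinarith
  set L := ⌈z⌉₊ with hL
  have hLz : z ≤ L := Nat.le_ceil z
  have hLz1 : (L : ℝ) ≤ z + 1 := (Nat.ceil_lt_add_one hz0.le).le
  have hTL : T < L := by
    have : (T : ℝ) < L := by linarith
    exact_mod_cast this
  have hmin := le_integral_min_firstEmptyTime hz0 hLz hvar
  set κ := (1 - (p : ℝ)) * (1 - 1 / (2 * 20)) with hκ
  have hκ1 : 97 / 100 ≤ κ := by rw [hκ]; linarith
  set g := z * κ / (16 * Ψ ^ 2) with hg
  have hgain := chainRun_gain hp0 p.2.2 he0.le hmp hZ (by norm_num : (1 : ℝ) ≤ 20) hz hz0 hΨ hg hTL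
  rw [← integral_firstEmptyTime hm p T (fun t => (t : ℝ) + 5 * g / 2 * min (t : ℝ) L),
    integral_add (integrable_binomialRandom p _) (integrable_binomialRandom p _),
    integral_const_mul, ← he] at hgain
  have hfinal := lt_of_gain he0 he1 hp0 hpe2 (by linarith) hΨz hΨ2 hZ1 hZΨ (Nat.cast_nonneg T)
    (by linarith) (Nat.cast_nonneg L) hLz1 hκ1 hg hmin hgain
  rw [hfin]
  linarith

/-- What remains is a choice of Z. For δεm ≤ 1 one has T = 1 and a single component. When ε < 1/1000
and ε³m ≥ 250, the bound of about 1/(2ε) is small against ε²m. For smaller ε³m it is not, and the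
bound of order √(δεm) replaces it; δ = 10⁻¹² is so small in order that √δ = 10⁻⁶ makes this
negligible. -/
theorem integral_componentSizeAtTime_le (hp : (p : ℝ) = (1 + ε) / m) (he0 : 0 < ε) (he1 : ε ≤ 1)
    (hl : 1 ≤ ε ^ 3 * m) :
    ∫ G, (componentSizeAtTime G (1 / 1000000000000 * ε * m) : ℝ)
      ∂(SimpleGraph.binomialRandom (Fin m) p) ≤ 2 * ε * m - 1 / 10000 / ε ^ 2 := by
  have hm0 : (0 : ℝ) < m := by
    rcases (Nat.cast_nonneg m : (0 : ℝ) ≤ m).eq_or_lt with h | h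
    · rw [← h] at hl; norm_num at hl
    · exact h
  have hm : 0 < m := by exact_mod_cast hm0
  have hmp : (m : ℝ) * p = 1 + ε := by rw [hp]; field_simp
  set x := 1 / 1000000000000 * ε * m with hx
  have hx0 : 0 < x := by positivity
  have hem : ε * m ≤ m := mul_le_of_le_one_left hm0.le he1
  have hxm : x ≤ m := by linarith
  set T := ⌈x⌉₊ with hT
  have hT0 : 0 < T := Nat.ceil_pos.2 hx0
  have hTm : T ≤ m := Nat.ceil_le.2 hxm
  have hT1 : (T : ℝ) ≤ x + 1 := (Nat.ceil_lt_add_one hx0.le).le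
  have hδ0 : (0 : ℝ) < 1 / 1000000000000 := by norm_num
  have hδ1 : (1 : ℝ) / 1000000000000 ≤ 1 / 1000 := by norm_num
  have hC : ∫ G, (componentSizeAtTime G x : ℝ) ∂(SimpleGraph.binomialRandom (Fin m) p) ≤
      ∫ G, (firstEmptyTime T G : ℝ) ∂(SimpleGraph.binomialRandom (Fin m) p) :=
    integral_mono (integrable_binomialRandom p _) (integrable_binomialRandom p _) fun G => by
      have h : componentSizeAtTime G x ≤ firstEmptyTime T G := componentSizeAtTime_le hx0 hxm
      exact Nat.cast_le.2 h
  refine hC.trans ?_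
  have hsup := reachBound_supercritical p.2.1 p.2.2 he0 he1 hmp hT0 hTm hδ0 hδ1 hT1
  have hone : T = 1 → ReachBound m ε p T (1 + 1 / 10) := fun h => by
    rw [h]; exact reachBound_one p.2.1 p.2.2 hmp hm (by norm_num)
  have hT1' : x ≤ 1 → T = 1 := fun h => le_antisymm (Nat.ceil_le.2 (by simpa using h)) hT0
  have hden : 1 + 1 / (2 * ε * (1 - 20 * (1 / 1000000000000))) ≤ 1 + 51 / 100 / ε := by
    rw [add_le_add_iff_left, div_le_div_iff₀ (by norm_num; positivity) he0]
    linarith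
  have hu : 1 / ε ≤ ε ^ 2 * m := by rw [div_le_iff₀ he0]; linarith
  have hdiv : ∀ a : ℝ, a / ε = a * (1 / ε) := fun a => by ring
  rcases le_or_gt (1 / 1000) ε with he | he
  · rcases le_or_gt x 1 with h | h
    · exact integral_firstEmptyTime_le_of_jensen hm hmp (hone (hT1' h)) he he1 hl (by linarith)
    · refine integral_firstEmptyTime_le_of_jensen hm hmp hsup he he1 hl (hden.trans ?_)
      have h2 : 1 / ε ≤ 1000 := by rw [div_le_iff₀ he0]; linarith
      have h3 : 1000000000000 ≤ ε * m := by linarith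
      have h4 : 1 / 1000000 * 1000000000000 ≤ ε ^ 2 * (ε * m) :=
        mul_le_mul (by nlinarith) h3 (by norm_num) (by positivity)
      rw [hdiv]
      linarith
  · have hei : 1000 ≤ 1 / ε := by rw [le_div_iff₀ he0]; linarith
    have hT2 : (T : ℝ) ≤ 1 / 1000000000000 * (ε * m) + 1 := by linarith
    rcases le_or_gt x 1 with h | h
    · refine integral_firstEmptyTime_le_of_gain hm hmp (hone (hT1' h)) he0 he.le hl hT2 ?_ ?_
      · rw [hdiv]; linarith
      · linarith
    rcases le_or_gt 250 (ε ^ 3 * m) with hlam | hlam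
    · refine integral_firstEmptyTime_le_of_gain hm hmp hsup he0 he.le hl hT2
        (hden.trans ?_) (hden.trans ?_)
      · rw [hdiv (51 / 100), hdiv (6 / 10)]; linarith
      · have : 250 * (1 / ε) ≤ ε ^ 2 * m := by
          rw [mul_one_div, div_le_iff₀ he0]; linarith
        rw [hdiv]; linarith
    · have hsq := reachBound_sqrt p.2.1 p.2.2 he0 he1 hmp hT0 hTm hδ0 hδ1 hT1 h.le
      have h2 : √(1 / 1000000000000 * ε * m) ≤ 1 / 1000000 * (ε ^ 2 * m) := by
        refine Real.sqrt_le_iff.2 ⟨by positivity, ?_⟩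
        have h3 : ε * m * 1 ≤ ε * m * (ε ^ 3 * m) := mul_le_mul_of_nonneg_left hl (by positivity)
        linarith
      have h3 : Real.exp 1 * √(1 / 1000000000000 * ε * m) ≤ 3 * (1 / 1000000 * (ε ^ 2 * m)) :=
        mul_le_mul (by linarith [Real.exp_one_lt_d9]) h2 (Real.sqrt_nonneg _) (by norm_num)
      have h4 : ε ^ 2 * m ≤ 250 * (1 / ε) := by
        rw [mul_one_div, le_div_iff₀ he0]; linarith
      refine integral_firstEmptyTime_le_of_gain hm hmp hsq he0 he.le hl hT2 ?_ ?_
      · rw [hdiv]; linarith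
      · linarith

end

/-! ### The main theorem. -/

theorem mainTheorem6 :
    ∃ δ c C : ℝ, 0 < δ ∧ δ < 1 / 10 ∧ 0 < c ∧ 0 < C ∧
      ∀ (m : ℕ) (ε : ℝ) (p : unitInterval),
        0 < ε → ε ≤ 1 → (p : ℝ) = (1 + ε) / m → 1 ≤ ε ^ 3 * m →
          (∫ G, (componentSizeAtTime G (δ * ε * m) : ℝ) ∂(SimpleGraph.binomialRandom (Fin m) p)
              ≤ 2 * ε * m - c * ε ^ (-2 : ℤ)) ∧
          ∀ k : ℕ, k = 2 ∨ k = 4 →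
            ∫ G, (sumOtherComponents G (δ * ε * m) k : ℝ) ∂(SimpleGraph.binomialRandom (Fin m) p)
              ≤ C * m * ε ^ (-2 * (k : ℤ) + 3) := by
  have hδ0 : (0 : ℝ) < 1 / 1000000000000 := by norm_num
  -- The exponents k = 2 and k = 4 correspond to j = k - 1 = 1 and 3.
  obtain ⟨C₁, hC₁, h₁⟩ := exists_sumOtherComponents_bound hδ0 (by norm_num) (j := 1) one_pos
  obtain ⟨C₃, hC₃, h₃⟩ := exists_sumOtherComponents_bound hδ0 (by norm_num) (j := 3) (by norm_num)
  refine ⟨1 / 1000000000000, 1 / 10000, C₁ + C₃, hδ0, by norm_num, by norm_num, by positivity,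
    fun m ε p he0 he1 hp hl => ⟨?_, ?_⟩⟩
  · refine (integral_componentSizeAtTime_le hp he0 he1 hl).trans_eq ?_
    rw [zpow_neg, div_eq_mul_inv (1 / 10000 : ℝ) (ε ^ 2)]
    norm_cast
  · rintro k (rfl | rfl)
    · refine (h₁ m ε p he0 he1 hp hl).trans ?_
      have e : ε ^ (-2 * ((2 : ℕ) : ℤ) + 3) = ε / ε ^ (2 * 1) := by
        norm_num
        field_simp
      rw [e]
      have : 0 ≤ C₃ * m * (ε / ε ^ (2 * 1)) := by positivity
      linarith
    · refine (h₃ m ε p he0 he1 hp hl).trans ?_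
      have e : ε ^ (-2 * ((4 : ℕ) : ℤ) + 3) = ε / ε ^ (2 * 3) := by
        norm_num
        field_simp
      rw [e]
      have : 0 ≤ C₁ * m * (ε / ε ^ (2 * 3)) := by positivity
      linarith
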